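/- For a semi-simplicial set $X_\bullet$ let $\widetilde C_*(X_\bullet)$ be its reduced real simplicial chain complex ($\widetilde C_q=\mathbb R[X_q]$ for $q\ge 0$, $\widetilde C_{-1}=\mathbb R$, $\partial_q=\sum_{i=0}^{q}(-1)^i d_i$ for $q\ge 1$, and $\partial_0$ sends every vertex to $1$), normed by the $\ell^1$-norm. The reduced simplicial bounded cohomology $\widetilde H^q_b(X_\bullet;\mathbb R)$ is the cohomology of the complex of bounded linear functionals on $\widetilde C_*(X_\bullet)$ (it is $0$ for $q<-1$). A partially ordered set is regarded as the semi-simplicial set of its finite flags $x_0<\dots<x_p$. **Theorem.** 1. (a) Let $F$ be a field and $n\ge 1$. Let $\mathcal T^n(F)$ be the Tits building of type $\mathtt A_{n-1}$, i.e. the poset of subspaces $0\ne W\subsetneq F^n$ under inclusion. Then $\widetilde H^q_b(\mathcal T^n(F);\mathbb R)=0$ for all $q\neq n-2$; in particular it vanishes for all $q\le n-3$. (b) Let $R$ be a unital ring and $n\ge 0$. Let $X^n_\bullet$ be the complex of $R$-split injections: its $p$-simplices are the split injective $R$-module homomorphisms $R^{p+1}\to R^n$, and the $i$-th face is precomposition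 with the inclusion $R^p=R^i\oplus 0\oplus R^{p-i}\to R^{p+1}$. Then $\widetilde H^q_b(X^n_\bullet;\mathbb R)=0$ for all $q\le n-\mathrm{sr}(R)-1$. Here $\mathrm{sr}(R)\in[1,\infty]$ is the Bass stable rank: the smallest $l\ge 1$ such that for every $l'\ge l+1$ and every unimodular column $(r_1,\dots,r_{l'})\in R^{l'}$ there are $t_1,\dots,t_{l'-1}\in R$ for which $(r_1+t_1r_{l'},\dots,r_{l'-1}+t_{l'-1}r_{l'})\in R^{l'-1}$ is unimodular, and $\infty$ if there is no such $l$ (in which case nothing is claimed). A column is unimodular if it is a basis of a free direct summand of rank one, and $R^n$ is the right module of columns. 2. (a) Let $F$ be a field and $n\ge 0$. Let $\mathcal T^{\omega,n}(F)$ be the Tits building of type $\mathtt C_n$, i.e. the poset of nonzero subspaces of $F^{2n}$ that are isotropic for the standard symplectic form, under inclusion. Then $\widetilde H^q_b(\mathcal T^{\omega,n}(F);\mathbb R)=0$ for all $q\ne n-1$; in particular it vanishes for all $q\le n-2$. (b) Let $R$ be $\mathbb Z$ or a field of characteristic zero, let $(\epsilon,\Lambda)$ be a form parameter for $R$, i.e.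 $\epsilon\in\{1,-1\}$ and $\Lambda\subseteq R$ is an additive subgroup with $\{a-\epsilon a: a\in R\}\subseteq\Lambda\subseteq\{a\in R: a+\epsilon a=0\}$, and let $n\ge 0$. Let $\mathcal H=R e\oplus R f$ be the hyperbolic $(\epsilon,\Lambda)$-quadratic module, with bilinear form $\lambda(e,f)=1$, $\lambda(f,e)=\epsilon$, $\lambda(e,e)=\lambda(f,f)=0$ and quadratic function $\mu(ae+bf)=ab+\Lambda\in R/\Lambda$, and equip $\mathcal H^{\oplus p}$ with the orthogonal sum structure. Let $X^n_\bullet$ be the complex of hyperbolic split injections: its $p$-simplices are the $R$-linear maps $\mathcal H^{\oplus p+1}\to\mathcal H^{\oplus n}$ preserving $\lambda$ and $\mu$, and the $i$-th face is precomposition with the inclusion $\mathcal H^{\oplus p}=\mathcal H^{\oplus i}\oplus 0\oplus\mathcal H^{\oplus p-i}\to\mathcal H^{\oplus p+1}$. Then $\widetilde H^q_b(X^n_\bullet;\mathbb R)=0$ for all $q\le\lfloor\frac{n-4}{2}\rfloor$. -/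

import Mathlib

open scoped Matrix

universe u v w

/-! ### Semi-simplicial sets -/

/-- A semi-simplicial set, given by its sets of simplices and its face maps. -/
structure SemiSimplicialSet where
  /-- the set of `p`-simplices -/
  obj : ℕ → Type u
  /-- the face maps `d_i : X_{p+1} → X_p`, for `0 ≤ i ≤ p + 1` -/
  face : ∀ {p : ℕ}, Fin (p + 2) → obj (p + 1) → obj p
  /-- the simplicial identities `d_i d_{j+1} = d_j d_i` for `i ≤ j` -/
  face_face : ∀ {p : ℕ} (i j : Fin (p + 2)), i ≤ j → ∀ s : obj (p + 2),
    face i (face j.succ s) = face j (face i.castSucc s)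

namespace SemiSimplicialSet

variable (X : SemiSimplicialSet.{u})

/-- The simplices of the augmentation of `X`, indexed by their number of vertices `k`: the
simplices of dimension `k - 1`, with a single simplex of dimension `-1`. -/
def augSimplex : ℕ → Type u
  | 0 => PUnit
  | k + 1 => X.obj k

/-- The face maps of the augmentation; every vertex has the `(-1)`-simplex as its only face. -/
def augFace : (k : ℕ) → Fin (k + 1) → X.augSimplex (k + 1) → X.augSimplex k
  | 0, _, _ => PUnit.unit
  | _ + 1, i, s => X.face i s

theorem augFace_augFace (k : ℕ) (i j : Fin (k + 1)) (h : i ≤ j) (s : X.augSimplex (k + 2)) :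
    X.augFace k i (X.augFace (k + 1) j.succ s)
      = X.augFace k j (X.augFace (k + 1) i.castSucc s) := by
  cases k with
  | zero => rfl
  | succ k => exact X.face_face i j h s

/-- The reduced real simplicial chain module in degree `k - 1`: the real vector space on the
`(k - 1)`-simplices, which is `ℝ` in degree `-1`. -/
abbrev RedChain (k : ℕ) : Type u := X.augSimplex k →₀ ℝ

/-- The `ℓ¹`-norm of a chain. -/
noncomputable def l1Norm {S : Type u} (c : S →₀ ℝ) : ℝ := c.sum fun _ a => |a|

/-- The boundary map from degree `k` to degree `k - 1` of the reduced chain complex. In degree `0`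
it maps every vertex to `1`. -/
noncomputable def redBoundary (k : ℕ) : X.RedChain (k + 1) →ₗ[ℝ] X.RedChain k :=
  Finsupp.lift (X.RedChain k) ℝ (X.augSimplex (k + 1))
    fun s => ∑ i : Fin (k + 1), Finsupp.single (X.augFace k i s) ((-1 : ℝ) ^ (i : ℕ))

theorem redBoundary_single (k : ℕ) (s : X.augSimplex (k + 1)) (a : ℝ) :
    X.redBoundary k (Finsupp.single s a)
      = a • ∑ i : Fin (k + 1), Finsupp.single (X.augFace k i s) ((-1 : ℝ) ^ (i : ℕ)) := by
  simp [redBoundary]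

theorem redBoundary_redBoundary (k : ℕ) (c : X.RedChain (k + 2)) :
    X.redBoundary k (X.redBoundary (k + 1) c) = 0 := by
  have key : (X.redBoundary k).comp (X.redBoundary (k + 1)) = 0 := by
    refine Finsupp.lhom_ext' fun s => LinearMap.ext_ring ?_
    simp only [LinearMap.comp_apply, Finsupp.lsingle_apply, redBoundary_single, one_smul, map_sum,
      LinearMap.zero_apply, Finset.smul_sum, Finsupp.smul_single, smul_eq_mul]
    rw [← Finset.sum_product', Finset.univ_product_univ]
    let P := Fin (k + 2) × Fin (k + 1)
    let S : Finset P := {ij : P | (ij.1 : ℕ) ≤ (ij.2 : ℕ)}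
    rw [← Finset.sum_add_sum_compl S, ← eq_neg_iff_add_eq_zero, ← Finset.sum_neg_distrib]
    let φ : ∀ ij : P, ij ∈ S → P := fun ij hij =>
      (ij.2.succ, Fin.castLT ij.1 (lt_of_le_of_lt (Finset.mem_filter.mp hij).right ij.2.is_lt))
    apply Finset.sum_bij φ
    · rintro ⟨i, j⟩ hij
      simp only [S, φ, Finset.compl_filter, Finset.mem_filter_univ, Fin.val_succ,
        Fin.val_castLT] at hij ⊢
      omega
    · rintro ⟨i, j⟩ hij ⟨i', j'⟩ hij' h
      have h1 := congrArg (fun z : P => (z.1 : ℕ)) h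
      have h2 := congrArg (fun z : P => (z.2 : ℕ)) h
      simp only [φ, Fin.val_succ, Fin.val_castLT] at h1 h2
      exact Prod.ext (Fin.ext h2) (Fin.ext (Nat.succ_injective h1))
    · rintro ⟨i', j'⟩ hij'
      simp only [S, Finset.compl_filter, Finset.mem_filter_univ, not_le] at hij'
      have hpos : i' ≠ 0 := by
        rintro rfl
        simp at hij'
      refine ⟨(j'.castSucc, i'.pred hpos), ?_, ?_⟩
      · simp only [S, Finset.mem_filter_univ, Fin.val_castSucc, Fin.val_pred]
        omega
      · simp [φ]
    · rintro ⟨i, j⟩ hij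
      simp only [S, Finset.mem_filter_univ] at hij
      have hi : (i : ℕ) < k + 1 := lt_of_le_of_lt hij j.is_lt
      have h := X.augFace_augFace k (i.castLT hi) j hij s
      rw [Fin.castSucc_castLT] at h
      simp only [φ]
      rw [h, ← Finsupp.single_neg, Fin.val_succ, Fin.val_castLT]
      congr 1
      ring
  exact LinearMap.congr_fun key c

theorem l1Norm_add_le {S : Type u} (c d : S →₀ ℝ) : l1Norm (c + d) ≤ l1Norm c + l1Norm d := by
  classical
  have h : ∀ e : S →₀ ℝ, e.support ⊆ c.support ∪ d.support →
      l1Norm e = ∑ s ∈ c.support ∪ d.support, |e s| := fun e he =>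
    Finsupp.sum_of_support_subset e he _ fun _ _ => abs_zero
  rw [h _ Finsupp.support_add, h c Finset.subset_union_left, h d Finset.subset_union_right,
    ← Finset.sum_add_distrib]
  exact Finset.sum_le_sum fun s _ => abs_add_le _ _

theorem l1Norm_sum_le {S : Type u} {ι : Type*} (t : Finset ι) (f : ι → (S →₀ ℝ)) :
    l1Norm (∑ i ∈ t, f i) ≤ ∑ i ∈ t, l1Norm (f i) := by
  classical
  induction t using Finset.induction_on with
  | empty => simp [l1Norm]
  | insert a t ha ih =>
    rw [Finset.sum_insert ha, Finset.sum_insert ha]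
    exact (l1Norm_add_le _ _).trans (by gcongr)

theorem l1Norm_redBoundary_le (k : ℕ) (c : X.RedChain (k + 1)) :
    l1Norm (X.redBoundary k c) ≤ (k + 1 : ℝ) * l1Norm c := by
  have h1 : X.redBoundary k c = ∑ s ∈ c.support, X.redBoundary k (Finsupp.single s (c s)) := by
    conv_lhs => rw [← Finsupp.sum_single c]
    rw [Finsupp.sum, map_sum]
  rw [h1]
  refine (l1Norm_sum_le _ _).trans ?_
  rw [l1Norm, Finsupp.sum, Finset.mul_sum]
  refine Finset.sum_le_sum fun s _ => ?_
  rw [redBoundary_single, Finset.smul_sum]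
  refine (l1Norm_sum_le _ _).trans (le_of_eq ?_)
  have h2 : ∀ i : Fin (k + 1),
      l1Norm (c s • Finsupp.single (X.augFace k i s) ((-1 : ℝ) ^ (i : ℕ))) = |c s| := fun i => by
    rw [l1Norm, Finsupp.smul_single, Finsupp.sum_single_index abs_zero]
    simp [abs_mul]
  rw [Finset.sum_congr rfl fun i _ => h2 i]
  simp

/-- The bounded cochains in degree `k - 1`: the linear functionals on the reduced chains that are
bounded for the `ℓ¹`-norm. -/
def redBoundedCochain (k : ℕ) : Submodule ℝ (X.RedChain k →ₗ[ℝ] ℝ) where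
  carrier := {φ | ∃ K : ℝ, ∀ c, |φ c| ≤ K * l1Norm c}
  zero_mem' := ⟨0, fun c => by simp⟩
  add_mem' := by
    rintro φ ψ ⟨K, hK⟩ ⟨L, hL⟩
    refine ⟨K + L, fun c => ?_⟩
    rw [LinearMap.add_apply, add_mul]
    exact (abs_add_le _ _).trans (add_le_add (hK c) (hL c))
  smul_mem' := by
    rintro a φ ⟨K, hK⟩
    refine ⟨|a| * K, fun c => ?_⟩
    rw [LinearMap.smul_apply, smul_eq_mul, abs_mul, mul_assoc]
    exact mul_le_mul_of_nonneg_left (hK c) (abs_nonneg a)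

/-- The coboundary map on cochains, the dual of the boundary map. -/
noncomputable def redCoboundary (k : ℕ) :
    (X.RedChain k →ₗ[ℝ] ℝ) →ₗ[ℝ] (X.RedChain (k + 1) →ₗ[ℝ] ℝ) :=
  LinearMap.lcomp ℝ ℝ (X.redBoundary k)

theorem redCoboundary_mem (k : ℕ) :
    ∀ φ ∈ X.redBoundedCochain k, X.redCoboundary k φ ∈ X.redBoundedCochain (k + 1) := by
  rintro φ ⟨K, hK⟩
  refine ⟨|K| * (k + 1), fun c => ?_⟩
  have hnn : 0 ≤ l1Norm (X.redBoundary k c) := Finset.sum_nonneg fun _ _ => abs_nonneg _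
  calc |φ (X.redBoundary k c)| ≤ K * l1Norm (X.redBoundary k c) := hK _
    _ ≤ |K| * l1Norm (X.redBoundary k c) := mul_le_mul_of_nonneg_right (le_abs_self K) hnn
    _ ≤ |K| * ((k + 1 : ℝ) * l1Norm c) :=
        mul_le_mul_of_nonneg_left (X.l1Norm_redBoundary_le k c) (abs_nonneg K)
    _ = |K| * (k + 1) * l1Norm c := by ring

/-- The bounded cocycles in degree `k - 1`. -/
noncomputable def redBoundedCocycles (k : ℕ) : Submodule ℝ (X.RedChain k →ₗ[ℝ] ℝ) :=
  X.redBoundedCochain k ⊓ LinearMap.ker (X.redCoboundary k)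

/-- The coboundaries of bounded cochains in degree `k - 1`. -/
noncomputable def redBoundedCoboundaries : (k : ℕ) → Submodule ℝ (X.RedChain k →ₗ[ℝ] ℝ)
  | 0 => ⊥
  | k + 1 => (X.redBoundedCochain k).map (X.redCoboundary k)

theorem redBoundedCoboundaries_le (k : ℕ) :
    X.redBoundedCoboundaries k ≤ X.redBoundedCocycles k := by
  cases k with
  | zero => exact bot_le
  | succ k =>
    rintro _ ⟨φ, hφ, rfl⟩
    refine ⟨X.redCoboundary_mem k φ hφ, LinearMap.mem_ker.2 (LinearMap.ext fun c => ?_)⟩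
    change φ (X.redBoundary k (X.redBoundary (k + 1) c)) = 0
    rw [redBoundary_redBoundary, map_zero]

/-- The reduced simplicial bounded cohomology of `X` with real coefficients in degree `k - 1`:
bounded cocycles modulo coboundaries of bounded cochains, formed as the image of the bounded
cocycles in the quotient of the space of all cochains by the coboundaries of bounded cochains. -/
abbrev RedBoundedCohomology (k : ℕ) : Type u :=
  (X.redBoundedCocycles k).map (X.redBoundedCoboundaries k).mkQ

/-- The reduced simplicial bounded cohomology of `X` with real coefficients vanishes in degree `q`.
The reduced complex is zero in degrees below `-1`. -/
def RedBoundedCohomologyVanishes (q : ℤ) : Prop :=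
  ∀ k : ℕ, (k : ℤ) = q + 1 → Subsingleton (X.RedBoundedCohomology k)

end SemiSimplicialSet

theorem Fin.succAbove_succ_succAbove {p : ℕ} (i j : Fin (p + 2)) (h : i ≤ j) (k : Fin (p + 1)) :
    j.succ.succAbove (i.succAbove k) = i.castSucc.succAbove (j.succAbove k) := by
  rcases i with ⟨i, _⟩
  rcases j with ⟨j, _⟩
  rcases k with ⟨k, _⟩
  simp only [Fin.mk_le_mk] at h
  simp only [Fin.succAbove, Fin.ext_iff, Fin.lt_def]
  split_ifs <;> simp at * <;> omega

/-! ### Order complexes and Tits buildings -/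

/-- The order complex of a partially ordered set: its `p`-simplices are the flags
`x_0 < ... < x_p`, and the `i`-th face omits `x_i`. -/
def orderComplex (P : Type u) [PartialOrder P] : SemiSimplicialSet.{u} where
  obj p := {s : Fin (p + 1) → P // StrictMono s}
  face i s := ⟨fun k => s.1 (i.succAbove k), s.2.comp (Fin.strictMono_succAbove i)⟩
  face_face i j h s := Subtype.ext <| funext fun k =>
    congrArg s.1 (Fin.succAbove_succ_succAbove i j h k)

/-- The Tits building of type `A_{n-1}` over `F`: the nonzero proper subspaces of `F^n`, ordered by
inclusion. -/
abbrev TitsBuildingA (F : Type u) [Field F] (n : ℕ) : Type u :=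
  {W : Submodule F (Fin n → F) // W ≠ ⊥ ∧ W ≠ ⊤}

/-- The Tits building of type `C_n` over `F`: the nonzero subspaces of `F^{2n}` that are isotropic
(the form vanishes identically on them) for the standard symplectic form, ordered by inclusion. -/
abbrev TitsBuildingC (F : Type u) [Field F] (n : ℕ) : Type u :=
  {W : Submodule F (Fin n ⊕ Fin n → F) //
    W ≠ ⊥ ∧ ∀ x ∈ W, ∀ y ∈ W, x ⬝ᵥ (Matrix.J (Fin n) F *ᵥ y) = 0}

/-! ### Coordinate inclusions -/

/-- The inclusion `M^p = M^i ⊕ 0 ⊕ M^{p-i} → M^{p+1}`, which puts a zero at the `i`-th place. -/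
def coordIncl (S : Type v) {M : Type u} [Semiring S] [AddCommMonoid M] [Module S M] {p : ℕ}
    (i : Fin (p + 1)) : (Fin p → M) →ₗ[S] (Fin (p + 1) → M) where
  toFun x := i.insertNth (α := fun _ => M) 0 x
  map_add' x y := by
    refine (Fin.insertNth_eq_iff.2 ⟨by simp, funext fun k => by simp [Fin.removeNth]⟩)
  map_smul' a x := by
    refine (Fin.insertNth_eq_iff.2 ⟨by simp, funext fun k => by simp [Fin.removeNth]⟩)

section coordIncl

variable (S : Type v) {M : Type u} [Semiring S] [AddCommMonoid M] [Module S M] {p : ℕ}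

@[simp] theorem coordIncl_same (i : Fin (p + 1)) (x : Fin p → M) : coordIncl S i x i = 0 :=
  Fin.insertNth_apply_same (α := fun _ => M) i 0 x

@[simp] theorem coordIncl_succAbove (i : Fin (p + 1)) (x : Fin p → M) (k : Fin p) :
    coordIncl S i x (i.succAbove k) = x k :=
  Fin.insertNth_apply_succAbove (α := fun _ => M) i 0 x k

theorem coordIncl_comp (i j : Fin (p + 2)) (h : i ≤ j) :
    (coordIncl S j.succ).comp (coordIncl S i : (Fin (p + 1) → M) →ₗ[S] _)
      = (coordIncl S i.castSucc).comp (coordIncl S j) := by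
  refine LinearMap.ext fun x => funext fun l => ?_
  simp only [LinearMap.comp_apply]
  rcases Fin.eq_self_or_eq_succAbove j.succ l with rfl | ⟨l, rfl⟩
  · have hj : j.succ = i.castSucc.succAbove j := by
      rw [Fin.succAbove_of_le_castSucc _ _ (Fin.castSucc_le_castSucc_iff.2 h)]
    rw [coordIncl_same]
    conv_rhs => rw [hj, coordIncl_succAbove, coordIncl_same]
  · rw [coordIncl_succAbove]
    rcases Fin.eq_self_or_eq_succAbove i l with rfl | ⟨l, rfl⟩
    · have hl : j.succ.succAbove l = l.castSucc :=
        Fin.succAbove_of_castSucc_lt _ _ (Fin.castSucc_lt_succ_iff.2 h)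
      rw [hl, coordIncl_same, coordIncl_same]
    · rw [Fin.succAbove_succ_succAbove i j h l, coordIncl_succAbove, coordIncl_succAbove,
        coordIncl_succAbove]

end coordIncl

/-! ### Stable rank and split injections

The columns `R^n` are right modules over the ring `R`, that is, modules over `Rᵐᵒᵖ`; thus `n × m`
matrices act on them from the left. -/

/-- A finite sequence of vectors is unimodular if it is an ordered basis of a free direct
summand. -/
def IsUnimodular (S : Type v) {M : Type u} [Ring S] [AddCommGroup M] [Module S M] {k : ℕ}
    (x : Fin k → M) : Prop :=
  LinearIndependent S x ∧ ∃ Q : Submodule S M, IsCompl (Submodule.span S (Set.range x)) Q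

/-- The stable range condition `(SR_l)`: for every `l' ≥ l`, every unimodular column of length `l'`
can be made into a unimodular column of length `l' - 1` by adding left multiples of its last entry
to the other entries, and dropping the last entry. (Here `l' = m + 1`.) -/
def StableRangeCondition (R : Type u) [Ring R] (l : ℕ) : Prop :=
  ∀ m : ℕ, l ≤ m + 1 → ∀ r : Fin (m + 1) → R, IsUnimodular Rᵐᵒᵖ ![r] →
    ∃ t : Fin m → R, IsUnimodular Rᵐᵒᵖ ![fun i : Fin m => r i.castSucc + t i * r (Fin.last m)]

/-- The Bass stable rank: the smallest `l ≥ 1` such that `R` satisfies `(SR_{l+1})`, and `∞` if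
there is none. -/
noncomputable def stableRank (R : Type u) [Ring R] : ℕ∞ :=
  ⨅ (l : ℕ) (_ : 1 ≤ l ∧ StableRangeCondition R (l + 1)), (l : ℕ∞)

/-- A linear map is split injective if it has a linear left inverse. -/
def IsSplitInjective {S : Type v} {M : Type u} {N : Type w} [Ring S] [AddCommGroup M]
    [AddCommGroup N] [Module S M] [Module S N] (f : M →ₗ[S] N) : Prop :=
  ∃ g : N →ₗ[S] M, g ∘ₗ f = LinearMap.id

theorem IsSplitInjective.comp_coordIncl {S : Type v} {M : Type u} {N : Type w} [Ring S]
    [AddCommGroup M] [AddCommGroup N] [Module S M] [Module S N] {p : ℕ}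
    {f : (Fin (p + 1) → M) →ₗ[S] N} (hf : IsSplitInjective f) (i : Fin (p + 1)) :
    IsSplitInjective (f ∘ₗ coordIncl S i) := by
  obtain ⟨g, hg⟩ := hf
  refine ⟨LinearMap.funLeft S M i.succAbove ∘ₗ g, LinearMap.ext fun x => funext fun k => ?_⟩
  have h : g (f (coordIncl S i x)) = coordIncl S i x := LinearMap.congr_fun hg _
  simp [LinearMap.funLeft_apply, h]

/-- The complex of `R`-split injections into `R^n`: its `p`-simplices are the split injective
`R`-linear maps `R^{p+1} → R^n`, and the `i`-th face is precomposition with the `i`-th coordinate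
inclusion `R^p → R^{p+1}`. -/
def splitInjectionComplex (R : Type u) [Ring R] (n : ℕ) : SemiSimplicialSet.{u} where
  obj p := {f : (Fin (p + 1) → R) →ₗ[Rᵐᵒᵖ] (Fin n → R) // IsSplitInjective f}
  face i f := ⟨f.1 ∘ₗ coordIncl Rᵐᵒᵖ i, f.2.comp_coordIncl i⟩
  face_face i j h f := Subtype.ext <| by
    simp only [LinearMap.comp_assoc]
    rw [coordIncl_comp Rᵐᵒᵖ i j h]

/-! ### Quadratic modules -/

/-- A form parameter `(ε, Λ)` for the commutative ring `R` with trivial involution. -/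
structure FormParameter (R : Type u) [CommRing R] where
  /-- the sign `ε` -/
  sign : R
  sign_eq : sign = 1 ∨ sign = -1
  /-- the additive subgroup `Λ` -/
  subgroup : AddSubgroup R
  sub_mem : ∀ a : R, a - sign * a ∈ subgroup
  add_eq_zero : ∀ a ∈ subgroup, a + sign * a = 0
  /-- This makes `a² · _` well defined on `R ⧸ Λ`. It is automatic over the integers and over
  fields of characteristic zero, see `FormParameter.ofInt` and `FormParameter.ofField`. -/
  sq_mul_mem : ∀ a : R, ∀ b ∈ subgroup, a ^ 2 * b ∈ subgroup

/-- Over the integers the last condition is automatic. -/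
def FormParameter.ofInt (e : ℤ) (he : e = 1 ∨ e = -1) (L : AddSubgroup ℤ)
    (h1 : ∀ a : ℤ, a - e * a ∈ L) (h2 : ∀ a ∈ L, a + e * a = 0) : FormParameter ℤ :=
  ⟨e, he, L, h1, h2, fun a b hb => by simpa using L.zsmul_mem hb (a ^ 2)⟩

/-- Over a field of characteristic zero the last condition is automatic. -/
def FormParameter.ofField {K : Type u} [Field K] [CharZero K] (e : K) (he : e = 1 ∨ e = -1)
    (L : AddSubgroup K) (h1 : ∀ a : K, a - e * a ∈ L) (h2 : ∀ a ∈ L, a + e * a = 0) :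
    FormParameter K :=
  ⟨e, he, L, h1, h2, fun a b hb => by
    rcases he with rfl | rfl
    · have h := h2 b hb
      rw [one_mul, ← two_mul] at h
      rw [(mul_eq_zero.1 h).resolve_left two_ne_zero, mul_zero]
      exact L.zero_mem
    · have h := h1 (a ^ 2 * b / 2)
      rwa [neg_one_mul, sub_neg_eq_add, add_halves] at h⟩

/-- The structure `(λ, μ)` of an `(ε, Λ)`-quadratic module on the `R`-module `M`. -/
structure QuadraticStructure {R : Type u} [CommRing R] (P : FormParameter R) (M : Type v)
    [AddCommGroup M] [Module R M] where
  /-- the bilinear form `λ` -/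
  lam : M →ₗ[R] M →ₗ[R] R
  lam_symm : ∀ x y, lam x y = P.sign * lam y x
  /-- the quadratic function `μ` -/
  mu : M → R ⧸ P.subgroup
  /-- `μ (a x) = a² μ (x)` -/
  mu_smul : ∀ (a : R) (x : M) (r : R), mu x = (r : R ⧸ P.subgroup) →
    mu (a • x) = ((a ^ 2 * r : R) : R ⧸ P.subgroup)
  mu_add : ∀ x y, mu (x + y) - mu x - mu y = (lam x y : R ⧸ P.subgroup)

namespace QuadraticStructure

variable {R : Type u} [CommRing R] {P : FormParameter R}
  {M : Type v} [AddCommGroup M] [Module R M] {N : Type w} [AddCommGroup N] [Module R N]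

/-- The hyperbolic module `R e ⊕ R f`, with `λ(e, f) = 1`, `λ(f, e) = ε`,
`λ(e, e) = λ(f, f) = 0` and `μ(e) = μ(f) = 0`; thus `μ(a e + b f) = a b`. -/
def hyperbolic (P : FormParameter R) : QuadraticStructure P (R × R) where
  lam := LinearMap.mk₂ R (fun x y => x.1 * y.2 + P.sign * (x.2 * y.1))
    (fun x x' y => by simp only [Prod.fst_add, Prod.snd_add]; ring)
    (fun a x y => by simp only [Prod.smul_fst, Prod.smul_snd, smul_eq_mul]; ring)
    (fun x y y' => by simp only [Prod.fst_add, Prod.snd_add]; ring)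
    (fun a x y => by simp only [Prod.smul_fst, Prod.smul_snd, smul_eq_mul]; ring)
  lam_symm x y := by
    have h : P.sign * P.sign = 1 := by rcases P.sign_eq with h | h <;> simp [h]
    simp only [LinearMap.mk₂_apply]
    linear_combination (-(x.1 * y.2)) * h
  mu x := ((x.1 * x.2 : R) : R ⧸ P.subgroup)
  mu_smul a x r h := by
    rw [QuotientAddGroup.eq] at h ⊢
    have h' := P.sq_mul_mem a _ h
    simp only [Prod.smul_fst, Prod.smul_snd, smul_eq_mul]
    convert h' using 1
    ring
  mu_add x y := by
    rw [← QuotientAddGroup.mk_sub, ← QuotientAddGroup.mk_sub, ← sub_eq_zero,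
      ← QuotientAddGroup.mk_sub, QuotientAddGroup.eq_zero_iff]
    convert P.sub_mem (x.2 * y.1) using 1
    simp only [LinearMap.mk₂_apply, Prod.fst_add, Prod.snd_add]
    ring

/-- The orthogonal direct sum of `n` copies of a quadratic module. -/
def power (Q : QuadraticStructure P M) (n : ℕ) : QuadraticStructure P (Fin n → M) where
  lam := LinearMap.mk₂ R (fun x y => ∑ i, Q.lam (x i) (y i))
    (fun x x' y => by simp [Finset.sum_add_distrib])
    (fun a x y => by simp [Finset.mul_sum])
    (fun x y y' => by simp [Finset.sum_add_distrib])
    (fun a x y => by simp [Finset.mul_sum])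
  lam_symm x y := by
    simp only [LinearMap.mk₂_apply, Finset.mul_sum]
    exact Finset.sum_congr rfl fun i _ => Q.lam_symm _ _
  mu x := ∑ i, Q.mu (x i)
  mu_smul a x r h := by
    choose s hs using fun i => QuotientAddGroup.mk_surjective (Q.mu (x i))
    have h1 : ∀ i, Q.mu ((a • x) i) = ((a ^ 2 * s i : R) : R ⧸ P.subgroup) := fun i =>
      Q.mu_smul a (x i) (s i) (hs i).symm
    have h2 : ((∑ i, s i : R) : R ⧸ P.subgroup) = (r : R ⧸ P.subgroup) := by
      rw [← h]
      simp only [← hs]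
      exact map_sum (QuotientAddGroup.mk' P.subgroup) s Finset.univ
    have h3 : ∑ i, ((a ^ 2 * s i : R) : R ⧸ P.subgroup)
        = ((∑ i, a ^ 2 * s i : R) : R ⧸ P.subgroup) :=
      (map_sum (QuotientAddGroup.mk' P.subgroup) (fun i => a ^ 2 * s i) Finset.univ).symm
    simp only [h1]
    rw [h3, ← Finset.mul_sum]
    rw [QuotientAddGroup.eq] at h2 ⊢
    have h4 := P.sq_mul_mem a _ h2
    convert h4 using 1
    ring
  mu_add x y := by
    simp only [LinearMap.mk₂_apply]
    rw [← Finset.sum_sub_distrib, ← Finset.sum_sub_distrib]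
    simp only [Pi.add_apply, Q.mu_add]
    exact (map_sum (QuotientAddGroup.mk' P.subgroup) (fun i => Q.lam (x i) (y i))
      Finset.univ).symm

/-- A linear map is a morphism of quadratic modules if it preserves `λ` and `μ`. -/
def IsMorphism (Q : QuadraticStructure P M) (Q' : QuadraticStructure P N) (f : M →ₗ[R] N) : Prop :=
  (∀ x y, Q'.lam (f x) (f y) = Q.lam x y) ∧ ∀ x, Q'.mu (f x) = Q.mu x

theorem mu_zero (Q : QuadraticStructure P M) : Q.mu 0 = 0 := by
  have h := Q.mu_add 0 0
  rw [add_zero, sub_self, zero_sub, map_zero] at h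
  exact neg_eq_zero.1 h

theorem isMorphism_coordIncl (Q : QuadraticStructure P M) {p : ℕ} (i : Fin (p + 1)) :
    IsMorphism (Q.power p) (Q.power (p + 1)) (coordIncl R i) := by
  constructor
  · intro x y
    simp only [power, LinearMap.mk₂_apply]
    rw [Fin.sum_univ_succAbove _ i]
    simp
  · intro x
    simp only [power]
    rw [Fin.sum_univ_succAbove _ i]
    simp [mu_zero]

theorem IsMorphism.comp_coordIncl {Q : QuadraticStructure P M} {Q' : QuadraticStructure P N} {p : ℕ}
    {f : (Fin (p + 1) → M) →ₗ[R] N} (hf : IsMorphism (Q.power (p + 1)) Q' f) (i : Fin (p + 1)) :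
    IsMorphism (Q.power p) Q' (f ∘ₗ coordIncl R i) :=
  ⟨fun x y => (hf.1 _ _).trans ((Q.isMorphism_coordIncl i).1 x y),
    fun x => (hf.2 _).trans ((Q.isMorphism_coordIncl i).2 x)⟩

/-- The complex of hyperbolic split injections into a quadratic module: with `H` the hyperbolic
module, its `p`-simplices are the morphisms of quadratic modules from `H^{p+1}`, and the `i`-th face
is precomposition with the `i`-th coordinate inclusion `H^p → H^{p+1}`. -/
def hyperbolicSplitInjectionComplex (Q : QuadraticStructure P N) :
    SemiSimplicialSet.{max u w} where
  obj p := {f : (Fin (p + 1) → R × R) →ₗ[R] N // IsMorphism ((hyperbolic P).power (p + 1)) Q f}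
  face i f := ⟨f.1 ∘ₗ coordIncl R i, f.2.comp_coordIncl i⟩
  face_face i j h f := Subtype.ext <| by
    simp only [LinearMap.comp_assoc]
    rw [coordIncl_comp R i j h]

end QuadraticStructure

/-! Bounded cohomology vanishes in all degrees `≤ q` as soon as the reduced chain complex is
*uniformly acyclic* in these degrees: every cycle `c` bounds a chain of norm at most `K * ‖c‖`. A
bounded cocycle then factors over a functional on the boundaries that is bounded for the norm of
chains, and it is a coboundary by the Hahn-Banach theorem (`ListChain.Models.vanishes`). Above its
dimension a complex has no chains at all. It remains to fill cycles with uniform bounds.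

In all four complexes a simplex is determined by the list of its vertices, so the chains are linear
combinations of lists from a family that is closed under sublists. Two tools suffice for filling.
Cycles on lists that can be extended by a common vertex `v` bound cones (`Fills.of_cone`). If the
link, within a set `X` of vertices, of every list that starts outside of `X` has bounded fillings in
the complementary degree, then cycles can be pushed into `X` with bounds (`fills_of_push`): one
removes the part of the cycle with the longest suffix outside of `X`, filling its coefficients in
the links of these suffixes.

* For the Tits buildings (`fills_flags_interval`, `fills_flags_isotropic`), let `H` be a hyperplane,
  respectively the orthogonal complement of a vector `v`. Subspaces that meet `H` trivially have
  links that are smaller buildings. The remaining subspaces are contracted by `W ≥ W ⊓ H ≤ H`,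
  respectively `W ≥ W ⊓ H ≤ (W ⊓ H) + v ≥ v`.
* For split injections, the lists are the unimodular ones. As in van der Kallen's work on linear
  groups one proves, by simultaneous induction on the rank (`exists_fills`), uniform acyclicity for
  the vectors of `N` and for those of `N ∪ (N + e)` that are unimodular together with a given list.
  The stable range condition provides coordinates in which a vector of the given list has a
  coordinate `1`, and projecting along this vector shortens the list.
* For hyperbolic split injections, the lists consist of orthogonal hyperbolic pairs. Cycles are
  pushed into the orthogonal complement of a pair `(e, f)`, where they bound a cone
  (`fills_hyperbolicLists`). The links are governed by the Witt index, which decreases by at most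
  one on passing to the kernel of a functional, by Euclidean division (`WittIndexGE.inf_ker`), and
  to the complement of a pair (`WittIndexGE.inf_perp`). Each vertex uses up two units of the Witt
  index, whence the slope `1 / 2`.
-/

/-! ### Chains on lists -/

open SemiSimplicialSet (l1Norm)

section Norm

variable {S T : Type u}

theorem l1Norm_nonneg (c : S →₀ ℝ) : 0 ≤ l1Norm c :=
  Finset.sum_nonneg fun _ _ => abs_nonneg _

@[simp] theorem l1Norm_zero : l1Norm (0 : S →₀ ℝ) = 0 := by simp [l1Norm]

@[simp] theorem l1Norm_single (s : S) (a : ℝ) : l1Norm (Finsupp.single s a) = |a| := by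
  simp [l1Norm]

theorem l1Norm_smul (a : ℝ) (c : S →₀ ℝ) : l1Norm (a • c) = |a| * l1Norm c := by
  rcases eq_or_ne a 0 with rfl | ha
  · simp
  · rw [l1Norm, l1Norm, Finsupp.sum_smul_index' (by simp), Finsupp.sum, Finsupp.sum,
      Finset.mul_sum]
    simp [abs_mul]

theorem l1Norm_neg (c : S →₀ ℝ) : l1Norm (-c) = l1Norm c := by
  rw [← neg_one_smul ℝ c, l1Norm_smul]; simp

theorem l1Norm_sub_le (c d : S →₀ ℝ) : l1Norm (c - d) ≤ l1Norm c + l1Norm d := by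
  rw [sub_eq_add_neg, ← l1Norm_neg d]
  exact SemiSimplicialSet.l1Norm_add_le _ _

theorem l1Norm_map_le_sum (f : (S →₀ ℝ) →ₗ[ℝ] (T →₀ ℝ)) (c : S →₀ ℝ) :
    l1Norm (f c) ≤ ∑ s ∈ c.support, |c s| * l1Norm (f (Finsupp.single s 1)) := by
  have h : f c = ∑ s ∈ c.support, c s • f (Finsupp.single s 1) := by
    conv_lhs => rw [← Finsupp.sum_single c]
    rw [Finsupp.sum, map_sum]
    refine Finset.sum_congr rfl fun s _ => ?_
    rw [← map_smul, Finsupp.smul_single_one]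
  rw [h]
  refine (SemiSimplicialSet.l1Norm_sum_le _ _).trans (Finset.sum_le_sum fun s _ => ?_)
  rw [l1Norm_smul]

/-- A linear map that is bounded by `B` on the basis elements occurring in `c` enlarges the norm
of `c` by a factor of at most `B`. -/
theorem l1Norm_map_le {f : (S →₀ ℝ) →ₗ[ℝ] (T →₀ ℝ)} {A : Set S} {B : ℝ}
    (hf : ∀ s ∈ A, l1Norm (f (Finsupp.single s 1)) ≤ B) {c : S →₀ ℝ}
    (hc : c ∈ Finsupp.supported ℝ ℝ A) : l1Norm (f c) ≤ B * l1Norm c := by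
  refine (l1Norm_map_le_sum f c).trans ?_
  rw [l1Norm, Finsupp.sum, Finset.mul_sum]
  refine Finset.sum_le_sum fun s hs => ?_
  rw [mul_comm B]
  exact mul_le_mul_of_nonneg_left (hf s (hc hs)) (abs_nonneg _)

theorem map_mem_supported {f : (S →₀ ℝ) →ₗ[ℝ] (T →₀ ℝ)} {A : Set S} {B : Set T}
    (hf : ∀ s ∈ A, f (Finsupp.single s 1) ∈ Finsupp.supported ℝ ℝ B) {c : S →₀ ℝ}
    (hc : c ∈ Finsupp.supported ℝ ℝ A) : f c ∈ Finsupp.supported ℝ ℝ B := by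
  rw [Finsupp.supported_eq_span_single] at hc
  refine Submodule.span_induction ?_ (by simp) (fun x y _ _ hx hy => ?_) (fun a x _ hx => ?_) hc
  · rintro _ ⟨s, hs, rfl⟩
    exact hf s hs
  · rw [map_add]; exact Submodule.add_mem _ hx hy
  · rw [map_smul]; exact Submodule.smul_mem _ _ hx

theorem map_eq_of_supported {M : Type*} [AddCommGroup M] [Module ℝ M]
    {f g : (S →₀ ℝ) →ₗ[ℝ] M} {A : Set S}
    (hf : ∀ s ∈ A, f (Finsupp.single s 1) = g (Finsupp.single s 1)) {c : S →₀ ℝ}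
    (hc : c ∈ Finsupp.supported ℝ ℝ A) : f c = g c := by
  rw [Finsupp.supported_eq_span_single] at hc
  refine Submodule.span_induction ?_ (by simp) (fun x y _ _ hx hy => ?_) (fun a x _ hx => ?_) hc
  · rintro _ ⟨s, hs, rfl⟩
    exact hf s hs
  · rw [map_add, map_add, hx, hy]
  · rw [map_smul, map_smul, hx]

theorem l1Norm_lmapDomain_le (f : S → T) (c : S →₀ ℝ) :
    l1Norm (Finsupp.lmapDomain ℝ ℝ f c) ≤ l1Norm c := by
  refine (l1Norm_map_le (A := Set.univ) (B := 1) (fun s _ => ?_) (by simp)).trans_eq (one_mul _)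
  simp

end Norm

namespace ListChain

variable {V : Type u} {W : Type u}

/-- The boundary of a list: the alternating sum of the lists obtained by omitting one entry. The
empty list plays the role of the simplex of dimension `-1`. -/
noncomputable def listBoundary : List V → (List V →₀ ℝ)
  | [] => 0
  | v :: l => Finsupp.single l 1 - Finsupp.lmapDomain ℝ ℝ (List.cons v) (listBoundary l)

/-- The boundary map on formal linear combinations of lists. -/
noncomputable def boundary : (List V →₀ ℝ) →ₗ[ℝ] (List V →₀ ℝ) :=
  Finsupp.linearCombination ℝ listBoundary

@[simp] theorem boundary_single (l : List V) :
    boundary (Finsupp.single l (1 : ℝ)) = listBoundary l := by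
  simp [boundary]

theorem boundary_cons (v : V) (c : List V →₀ ℝ) :
    boundary (Finsupp.lmapDomain ℝ ℝ (List.cons v) c)
      = c - Finsupp.lmapDomain ℝ ℝ (List.cons v) (boundary c) := by
  have h : boundary ∘ₗ Finsupp.lmapDomain ℝ ℝ (List.cons v)
      = LinearMap.id - Finsupp.lmapDomain ℝ ℝ (List.cons v) ∘ₗ boundary := by
    refine Finsupp.lhom_ext' fun l => LinearMap.ext_ring ?_
    simp [listBoundary]
  exact LinearMap.congr_fun h c

theorem boundary_boundary (c : List V →₀ ℝ) : boundary (boundary c) = 0 := by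
  have h : (boundary ∘ₗ boundary : (List V →₀ ℝ) →ₗ[ℝ] _) = 0 := by
    refine Finsupp.lhom_ext' fun l => LinearMap.ext_ring ?_
    simp only [LinearMap.comp_apply, Finsupp.lsingle_apply, boundary_single,
      LinearMap.zero_apply]
    induction l with
    | nil => simp [listBoundary]
    | cons a l ih => rw [listBoundary, map_sub, boundary_cons, boundary_single, ih]; simp
  exact LinearMap.congr_fun h c

theorem lmapDomain_lmapDomain {α β γ : Type*} (f : α → β) (g : β → γ) (c : α →₀ ℝ) :
    Finsupp.lmapDomain ℝ ℝ g (Finsupp.lmapDomain ℝ ℝ f c)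
      = Finsupp.lmapDomain ℝ ℝ (fun x => g (f x)) c :=
  (Finsupp.mapDomain_comp (f := f) (g := g)).symm

theorem listBoundary_append (x s : List V) :
    listBoundary (x ++ s) = Finsupp.lmapDomain ℝ ℝ (· ++ s) (listBoundary x)
      + (-1 : ℝ) ^ x.length • Finsupp.lmapDomain ℝ ℝ (x ++ ·) (listBoundary s) := by
  induction x with
  | nil =>
    simp only [listBoundary, map_zero, List.nil_append, List.length_nil, pow_zero, one_smul,
      zero_add]
    exact Finsupp.mapDomain_id.symm
  | cons a x ih =>
    simp only [List.cons_append, listBoundary, ih, map_add, map_sub, map_smul,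
      lmapDomain_lmapDomain, List.length_cons, pow_succ]
    simp only [Finsupp.lmapDomain_apply, Finsupp.mapDomain_single]
    rw [mul_neg_one, neg_smul]
    abel

theorem boundary_map (f : V → W) (c : List V →₀ ℝ) :
    boundary (Finsupp.lmapDomain ℝ ℝ (List.map f) c)
      = Finsupp.lmapDomain ℝ ℝ (List.map f) (boundary c) := by
  have h : boundary ∘ₗ Finsupp.lmapDomain ℝ ℝ (List.map f)
      = Finsupp.lmapDomain ℝ ℝ (List.map f) ∘ₗ boundary := by
    refine Finsupp.lhom_ext' fun l => LinearMap.ext_ring ?_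
    simp only [LinearMap.comp_apply, Finsupp.lsingle_apply, boundary_single,
      Finsupp.lmapDomain_apply, Finsupp.mapDomain_single]
    induction l with
    | nil => simp [listBoundary]
    | cons a l ih =>
      rw [List.map_cons, listBoundary, listBoundary, ih]
      simp only [← Finsupp.lmapDomain_apply ℝ ℝ, map_sub, lmapDomain_lmapDomain, List.map_cons]
      simp
  exact LinearMap.congr_fun h c

theorem listBoundary_reverse (l : List V) :
    listBoundary l.reverse
      = (-1 : ℝ) ^ (l.length + 1) • Finsupp.lmapDomain ℝ ℝ List.reverse (listBoundary l) := by
  induction l with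
  | nil => simp [listBoundary]
  | cons a l ih =>
    rw [List.reverse_cons, listBoundary_append, ih]
    simp only [listBoundary, map_sub, map_smul, map_zero, sub_zero, lmapDomain_lmapDomain,
      List.length_cons, List.length_reverse, List.reverse_cons]
    simp only [Finsupp.lmapDomain_apply, Finsupp.mapDomain_single, List.append_nil, pow_succ]
    simp only [mul_neg_one, neg_neg, smul_sub, neg_smul]
    abel

theorem listBoundary_mem (l : List V) :
    listBoundary l ∈ Finsupp.supported ℝ ℝ {l' | l'.Sublist l ∧ l'.length + 1 = l.length} := by
  induction l with
  | nil => exact Submodule.zero_mem _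
  | cons a l ih =>
    refine Submodule.sub_mem _ (Finsupp.single_mem_supported ℝ _ ⟨l.sublist_cons_self a, rfl⟩) ?_
    refine map_mem_supported (fun l' hl' => ?_) ih
    rw [Finsupp.lmapDomain_apply, Finsupp.mapDomain_single]
    exact Finsupp.single_mem_supported ℝ _ ⟨hl'.1.cons_cons a, by simp [← hl'.2]⟩

theorem l1Norm_listBoundary_le (l : List V) : l1Norm (listBoundary l) ≤ l.length := by
  induction l with
  | nil => simp [listBoundary]
  | cons a l ih =>
    refine (l1Norm_sub_le _ _).trans ?_
    have := l1Norm_lmapDomain_le (List.cons a) (listBoundary l)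
    simp only [l1Norm_single, List.length_cons, abs_one, Nat.cast_add, Nat.cast_one]
    linarith

/-- The chains of length `k` on a family `F` of lists; these have degree `k - 1`. -/
def chains (F : Set (List V)) (k : ℕ) : Submodule ℝ (List V →₀ ℝ) :=
  Finsupp.supported ℝ ℝ {l | l ∈ F ∧ l.length = k}

/-- A family of lists is closed if it contains all sublists of its members. -/
def Closed (F : Set (List V)) : Prop := ∀ l ∈ F, ∀ l', l'.Sublist l → l' ∈ F

theorem chains_mono {F G : Set (List V)} (h : F ⊆ G) (k : ℕ) : chains F k ≤ chains G k :=
  Finsupp.supported_mono fun _ hl => ⟨h hl.1, hl.2⟩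

theorem boundary_mem_chains {F : Set (List V)} (hF : Closed F) {k : ℕ} {c : List V →₀ ℝ}
    (hc : c ∈ chains F (k + 1)) : boundary c ∈ chains F k := by
  refine map_mem_supported (fun l hl => ?_) hc
  rw [boundary_single]
  have h : {l' | l'.Sublist l ∧ l'.length + 1 = l.length} ⊆ {l' | l' ∈ F ∧ l'.length = k} :=
    fun l' hl' => ⟨hF l hl.1 l' hl'.1, by
      have h1 := hl'.2
      have h2 := hl.2
      omega⟩
  exact Finsupp.supported_mono h (listBoundary_mem l)

theorem l1Norm_boundary_le {F : Set (List V)} {k : ℕ} {c : List V →₀ ℝ} (hc : c ∈ chains F k) :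
    l1Norm (boundary c) ≤ k * l1Norm c := by
  refine l1Norm_map_le (fun l hl => ?_) hc
  rw [boundary_single, ← hl.2]
  exact l1Norm_listBoundary_le l

/-- `Fills G F k K`: every cycle of length `k` on `G` bounds a chain on `F` whose norm is at most
`K` times the norm of the cycle. For `G = F` this says that the reduced homology of `F` vanishes in
degree `k - 1`, with a uniform bound on fillings. -/
def Fills (G F : Set (List V)) (k : ℕ) (K : ℝ) : Prop :=
  ∀ c ∈ chains G k, boundary c = 0 →
    ∃ b ∈ chains F (k + 1), boundary b = c ∧ l1Norm b ≤ K * l1Norm c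

theorem Fills.mono {G G' F F' : Set (List V)} {k : ℕ} {K K' : ℝ} (h : Fills G F k K)
    (hG : G' ⊆ G) (hF : F ⊆ F') (hK : K ≤ K') : Fills G' F' k K' := by
  intro c hc hc0
  obtain ⟨b, hb, h1, h2⟩ := h c (chains_mono hG k hc) hc0
  exact ⟨b, chains_mono hF _ hb, h1,
    h2.trans (mul_le_mul_of_nonneg_right hK (l1Norm_nonneg c))⟩

/-- Maps of vertices transport fillings, as soon as their composite fixes the vertices that
occur. -/
theorem Fills.of_retract {G F : Set (List V)} {G' F' : Set (List W)} {k : ℕ} {K : ℝ}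
    (h : Fills G' F' k K) (f : V → W) (g : W → V) (hf : ∀ l ∈ G, l.map f ∈ G')
    (hg : ∀ l ∈ F', l.map g ∈ F) (hfg : ∀ l ∈ G, ∀ v ∈ l, g (f v) = v) (hK : 0 ≤ K) :
    Fills G F k K := by
  intro c hc hc0
  obtain ⟨b, hb, hb1, hb2⟩ := h (Finsupp.lmapDomain ℝ ℝ (List.map f) c)
    (map_mem_supported (fun l hl => by
      rw [Finsupp.lmapDomain_apply, Finsupp.mapDomain_single]
      exact Finsupp.single_mem_supported ℝ _ ⟨hf l hl.1, by simpa using hl.2⟩) hc)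
    (by rw [boundary_map, hc0, map_zero])
  refine ⟨Finsupp.lmapDomain ℝ ℝ (List.map g) b, map_mem_supported (fun l hl => by
      rw [Finsupp.lmapDomain_apply, Finsupp.mapDomain_single]
      exact Finsupp.single_mem_supported ℝ _ ⟨hg l hl.1, by simpa using hl.2⟩) hb, ?_, ?_⟩
  · rw [boundary_map, hb1, lmapDomain_lmapDomain]
    refine (map_eq_of_supported (g := LinearMap.id) (fun l hl => ?_) hc)
    have : List.map (g ∘ f) l = l := by
      conv_rhs => rw [← List.map_id l]
      exact List.map_congr_left fun v hv => hfg l hl.1 v hv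
    simp [this]
  · exact (l1Norm_lmapDomain_le _ _).trans (hb2.trans
      (mul_le_mul_of_nonneg_left (l1Norm_lmapDomain_le _ _) hK))

/-- Reversing lists changes the boundary only by a sign. -/
theorem Fills.reverse {G F : Set (List V)} {k : ℕ} {K : ℝ} (h : Fills G F k K) (hK : 0 ≤ K) :
    Fills {l | l.reverse ∈ G} {l | l.reverse ∈ F} k K := by
  have key : ∀ (E : Set (List V)) (m : ℕ), ∀ c ∈ chains E m,
      boundary (Finsupp.lmapDomain ℝ ℝ List.reverse c)
        = (-1 : ℝ) ^ (m + 1) • Finsupp.lmapDomain ℝ ℝ List.reverse (boundary c) := by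
    intro E m c hc
    refine map_eq_of_supported (f := boundary ∘ₗ Finsupp.lmapDomain ℝ ℝ List.reverse)
      (g := (-1 : ℝ) ^ (m + 1) • (Finsupp.lmapDomain ℝ ℝ List.reverse ∘ₗ boundary))
      (fun l hl => ?_) hc
    have := listBoundary_reverse l
    rw [hl.2] at this
    simpa using this
  intro c hc hc0
  obtain ⟨b, hb, hb1, hb2⟩ := h (Finsupp.lmapDomain ℝ ℝ List.reverse c)
    (map_mem_supported (fun l hl => by
      rw [Finsupp.lmapDomain_apply, Finsupp.mapDomain_single]
      exact Finsupp.single_mem_supported ℝ _ ⟨hl.1, by simpa using hl.2⟩) hc)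
    (by rw [key _ _ c hc, hc0, map_zero, smul_zero])
  refine ⟨(-1 : ℝ) ^ k • Finsupp.lmapDomain ℝ ℝ List.reverse b,
    Submodule.smul_mem _ _ (map_mem_supported (fun l hl => by
      rw [Finsupp.lmapDomain_apply, Finsupp.mapDomain_single]
      exact Finsupp.single_mem_supported ℝ _
        ⟨by simpa using hl.1, by simpa using hl.2⟩) hb), ?_, ?_⟩
  · have h1 : (-1 : ℝ) ^ k * (-1 : ℝ) ^ (k + 1 + 1) = 1 := by
      rw [← pow_add]; exact Even.neg_one_pow ⟨k + 1, by ring⟩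
    rw [map_smul, key _ _ b hb, hb1, smul_smul, h1, one_smul, lmapDomain_lmapDomain]
    simp only [List.reverse_reverse]
    exact Finsupp.mapDomain_id
  · rw [l1Norm_smul, abs_pow, abs_neg, abs_one, one_pow, one_mul]
    exact (l1Norm_lmapDomain_le _ _).trans (hb2.trans
      (mul_le_mul_of_nonneg_left (l1Norm_lmapDomain_le _ _) hK))

/-- If prepending the vertex `v` takes lists in `G` to lists in `F`, then all cycles on `G` bound
cones on `F`. -/
theorem Fills.of_cone {G F : Set (List V)} (v : V) (h : ∀ l ∈ G, v :: l ∈ F) (k : ℕ) :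
    Fills G F k 1 := by
  intro c hc hc0
  refine ⟨Finsupp.lmapDomain ℝ ℝ (List.cons v) c, map_mem_supported (fun l hl => ?_) hc, ?_, ?_⟩
  · rw [Finsupp.lmapDomain_apply, Finsupp.mapDomain_single]
    exact Finsupp.single_mem_supported ℝ _ ⟨h l hl.1, by simpa using hl.2⟩
  · rw [boundary_cons, hc0, map_zero, sub_zero]
  · rw [one_mul]; exact l1Norm_lmapDomain_le _ _

theorem Fills.of_isEmpty {G F : Set (List V)} (h : ∀ l, l ∉ G) (k : ℕ)
    (K : ℝ) : Fills G F k K := by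
  intro c hc _
  have hc0 : c = 0 := by
    rw [← Finsupp.support_eq_empty, Finset.eq_empty_iff_forall_notMem]
    exact fun l hl => h l (hc hl).1
  exact ⟨0, Submodule.zero_mem _, by rw [hc0, map_zero], by simp [hc0]⟩

theorem Fills.zero_of_mem {G F : Set (List V)} {a : V} (h : [a] ∈ F) :
    Fills G F 0 1 := by
  intro c hc hc0
  refine Fills.of_cone (G := {[]}) (F := F) a (by simpa using h) 0 c ?_ hc0
  intro l hl
  have hl0 : l.length = 0 := (hc hl).2
  exact ⟨List.length_eq_zero_iff.1 hl0, hl0⟩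

/-- A version of `Fills.of_cone` for families in which the apex `v` may already occur, but only as
the first entry of a list. -/
theorem Fills.of_first {F : Set (List V)} (v : V)
    (h : ∀ l ∈ F, v ∉ l → v :: l ∈ F) (hv : ∀ l, v :: l ∈ F → v ∉ l)
    (hv' : ∀ a l, a :: l ∈ F → a ≠ v → v ∉ l) (k : ℕ) :
    Fills F F k 1 := by
  classical
  -- The contracting homotopy prepends `v` where this is possible.
  let s : (List V →₀ ℝ) →ₗ[ℝ] (List V →₀ ℝ) := Finsupp.linearCombination ℝ fun l =>
    if l.head? = some v then 0 else Finsupp.single (v :: l) 1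
  have hs : ∀ l, v ∉ l → s (Finsupp.single l 1) = Finsupp.single (v :: l) 1 := fun l hl => by
    have : l.head? ≠ some v := fun h => hl (List.mem_of_mem_head? h)
    simp [s, this]
  have hs' : ∀ l, s (Finsupp.single (v :: l) 1) = 0 := fun l => by simp [s]
  have key : ∀ c ∈ chains F k, boundary (s c) + s (boundary c) = c := by
    intro c hc
    refine map_eq_of_supported (f := boundary ∘ₗ s + s ∘ₗ boundary) (g := LinearMap.id)
      (fun l hl => ?_) hc
    simp only [LinearMap.add_apply, LinearMap.comp_apply, boundary_single, LinearMap.id_apply]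
    by_cases hvl : v ∈ l
    · obtain ⟨a, l, rfl⟩ := List.exists_cons_of_ne_nil (List.ne_nil_of_mem hvl)
      have hav : a = v := by
        by_contra hne
        rcases List.mem_cons.1 hvl with h1 | h1
        · exact hne h1.symm
        · exact hv' a l hl.1 hne h1
      subst hav
      rw [hs', map_zero, zero_add, listBoundary, map_sub, hs _ (hv l hl.1), sub_eq_self]
      refine map_eq_of_supported (f := s ∘ₗ Finsupp.lmapDomain ℝ ℝ (List.cons a)) (g := 0)
        (A := Set.univ) (fun l' _ => ?_) (by simp)
      simp [hs']
    · have h1 : s (listBoundary l) = Finsupp.lmapDomain ℝ ℝ (List.cons v) (listBoundary l) := by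
        refine map_eq_of_supported (fun l' hl' => ?_) (listBoundary_mem l)
        rw [hs l' fun h => hvl (hl'.1.subset h)]
        simp
      rw [hs l hvl, h1, boundary_single, listBoundary, sub_add_cancel]
  intro c hc hc0
  refine ⟨s c, map_mem_supported (fun l hl => ?_) hc, ?_, l1Norm_map_le (fun l hl => ?_) hc⟩
  · by_cases hvl : l.head? = some v
    · simp [s, hvl]
    · have hvl' : v ∉ l := fun hm => by
        rcases l with _ | ⟨a, l⟩
        · simp at hm
        · have hne : a ≠ v := fun h => hvl (by simp [h])
          rcases List.mem_cons.1 hm with h1 | h1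
          · exact hne h1.symm
          · exact hv' a l hl.1 hne h1
      rw [hs l hvl']
      exact Finsupp.single_mem_supported ℝ _ ⟨h l hl.1 hvl', by simpa using hl.2⟩
  · simpa [hc0] using key c hc
  · by_cases hvl : l.head? = some v <;> simp [s, hvl]

/-! ### Pushing cycles into a set of vertices -/

/-- The lists with entries in `X` that can be put in front of `s` within the family `F`. -/
def link (F : Set (List V)) (X : Set V) (s : List V) : Set (List V) :=
  {x | (∀ a ∈ x, a ∈ X) ∧ x ++ s ∈ F}

/-- The lists in `F` with entries in `X`. -/
def within (F : Set (List V)) (X : Set V) : Set (List V) := {l | l ∈ F ∧ ∀ a ∈ l, a ∈ X}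

section Suffix

open Classical in
/-- The longest initial segment of a list with entries in `X`. -/
noncomputable def prefixIn (X : Set V) (l : List V) : List V := l.takeWhile (· ∈ X)

open Classical in
/-- What remains of a list after its longest initial segment with entries in `X`. -/
noncomputable def suffixOut (X : Set V) (l : List V) : List V := l.dropWhile (· ∈ X)

variable {X : Set V}

theorem prefixIn_append_suffixOut (X : Set V) (l : List V) :
    prefixIn X l ++ suffixOut X l = l := List.takeWhile_append_dropWhile

theorem mem_of_mem_prefixIn {l : List V} {a : V} (h : a ∈ prefixIn X l) : a ∈ X := by
  simpa using List.mem_takeWhile_imp h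

theorem suffixOut_append {x : List V} (hx : ∀ a ∈ x, a ∈ X) (t : List V) :
    suffixOut X (x ++ t) = suffixOut X t := by
  induction x with
  | nil => rfl
  | cons a x ih =>
    have ha : a ∈ X := hx a (by simp)
    simp only [suffixOut, List.cons_append, List.dropWhile_cons, ha, decide_true, if_true]
    exact ih fun b hb => hx b (by simp [hb])

theorem prefixIn_append {x : List V} (hx : ∀ a ∈ x, a ∈ X) (t : List V) :
    prefixIn X (x ++ t) = x ++ prefixIn X t := by
  induction x with
  | nil => rfl
  | cons a x ih =>
    have ha : a ∈ X := hx a (by simp)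
    simp only [prefixIn, List.cons_append, List.takeWhile_cons, ha, decide_true, if_true]
    rw [List.cons_inj_right]
    exact ih fun b hb => hx b (by simp [hb])

theorem length_suffixOut_le (X : Set V) (l : List V) : (suffixOut X l).length ≤ l.length := by
  have h := congrArg List.length (prefixIn_append_suffixOut X l)
  rw [List.length_append] at h
  omega

theorem suffixOut_suffixOut (X : Set V) (l : List V) :
    suffixOut X (suffixOut X l) = suffixOut X l := by
  induction l with
  | nil => rfl
  | cons a l ih =>
    by_cases ha : a ∈ X
    · simpa [suffixOut, List.dropWhile_cons, ha] using ih
    · simp [suffixOut, ha]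

theorem prefixIn_suffixOut (X : Set V) (l : List V) : prefixIn X (suffixOut X l) = [] := by
  have h := prefixIn_append_suffixOut X (suffixOut X l)
  rw [suffixOut_suffixOut] at h
  simpa using h

theorem notMem_of_suffixOut_eq_cons {l t : List V} {a : V} (h : suffixOut X l = a :: t) :
    a ∉ X := fun ha => by
  have := prefixIn_suffixOut X l
  rw [h] at this
  simp [prefixIn, ha] at this

end Suffix

open Classical in
/-- The coefficient operator picking out the lists `x ++ s`, where `x` is the longest initial
segment with entries in `X`. -/
noncomputable def coeffAt (X : Set V) (s : List V) : (List V →₀ ℝ) →ₗ[ℝ] (List V →₀ ℝ) :=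
  Finsupp.linearCombination ℝ fun l =>
    if suffixOut X l = s then Finsupp.single (prefixIn X l) 1 else 0

open Classical in
theorem coeffAt_single (X : Set V) (s l : List V) :
    coeffAt X s (Finsupp.single l 1)
      = if suffixOut X l = s then Finsupp.single (prefixIn X l) 1 else 0 := by
  simp [coeffAt]

/-- The lists whose part after the longest initial segment with entries in `X` has length less
than `m`. -/
def shortSuffix (X : Set V) (m : ℕ) : Set (List V) := {l | (suffixOut X l).length < m}

theorem lmap_append_listBoundary_mem {X : Set V} {x : List V} (hx : ∀ a ∈ x, a ∈ X)
    (t : List V) :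
    Finsupp.lmapDomain ℝ ℝ (x ++ ·) (listBoundary t)
      ∈ Finsupp.supported ℝ ℝ (shortSuffix X t.length) := by
  refine map_mem_supported (fun t' ht' => ?_) (listBoundary_mem t)
  rw [Finsupp.lmapDomain_apply, Finsupp.mapDomain_single]
  refine Finsupp.single_mem_supported ℝ _ ?_
  change (suffixOut X (x ++ t')).length < t.length
  rw [suffixOut_append hx]
  have h1 := length_suffixOut_le X t'
  have h2 : t'.length + 1 = t.length := ht'.2
  omega

/-- In the associated graded of the filtration by the length of `suffixOut`, the boundary acts on
the initial segments only. -/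
theorem coeffAt_boundary {X : Set V} {s : List V} {c : List V →₀ ℝ}
    (hc : c ∈ Finsupp.supported ℝ ℝ (shortSuffix X (s.length + 1))) :
    coeffAt X s (boundary c) = boundary (coeffAt X s c) := by
  classical
  refine map_eq_of_supported (f := coeffAt X s ∘ₗ boundary) (g := boundary ∘ₗ coeffAt X s)
    (fun l hl => ?_) hc
  simp only [LinearMap.comp_apply, boundary_single]
  have hx : ∀ a ∈ prefixIn X l, a ∈ X := fun a => mem_of_mem_prefixIn
  have ht : suffixOut X (suffixOut X l) = suffixOut X l := suffixOut_suffixOut X l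
  have hlen : (suffixOut X l).length ≤ s.length := Nat.lt_succ_iff.1 hl
  have h1 : coeffAt X s (Finsupp.lmapDomain ℝ ℝ (prefixIn X l ++ ·)
      (listBoundary (suffixOut X l))) = 0 := by
    refine map_eq_of_supported (g := 0) (fun l' hl' => ?_)
      (lmap_append_listBoundary_mem hx (suffixOut X l))
    rw [coeffAt_single, if_neg, LinearMap.zero_apply]
    intro h
    have : (suffixOut X l').length < (suffixOut X l).length := hl'
    rw [h] at this
    omega
  conv_lhs => rw [← prefixIn_append_suffixOut X l, listBoundary_append, map_add, map_smul, h1,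
    smul_zero, add_zero]
  rw [coeffAt_single]
  refine (map_eq_of_supported
    (f := coeffAt X s ∘ₗ Finsupp.lmapDomain ℝ ℝ (· ++ suffixOut X l))
    (g := if suffixOut X l = s then (LinearMap.id : (List V →₀ ℝ) →ₗ[ℝ] _) else 0) (fun x hx' => ?_)
    (listBoundary_mem (prefixIn X l))).trans ?_
  · have hxX : ∀ a ∈ x, a ∈ X := fun a ha => hx a (hx'.1.subset ha)
    simp only [LinearMap.comp_apply, Finsupp.lmapDomain_apply, Finsupp.mapDomain_single]
    rw [coeffAt_single, suffixOut_append hxX, ht, prefixIn_append hxX, prefixIn_suffixOut,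
      List.append_nil]
    split_ifs <;> rfl
  · split_ifs <;> simp

theorem sum_l1Norm_coeffAt_le (X : Set V) (T : Finset (List V)) (c : List V →₀ ℝ) :
    ∑ s ∈ T, l1Norm (coeffAt X s c) ≤ l1Norm c := by
  classical
  refine (Finset.sum_le_sum fun s _ => l1Norm_map_le_sum (coeffAt X s) c).trans ?_
  rw [Finset.sum_comm, l1Norm, Finsupp.sum]
  refine Finset.sum_le_sum fun l _ => ?_
  rw [← Finset.mul_sum]
  refine mul_le_of_le_one_right (abs_nonneg _) ?_
  have : ∀ s, l1Norm (coeffAt X s (Finsupp.single l 1)) = if suffixOut X l = s then 1 else 0 := by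
    intro s
    rw [coeffAt_single]
    split_ifs <;> simp
  simp only [this, Finset.sum_ite_eq]
  split_ifs <;> norm_num

/-- Lowering the filtration by the length of `suffixOut` by one: the top part of a cycle is a sum of
terms `x * s` with `s` of length `m + 1`, where `x` is a cycle in the link of `s`, so it is removed
by filling each `x` in the link. -/
theorem exists_push_step {F : Set (List V)} (hF : Closed F) {X : Set V} {k m : ℕ} (hm : m + 1 ≤ k)
    {K : ℝ} (hK : 0 ≤ K)
    (h : ∀ s ∈ F, s.length = m + 1 → (∀ a t, s = a :: t → a ∉ X) →
      Fills (link F X s) (link F X s) (k - (m + 1)) K)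
    {c : List V →₀ ℝ} (hc : c ∈ chains F k) (hc0 : boundary c = 0)
    (hcm : c ∈ Finsupp.supported ℝ ℝ (shortSuffix X (m + 2))) :
    ∃ b ∈ chains F (k + 1), c - boundary b ∈ Finsupp.supported ℝ ℝ (shortSuffix X (m + 1)) ∧
      l1Norm b ≤ K * l1Norm c := by
  classical
  -- The suffixes of maximal length that occur in `c`.
  set T : Finset (List V) := (c.support.image (suffixOut X)).filter (fun s => s.length = m + 1)
    with hT
  have hTlen : ∀ s ∈ T, s.length = m + 1 := fun s hs => (Finset.mem_filter.1 hs).2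
  have hfill : ∀ s ∈ T, ∃ y ∈ chains (link F X s) (k - (m + 1) + 1),
      boundary y = coeffAt X s c ∧ l1Norm y ≤ K * l1Norm (coeffAt X s c) := by
    intro s hs
    obtain ⟨l, hl, rfl⟩ := Finset.mem_image.1 (Finset.mem_filter.1 hs).1
    have hlF : l ∈ F := (hc hl).1
    refine h _ (hF l hlF _ ?_) (hTlen _ hs) (fun a t hat => notMem_of_suffixOut_eq_cons hat) _ ?_ ?_
    · conv_rhs => rw [← prefixIn_append_suffixOut X l]
      exact List.sublist_append_right _ _
    · refine map_mem_supported (fun l' hl' => ?_) hc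
      rw [coeffAt_single]
      split_ifs with hll
      · refine Finsupp.single_mem_supported ℝ _ ⟨⟨fun a => mem_of_mem_prefixIn, ?_⟩, ?_⟩
        · rw [← hll, prefixIn_append_suffixOut]; exact hl'.1
        · have h1 := congrArg List.length (prefixIn_append_suffixOut X l')
          rw [List.length_append, hll, hTlen _ hs, hl'.2] at h1
          omega
      · exact Submodule.zero_mem _
    · rw [← coeffAt_boundary, hc0, map_zero]
      rwa [hTlen _ hs]
  choose! y hy hy1 hy2 using hfill
  set b : List V →₀ ℝ := ∑ s ∈ T, Finsupp.lmapDomain ℝ ℝ (· ++ s) (y s) with hb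
  refine ⟨b, Submodule.sum_mem _ fun s hs => map_mem_supported (fun x hx => ?_) (hy s hs), ?_, ?_⟩
  · rw [Finsupp.lmapDomain_apply, Finsupp.mapDomain_single]
    refine Finsupp.single_mem_supported ℝ _ ⟨hx.1.2, ?_⟩
    have h1 := hx.2
    rw [List.length_append, hTlen s hs, h1]
    omega
  · -- What is left of `c` has shorter suffixes, and so have the faces of `b` that omit an entry of `s`.
    have e : c - boundary b = (c - ∑ s ∈ T, Finsupp.lmapDomain ℝ ℝ (· ++ s) (coeffAt X s c))
        - ∑ s ∈ T, (boundary (Finsupp.lmapDomain ℝ ℝ (· ++ s) (y s))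
            - Finsupp.lmapDomain ℝ ℝ (· ++ s) (boundary (y s))) := by
      have e1 : ∑ s ∈ T, Finsupp.lmapDomain ℝ ℝ (· ++ s) (coeffAt X s c)
          = ∑ s ∈ T, Finsupp.lmapDomain ℝ ℝ (· ++ s) (boundary (y s)) :=
        Finset.sum_congr rfl fun s hs => by rw [hy1 s hs]
      rw [Finset.sum_sub_distrib, hb, map_sum, e1]
      abel
    rw [e]
    refine Submodule.sub_mem _ ?_ (Submodule.sum_mem _ fun s hs => ?_)
    · have hid : c - ∑ s ∈ T, Finsupp.lmapDomain ℝ ℝ (· ++ s) (coeffAt X s c)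
          = ((LinearMap.id : (List V →₀ ℝ) →ₗ[ℝ] (List V →₀ ℝ))
            - ∑ s ∈ T, Finsupp.lmapDomain ℝ ℝ (· ++ s) ∘ₗ coeffAt X s) c := by
        simp
      rw [hid]
      refine map_mem_supported (A := (c.support : Set (List V))) (fun l hl => ?_)
        (Finsupp.mem_supported_support ℝ c)
      simp only [LinearMap.sub_apply, LinearMap.id_apply, LinearMap.sum_apply,
        LinearMap.comp_apply]
      have h1 : ∀ s ∈ T, Finsupp.lmapDomain ℝ ℝ (· ++ s) (coeffAt X s (Finsupp.single l 1))
          = if suffixOut X l = s then Finsupp.single l (1 : ℝ) else 0 := by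
        intro s _
        rw [coeffAt_single]
        split_ifs with hs
        · rw [Finsupp.lmapDomain_apply, Finsupp.mapDomain_single, ← hs,
            prefixIn_append_suffixOut]
        · rw [map_zero]
      rw [Finset.sum_congr rfl h1, Finset.sum_ite_eq]
      split_ifs with hlT
      · rw [sub_self]; exact Submodule.zero_mem _
      · rw [sub_zero]
        refine Finsupp.single_mem_supported ℝ _ ?_
        have h2 : (suffixOut X l).length < m + 2 := hcm hl
        have h3 : (suffixOut X l).length ≠ m + 1 := fun h3 =>
          hlT (Finset.mem_filter.2 ⟨Finset.mem_image_of_mem _ hl, h3⟩)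
        change (suffixOut X l).length < m + 1
        omega
    · refine map_mem_supported
        (f := boundary ∘ₗ Finsupp.lmapDomain ℝ ℝ (· ++ s)
          - Finsupp.lmapDomain ℝ ℝ (· ++ s) ∘ₗ boundary) (fun x hx => ?_) (hy s hs)
      simp only [LinearMap.sub_apply, LinearMap.comp_apply, Finsupp.lmapDomain_apply _ _ (· ++ s),
        Finsupp.mapDomain_single, boundary_single]
      rw [listBoundary_append, ← Finsupp.lmapDomain_apply ℝ ℝ, add_sub_cancel_left]
      refine Submodule.smul_mem _ _ ?_
      rw [← hTlen s hs]
      exact lmap_append_listBoundary_mem hx.1.1 s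
  · calc l1Norm b ≤ ∑ s ∈ T, l1Norm (Finsupp.lmapDomain ℝ ℝ (· ++ s) (y s)) :=
          SemiSimplicialSet.l1Norm_sum_le _ _
      _ ≤ ∑ s ∈ T, K * l1Norm (coeffAt X s c) := Finset.sum_le_sum fun s hs =>
          (l1Norm_lmapDomain_le _ _).trans (hy2 s hs)
      _ = K * ∑ s ∈ T, l1Norm (coeffAt X s c) := by rw [Finset.mul_sum]
      _ ≤ K * l1Norm c := mul_le_mul_of_nonneg_left (sum_l1Norm_coeffAt_le X T c) hK

/-- Iterating `exists_push_step` moves a cycle into the lists without suffix outside of `X`. The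
constant `K'` does not depend on the family `F`. -/
theorem exists_push_of_shortSuffix (k : ℕ) (K : ℕ → ℝ) (j : ℕ) (hj : j ≤ k) :
    ∃ K' : ℝ, 0 ≤ K' ∧ ∀ (V : Type u) (F : Set (List V)) (X : Set V), Closed F →
      (∀ s ∈ F, s ≠ [] → s.length ≤ k → (∀ a t, s = a :: t → a ∉ X) →
        Fills (link F X s) (link F X s) (k - s.length) (K s.length)) →
      ∀ c ∈ chains F k, boundary c = 0 → c ∈ Finsupp.supported ℝ ℝ (shortSuffix X (j + 1)) →
        ∃ b ∈ chains F (k + 1), c - boundary b ∈ chains (within F X) k ∧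
          l1Norm b ≤ K' * l1Norm c := by
  induction j with
  | zero =>
    refine ⟨0, le_rfl, fun V F X hF _ c hc hc0 hcm => ⟨0, Submodule.zero_mem _, ?_, by simp⟩⟩
    rw [map_zero, sub_zero]
    intro l hl
    refine ⟨⟨(hc hl).1, ?_⟩, (hc hl).2⟩
    have h0 : suffixOut X l = [] :=
      List.eq_nil_of_length_eq_zero (Nat.lt_one_iff.1 (hcm hl))
    have h1 := prefixIn_append_suffixOut X l
    rw [h0, List.append_nil] at h1
    rw [← h1]
    exact fun a => mem_of_mem_prefixIn
  | succ j ih =>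
    obtain ⟨K₁, hK₁, ih⟩ := ih (by omega)
    set L := |K (j + 1)| with hL
    have hL0 : 0 ≤ L := abs_nonneg _
    refine ⟨L + K₁ * (1 + (k + 1) * L), by positivity, fun V F X hF h c hc hc0 hcm => ?_⟩
    obtain ⟨b, hb, hb1, hb2⟩ := exists_push_step (m := j) hF hj hL0 (fun s hs hsl hsX => by
      have hne : s ≠ [] := by
        rintro rfl
        simp at hsl
      have := h s hs hne (by omega) hsX
      rw [hsl] at this
      exact this.mono subset_rfl subset_rfl (le_abs_self _)) hc hc0 hcm
    obtain ⟨b', hb', hb1', hb2'⟩ := ih V F X hF h (c - boundary b)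
      (Submodule.sub_mem _ hc (boundary_mem_chains hF hb))
      (by
        rw [map_sub, hc0, boundary_boundary, sub_zero]) hb1
    refine ⟨b + b', Submodule.add_mem _ hb hb', by rwa [map_add, ← sub_sub], ?_⟩
    have hn := l1Norm_nonneg c
    have h1 : l1Norm (c - boundary b) ≤ (1 + (k + 1) * L) * l1Norm c := by
      have h2 := l1Norm_boundary_le hb
      have h3 := l1Norm_sub_le c (boundary b)
      push_cast at h2
      have h4 : (k + 1 : ℝ) * l1Norm b ≤ (k + 1) * (L * l1Norm c) :=
        mul_le_mul_of_nonneg_left hb2 (by positivity)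
      linarith
    calc l1Norm (b + b') ≤ l1Norm b + l1Norm b' := SemiSimplicialSet.l1Norm_add_le _ _
      _ ≤ L * l1Norm c + K₁ * ((1 + (k + 1) * L) * l1Norm c) :=
          add_le_add hb2 (hb2'.trans (mul_le_mul_of_nonneg_left h1 hK₁))
      _ = (L + K₁ * (1 + (k + 1) * L)) * l1Norm c := by ring

/-- If the links of all nonempty lists that start outside of `X` have bounded fillings in the
complementary degree, then every cycle on `F` is homologous, with bounds, to a cycle on lists with
entries in `X`. The constant is uniform in all families, which is what makes inductions over links
possible. -/
theorem fills_of_push (k : ℕ) (K : ℕ → ℝ) (K₀ : ℝ) :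
    ∃ K' : ℝ, 0 ≤ K' ∧ ∀ (V : Type u) (F F' : Set (List V)) (X : Set V), Closed F → F ⊆ F' →
      (∀ s ∈ F, s ≠ [] → s.length ≤ k → (∀ a t, s = a :: t → a ∉ X) →
        Fills (link F X s) (link F X s) (k - s.length) (K s.length)) →
      Fills (within F X) F' k K₀ → Fills F F' k K' := by
  obtain ⟨K₁, hK₁, h⟩ := exists_push_of_shortSuffix k K k le_rfl
  refine ⟨K₁ + |K₀| * (1 + (k + 1) * K₁), by positivity, fun V F F' X hF hFF' hs h0 c hc hc0 => ?_⟩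
  obtain ⟨b, hb, hb1, hb2⟩ := h V F X hF hs c hc hc0 fun l hl => by
    have h1 := length_suffixOut_le X l
    have h2 : l.length = k := (hc hl).2
    change (suffixOut X l).length < k + 1
    omega
  obtain ⟨b', hb', hb1', hb2'⟩ := h0 _ hb1 (by rw [map_sub, hc0, boundary_boundary, sub_zero])
  refine ⟨b + b', Submodule.add_mem _ (chains_mono hFF' _ hb) hb', by rw [map_add, hb1']; abel, ?_⟩
  have hn := l1Norm_nonneg c
  have h1 : l1Norm (c - boundary b) ≤ (1 + (k + 1) * K₁) * l1Norm c := by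
    have h2 := l1Norm_boundary_le hb
    have h3 := l1Norm_sub_le c (boundary b)
    push_cast at h2
    have h4 : (k + 1 : ℝ) * l1Norm b ≤ (k + 1) * (K₁ * l1Norm c) :=
      mul_le_mul_of_nonneg_left hb2 (by positivity)
    linarith
  have h5 : l1Norm b' ≤ |K₀| * l1Norm (c - boundary b) :=
    hb2'.trans (mul_le_mul_of_nonneg_right (le_abs_self _) (l1Norm_nonneg _))
  calc l1Norm (b + b') ≤ l1Norm b + l1Norm b' := SemiSimplicialSet.l1Norm_add_le _ _
    _ ≤ K₁ * l1Norm c + |K₀| * ((1 + (k + 1) * K₁) * l1Norm c) :=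
        add_le_add hb2 (h5.trans (mul_le_mul_of_nonneg_left h1 (abs_nonneg _)))
    _ = (K₁ + |K₀| * (1 + (k + 1) * K₁)) * l1Norm c := by ring

/-- The mirror image of `link`: the lists with entries in `X` that can be put behind `s`. -/
def upLink (F : Set (List V)) (X : Set V) (s : List V) : Set (List V) :=
  {x | (∀ a ∈ x, a ∈ X) ∧ s ++ x ∈ F}

/-- The mirror image of `fills_of_push`. -/
theorem fills_of_push_up (k : ℕ) (K : ℕ → ℝ) (K₀ : ℝ) :
    ∃ K' : ℝ, 0 ≤ K' ∧ ∀ (V : Type u) (F F' : Set (List V)) (X : Set V), Closed F → F ⊆ F' →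
      (∀ s ∈ F, s ≠ [] → s.length ≤ k → (∀ a (t : List V), s = t ++ [a] → a ∉ X) →
        Fills (upLink F X s) (upLink F X s) (k - s.length) (K s.length)) →
      Fills (within F X) F' k K₀ → Fills F F' k K' := by
  obtain ⟨K', hK', h⟩ := fills_of_push.{u} k (fun m => |K m|) |K₀|
  refine ⟨K', hK', fun V F F' X hF hFF' hs h0 => ?_⟩
  have hrev := h V {l | l.reverse ∈ F} {l | l.reverse ∈ F'} X
    (fun l hl l' hl' => hF _ hl _ (List.reverse_sublist.2 hl')) (fun l hl => hFF' hl)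
    (fun s hsF hne hlen hsX => by
      have h1 := (hs s.reverse hsF (by simpa using hne) (by simpa using hlen)
        (fun a t hat => hsX a t.reverse (by
          rw [← List.reverse_reverse s, hat]; simp))).mono subset_rfl subset_rfl (le_abs_self _)
      have h2 := h1.reverse (abs_nonneg _)
      rw [List.length_reverse] at h2
      have e : {l | l.reverse ∈ upLink F X s.reverse} = link {l | l.reverse ∈ F} X s := by
        ext l; simp [upLink, link]
      rwa [e] at h2)
    (by
      have h2 := (h0.mono subset_rfl subset_rfl (le_abs_self _)).reverse (abs_nonneg _)
      have e : {l | l.reverse ∈ within F X} = within {l | l.reverse ∈ F} X := by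
        ext l; simp [within]
      rwa [e] at h2)
  have h3 := hrev.reverse hK'
  simpa using h3

/-! ### From bounded fillings to bounded cohomology -/

theorem listBoundary_ofFn (k : ℕ) (g : Fin (k + 1) → V) :
    listBoundary (List.ofFn g)
      = ∑ i : Fin (k + 1), Finsupp.single (List.ofFn fun j => g (i.succAbove j))
          ((-1 : ℝ) ^ (i : ℕ)) := by
  induction k with
  | zero => simp [listBoundary]
  | succ k ih =>
    rw [List.ofFn_succ, listBoundary, Fin.sum_univ_succ, ih, map_sum, sub_eq_add_neg,
      ← Finset.sum_neg_distrib]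
    refine congrArg₂ (· + ·) (by simp) (Finset.sum_congr rfl fun i _ => ?_)
    rw [Finsupp.lmapDomain_apply, Finsupp.mapDomain_single, ← Finsupp.single_neg,
      List.ofFn_succ (f := fun j => g (i.succ.succAbove j))]
    simp [pow_succ]

/-- A semi-simplicial set `X` is modelled by a family of lists `F` if its simplices are
determined by their vertices `vert s`, which run through the lists in `F`. -/
structure Models (F : Set (List V)) (X : SemiSimplicialSet.{u}) where
  nil_mem : [] ∈ F
  /-- the vertices of a simplex -/
  vert : ∀ {p : ℕ}, X.obj p → Fin (p + 1) → V
  injective : ∀ p, Function.Injective (vert (p := p))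
  vert_mem : ∀ {p : ℕ} (s : X.obj p), List.ofFn (vert s) ∈ F
  exists_vert : ∀ {p : ℕ} (g : Fin (p + 1) → V), List.ofFn g ∈ F → ∃ s : X.obj p, vert s = g
  vert_face : ∀ {p : ℕ} (i : Fin (p + 2)) (s : X.obj (p + 1)) (j : Fin (p + 1)),
    vert (X.face i s) j = vert s (i.succAbove j)

namespace Models

variable {F : Set (List V)} {X : SemiSimplicialSet.{u}} (M : Models F X)

/-- The list of vertices of a simplex of the augmentation. -/
def toList : (k : ℕ) → X.augSimplex k → List V
  | 0, _ => []
  | _ + 1, s => List.ofFn (M.vert (X := X) s)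

theorem toList_injective (k : ℕ) : Function.Injective (M.toList k) := by
  cases k with
  | zero => intro a b _; cases a; cases b; rfl
  | succ k => exact fun a b h => M.injective k (List.ofFn_injective h)

theorem toList_mem (k : ℕ) (s : X.augSimplex k) :
    M.toList k s ∈ {l | l ∈ F ∧ l.length = k} := by
  cases k with
  | zero => exact ⟨M.nil_mem, rfl⟩
  | succ k => exact ⟨M.vert_mem s, by simp [toList]⟩

theorem exists_toList (k : ℕ) (l : List V) (hl : l ∈ F) (hk : l.length = k) :
    ∃ s, M.toList k s = l := by
  cases k with
  | zero => exact ⟨PUnit.unit, (List.length_eq_zero_iff.1 hk).symm⟩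
  | succ k =>
    obtain ⟨g, rfl⟩ : ∃ g : Fin (k + 1) → V, List.ofFn g = l := by
      exact ⟨fun i => l.get (i.cast hk.symm), by
        rw [List.ofFn_congr hk.symm]; simp⟩
    obtain ⟨s, hs⟩ := M.exists_vert g hl
    exact ⟨s, congrArg List.ofFn hs⟩

/-- The chain map to chains on lists. -/
noncomputable def toChain (k : ℕ) : X.RedChain k →ₗ[ℝ] (List V →₀ ℝ) :=
  Finsupp.lmapDomain ℝ ℝ (M.toList k)

theorem toChain_single (k : ℕ) (s : X.augSimplex k) (a : ℝ) :
    M.toChain k (Finsupp.single s a) = Finsupp.single (M.toList k s) a := by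
  simp [toChain]

theorem toChain_injective (k : ℕ) : Function.Injective (M.toChain k) :=
  Finsupp.mapDomain_injective (M.toList_injective k)

theorem l1Norm_toChain (k : ℕ) (c : X.RedChain k) : l1Norm (M.toChain k c) = l1Norm c :=
  Finsupp.sum_mapDomain_index_inj (M.toList_injective k)

theorem toChain_boundary (k : ℕ) (c : X.RedChain (k + 1)) :
    M.toChain k (X.redBoundary k c) = boundary (M.toChain (k + 1) c) := by
  have h : M.toChain k ∘ₗ X.redBoundary k = boundary ∘ₗ M.toChain (k + 1) := by
    refine Finsupp.lhom_ext' fun s => LinearMap.ext_ring ?_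
    simp only [LinearMap.comp_apply, Finsupp.lsingle_apply, SemiSimplicialSet.redBoundary_single,
      one_smul, map_sum, toChain_single, boundary_single]
    rw [show M.toList (k + 1) s = List.ofFn (M.vert (X := X) s) from rfl, listBoundary_ofFn]
    refine Finset.sum_congr rfl fun i _ => ?_
    congr 1
    cases k with
    | zero => simp [toList]
    | succ k => exact congrArg List.ofFn (funext fun j => M.vert_face i s j)
  exact LinearMap.congr_fun h c

theorem toChain_mem (k : ℕ) (c : X.RedChain k) : M.toChain k c ∈ chains F k := by
  refine map_mem_supported (A := Set.univ) (fun s _ => ?_) (by simp)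
  rw [toChain_single]
  exact Finsupp.single_mem_supported ℝ _ (M.toList_mem k s)

theorem exists_toChain (k : ℕ) (c : List V →₀ ℝ) (hc : c ∈ chains F k) :
    ∃ d, M.toChain k d = c := by
  rw [chains, Finsupp.supported_eq_span_single] at hc
  have : c ∈ LinearMap.range (M.toChain k) := by
    refine Submodule.span_le.2 ?_ hc
    rintro _ ⟨l, hl, rfl⟩
    obtain ⟨s, hs⟩ := M.exists_toList k l hl.1 hl.2
    exact ⟨Finsupp.single s 1, by rw [toChain_single, hs]⟩
  exact this

theorem exists_filling {k : ℕ} {K : ℝ} (h : Fills F F k K) (c : X.RedChain k)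
    (hc : boundary (M.toChain k c) = 0) :
    ∃ b : X.RedChain (k + 1), X.redBoundary k b = c ∧ l1Norm b ≤ K * l1Norm c := by
  obtain ⟨b, hb, hb1, hb2⟩ := h _ (M.toChain_mem k c) hc
  obtain ⟨b, rfl⟩ := M.exists_toChain _ b hb
  rw [l1Norm_toChain, l1Norm_toChain] at hb2
  refine ⟨b, M.toChain_injective k ?_, hb2⟩
  rw [toChain_boundary, hb1]

/-- Bounded fillings in degrees `q - 1` and `q` imply that bounded cohomology vanishes in
degree `q`: a bounded cocycle induces a functional on the boundaries in degree `q - 1` that is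
bounded for the norm of chains, and this extends by the Hahn-Banach theorem. -/
theorem vanishes (M : Models F X) {k : ℕ} (h : ∀ j ≤ k, ∃ K, Fills F F j K) :
    X.RedBoundedCohomologyVanishes ((k : ℤ) - 1) := by
  intro k' hk'
  obtain rfl : k' = k := by omega
  suffices hle : X.redBoundedCocycles k' ≤ X.redBoundedCoboundaries k' by
    have hbot : (X.redBoundedCocycles k').map (X.redBoundedCoboundaries k').mkQ = ⊥ := by
      refine (Submodule.eq_bot_iff _).2 ?_
      rintro _ ⟨f, hf, rfl⟩
      exact (Submodule.Quotient.mk_eq_zero _).2 (hle hf)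
    rw [SemiSimplicialSet.RedBoundedCohomology, hbot]
    infer_instance
  rintro φ ⟨⟨B, hB⟩, hφ⟩
  have hφ0 : ∀ b, φ (X.redBoundary k' b) = 0 := fun b =>
    LinearMap.congr_fun (LinearMap.mem_ker.1 hφ) b
  cases k' with
  | zero =>
    obtain ⟨K, hK⟩ := h 0 le_rfl
    -- The empty simplex is a boundary, so a cocycle of degree `-1` vanishes.
    have hz : φ = 0 := by
      refine LinearMap.ext fun c => ?_
      obtain ⟨b, hb, -⟩ := M.exists_filling hK c (by
        refine map_eq_of_supported (g := 0) (fun l hl => ?_) (M.toChain_mem 0 c)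
        rw [List.length_eq_zero_iff.1 hl.2]
        simp [listBoundary])
      rw [← hb, hφ0, LinearMap.zero_apply]
    rw [hz]
    exact Submodule.zero_mem _
  | succ k =>
    obtain ⟨K₁, hK₁⟩ := h (k + 1) le_rfl
    obtain ⟨K, hK⟩ := h k (Nat.le_succ k)
    -- By acyclicity in degree `k`, the cocycle factors over a functional `ψ` on the boundaries.
    have hker : LinearMap.ker (X.redBoundary k) ≤ LinearMap.ker φ := by
      intro c hc
      obtain ⟨b, hb, -⟩ := M.exists_filling hK₁ c (by
        rw [← toChain_boundary, LinearMap.mem_ker.1 hc, map_zero])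
      rw [LinearMap.mem_ker, ← hb, hφ0]
    let ψ : LinearMap.range (X.redBoundary k) →ₗ[ℝ] ℝ :=
      (LinearMap.ker (X.redBoundary k)).liftQ φ hker ∘ₗ
        (X.redBoundary k).quotKerEquivRange.symm.toLinearMap
    have hψ : ∀ b, ψ ⟨X.redBoundary k b, b, rfl⟩ = φ b := by
      intro b
      have : (X.redBoundary k).quotKerEquivRange.symm ⟨X.redBoundary k b, b, rfl⟩
          = (LinearMap.ker (X.redBoundary k)).mkQ b := by
        rw [LinearEquiv.symm_apply_eq]
        exact Subtype.ext (by simp)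
      change (LinearMap.ker (X.redBoundary k)).liftQ φ hker
        ((X.redBoundary k).quotKerEquivRange.symm ⟨X.redBoundary k b, b, rfl⟩) = φ b
      rw [this]
      simp
    -- A short filling of a boundary `c` bounds `ψ c` in terms of the norm of `c`.
    obtain ⟨g, hg1, hg2⟩ := exists_extension_of_le_sublinear
      (⟨LinearMap.range (X.redBoundary k), ψ⟩ : X.RedChain k →ₗ.[ℝ] ℝ)
      (fun c => |B| * (|K| * l1Norm c))
      (fun a ha c => by rw [l1Norm_smul, abs_of_pos ha]; ring)
      (fun c d => by
        rw [← mul_add, ← mul_add]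
        have := SemiSimplicialSet.l1Norm_add_le c d
        gcongr)
      (by
        rintro ⟨c, hc⟩
        change ψ ⟨c, hc⟩ ≤ |B| * (|K| * l1Norm c)
        obtain ⟨b', rfl⟩ := hc
        obtain ⟨b, hb, hbn⟩ := M.exists_filling hK (X.redBoundary k b')
          (by rw [toChain_boundary, boundary_boundary])
        have e : ψ ⟨X.redBoundary k b', b', rfl⟩ = φ b := by
          rw [← hψ b]
          congr 1
          exact Subtype.ext hb.symm
        rw [e]
        have h1 := (le_abs_self _).trans (hB b)
        have h2 : B * l1Norm b ≤ |B| * l1Norm b :=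
          mul_le_mul_of_nonneg_right (le_abs_self _) (l1Norm_nonneg _)
        have h3 : l1Norm b ≤ |K| * l1Norm (X.redBoundary k b') :=
          hbn.trans (mul_le_mul_of_nonneg_right (le_abs_self _) (l1Norm_nonneg _))
        exact h1.trans (h2.trans (mul_le_mul_of_nonneg_left h3 (abs_nonneg _))))
    refine ⟨g, ⟨|B| * |K|, fun c => ?_⟩, LinearMap.ext fun b => ?_⟩
    · rw [abs_le, mul_assoc]
      refine ⟨?_, hg2 c⟩
      have := hg2 (-c)
      simp only [map_neg, l1Norm_neg] at this
      linarith
    · exact (hg1 ⟨X.redBoundary k b, b, rfl⟩).trans (hψ b)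

end Models

/-- Bounded cohomology vanishes above the dimension. -/
theorem _root_.SemiSimplicialSet.vanishes_of_isEmpty (X : SemiSimplicialSet.{u}) (p : ℕ)
    (h : IsEmpty (X.obj p)) : X.RedBoundedCohomologyVanishes p := by
  intro k hk
  obtain rfl : k = p + 1 := by omega
  have : IsEmpty (X.augSimplex (p + 1)) := h
  have : Subsingleton (X.RedChain (p + 1)) := inferInstance
  have h0 : ∀ f g : X.RedChain (p + 1) →ₗ[ℝ] ℝ, f = g := fun f g => LinearMap.ext fun c => by
    rw [Subsingleton.elim c 0, map_zero, map_zero]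
  refine ⟨?_⟩
  rintro ⟨_, f, hf, rfl⟩ ⟨_, g, hg, rfl⟩
  obtain rfl := h0 f g
  rfl

/-! ### Flags in partially ordered sets -/

section Flags

variable {P : Type u} [PartialOrder P]

/-- The increasing lists with entries in the subset `A` of a partially ordered set. -/
def flags (A : Set P) : Set (List P) := {l | l.Pairwise (· < ·) ∧ ∀ x ∈ l, x ∈ A}

theorem flags_closed (A : Set P) : Closed (flags A) := fun _ hl _ hl' =>
  ⟨hl.1.sublist hl', fun x hx => hl.2 x (hl'.subset hx)⟩

theorem flags_mono {A B : Set P} (h : A ⊆ B) : flags A ⊆ flags B :=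
  fun _ hl => ⟨hl.1, fun x hx => h (hl.2 x hx)⟩

theorem within_flags {A X : Set P} (h : X ⊆ A) : within (flags A) X = flags X := by
  ext l
  exact ⟨fun hl => ⟨hl.1.1, hl.2⟩, fun hl => ⟨flags_mono h hl, hl.2⟩⟩

theorem fills_flags_dual {A : Set P} {k : ℕ} {K : ℝ} (hK : 0 ≤ K)
    (h : Fills (flags (OrderDual.ofDual ⁻¹' A)) (flags (OrderDual.ofDual ⁻¹' A)) k K) :
    Fills (flags A) (flags A) k K := by
  have e : {l : List P | l.reverse ∈ flags A}
      = (flags (OrderDual.ofDual ⁻¹' A) : Set (List Pᵒᵈ)) := by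
    ext l
    change (l.reverse.Pairwise (· < ·) ∧ ∀ x ∈ l.reverse, x ∈ A)
      ↔ (List.Pairwise (fun a b : P => b < a) l ∧ ∀ x ∈ l, x ∈ A)
    rw [List.pairwise_reverse]
    simp
  have h' : Fills {l : List P | l.reverse ∈ flags A} {l : List P | l.reverse ∈ flags A} k K := by
    rw [e]; exact h
  simpa using h'.reverse hK

theorem fills_flags_of_least {A : Set P} {t : P} (h : IsLeast A t) (k : ℕ) :
    Fills (flags A) (flags A) k 1 := by
  have hlt : ∀ l, t :: l ∈ flags A → t ∉ l := fun l hl hm =>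
    lt_irrefl _ ((List.pairwise_cons.1 hl.1).1 t hm)
  refine Fills.of_first (F := flags A) t (fun l hl hm => ⟨List.pairwise_cons.2 ⟨fun x hx => ?_, hl.1⟩, ?_⟩) hlt
    (fun a l hl hne hm => ?_) k
  · exact lt_of_le_of_ne (h.2 (hl.2 x hx)) fun e => hm (e ▸ hx)
  · simpa using ⟨h.1, hl.2⟩
  · have h1 := (List.pairwise_cons.1 hl.1).1 t hm
    exact absurd (h.2 (hl.2 a (by simp))) (not_le_of_gt h1)

theorem fills_flags_of_greatest {A : Set P} {t : P} (h : IsGreatest A t) (k : ℕ) :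
    Fills (flags A) (flags A) k 1 :=
  fills_flags_dual zero_le_one (fills_flags_of_least (t := OrderDual.toDual t)
    ⟨h.1, fun _ hx => h.2 hx⟩ k)

end Flags

/-- Pushing flags into `X`, for subsets `X ⊆ A` of a partially ordered set: it suffices to control
the elements of `X` above a given element `y` of `A` outside of `X`. The number `m` is the length
of a flag in `A` that ends in `y`. -/
theorem fills_flags_of_push_up (k : ℕ) (K : ℕ → ℝ) (K₀ : ℝ) :
    ∃ K' : ℝ, 0 ≤ K' ∧ ∀ (P : Type u) [PartialOrder P] (A X : Set P), X ⊆ A →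
      (∀ y ∈ A, y ∉ X → ∀ m, 1 ≤ m → m ≤ k → (2 ≤ m → ∃ z ∈ A, z < y) →
        Fills (flags {x | x ∈ X ∧ y < x}) (flags {x | x ∈ X ∧ y < x}) (k - m) (K m)) →
      Fills (flags X) (flags X) k K₀ → Fills (flags A) (flags A) k K' := by
  obtain ⟨K', hK', h⟩ := fills_of_push_up.{u} k K K₀
  refine ⟨K', hK', fun P _ A X hXA hlink h0 => h P (flags A) (flags A) X (flags_closed A) subset_rfl
    (fun s hs hne hsk hsX => ?_) ?_⟩
  · obtain ⟨t, y, rfl⟩ : ∃ t y, s = t ++ [y] :=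
      ⟨s.dropLast, s.getLast hne, (List.dropLast_append_getLast hne).symm⟩
    have ht := List.pairwise_append.1 hs.1
    have e : upLink (flags A) X (t ++ [y]) = flags {x | x ∈ X ∧ y < x} := by
      ext x
      constructor
      · rintro ⟨hx, hx'⟩
        have h1 := List.pairwise_append.1 hx'.1
        exact ⟨h1.2.1, fun a ha => ⟨hx a ha, h1.2.2 y (by simp) a ha⟩⟩
      · intro hx
        refine ⟨fun a ha => (hx.2 a ha).1, List.pairwise_append.2 ⟨hs.1, hx.1, ?_⟩, ?_⟩
        · intro a ha b hb
          rcases List.mem_append.1 ha with ha | ha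
          · exact (ht.2.2 a ha y (by simp)).trans (hx.2 b hb).2
          · rw [List.mem_singleton.1 ha]; exact (hx.2 b hb).2
        · intro a ha
          rcases List.mem_append.1 ha with ha | ha
          · exact hs.2 a ha
          · exact hXA (hx.2 a ha).1
    rw [e]
    refine hlink y (hs.2 y (by simp)) (hsX y t rfl) _ (by simp) hsk fun h2 => ?_
    have htne : t ≠ [] := by
      rintro rfl
      simp at h2
    obtain ⟨z, t', rfl⟩ := List.exists_cons_of_ne_nil htne
    exact ⟨z, hs.2 z (by simp), ht.2.2 z (by simp) y (by simp)⟩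
  · rw [within_flags hXA]
    exact h0.mono subset_rfl (flags_mono hXA) le_rfl

/-- If the elements of `X` above each element of `A` outside of `X` have a least element, then
fillings in `X` give fillings in `A`. -/
theorem fills_flags_of_least_above (k : ℕ) (K₀ : ℝ) :
    ∃ K' : ℝ, 0 ≤ K' ∧ ∀ (P : Type u) [PartialOrder P] (A X : Set P), X ⊆ A →
      (∀ y ∈ A, y ∉ X → ∃ t, IsLeast {x | x ∈ X ∧ y < x} t) →
      Fills (flags X) (flags X) k K₀ → Fills (flags A) (flags A) k K' := by
  obtain ⟨K', hK', h⟩ := fills_flags_of_push_up.{u} k (fun _ => 1) K₀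
  refine ⟨K', hK', fun P _ A X hXA hl h0 => h P A X hXA (fun y hy hyX m _ _ _ => ?_) h0⟩
  obtain ⟨t, ht⟩ := hl y hy hyX
  exact fills_flags_of_least ht _

/-- The dual of `fills_flags_of_least_above`. -/
theorem fills_flags_of_greatest_below (k : ℕ) (K₀ : ℝ) :
    ∃ K' : ℝ, 0 ≤ K' ∧ ∀ (P : Type u) [PartialOrder P] (A X : Set P), X ⊆ A →
      (∀ y ∈ A, y ∉ X → ∃ t, IsGreatest {x | x ∈ X ∧ x < y} t) →
      Fills (flags X) (flags X) k K₀ → Fills (flags A) (flags A) k K' := by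
  obtain ⟨K', hK', h⟩ := fills_flags_of_least_above.{u} k |K₀|
  refine ⟨K', hK', fun P _ A X hXA hl h0 => fills_flags_dual hK' ?_⟩
  refine h Pᵒᵈ (OrderDual.ofDual ⁻¹' A) (OrderDual.ofDual ⁻¹' X) (fun x hx => hXA hx)
    (fun y hy hyX => ?_) ?_
  · obtain ⟨t, ht⟩ := hl (OrderDual.ofDual y) hy hyX
    exact ⟨OrderDual.toDual t, ⟨ht.1.1, ht.1.2⟩, fun x hx => ht.2 ⟨hx.1, hx.2⟩⟩
  · exact fills_flags_dual (P := Pᵒᵈ) (A := OrderDual.ofDual ⁻¹' X) (abs_nonneg _)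
      (h0.mono subset_rfl subset_rfl (le_abs_self _))

/-- The order complex of a subset of a partially ordered set is modelled by the flags in this
subset. -/
noncomputable def modelsOrderComplex {P : Type u} [PartialOrder P] (p : P → Prop) :
    Models (flags {x | p x}) (orderComplex {x // p x}) where
  nil_mem := ⟨List.Pairwise.nil, by simp⟩
  vert s i := (s.1 i).1
  injective _ s t h := Subtype.ext (funext fun i => Subtype.ext (congrFun h i))
  vert_mem s := ⟨List.pairwise_ofFn.2 fun _ _ hij => s.2 hij, by
    simp only [List.mem_ofFn]
    rintro _ ⟨i, rfl⟩
    exact (s.1 i).2⟩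
  exists_vert g hg := ⟨⟨fun i => ⟨g i, hg.2 _ (List.mem_ofFn.2 ⟨i, rfl⟩)⟩, fun i j hij =>
    List.pairwise_ofFn.1 hg.1 hij⟩, rfl⟩
  vert_face _ _ _ := rfl

/-! ### Tits buildings -/

section Buildings

open Module

variable {F : Type u} [Field F] {V : Type u} [AddCommGroup V] [Module F V]

/-- A subspace is isotropic if the bilinear form vanishes identically on it. -/
def IsIsotropic (B : V →ₗ[F] V →ₗ[F] F) (W : Submodule F V) : Prop := ∀ x ∈ W, ∀ y ∈ W, B x y = 0

theorem IsIsotropic.sup_span {B : V →ₗ[F] V →ₗ[F] F} (hB : B.IsAlt) {W : Submodule F V}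
    (hW : IsIsotropic B W) {v : V} (hv : W ≤ LinearMap.ker (B v)) :
    IsIsotropic B (W ⊔ Submodule.span F {v}) := by
  have h1 : ∀ w ∈ W, B v w = 0 := fun w hw => hv hw
  have h2 : ∀ w ∈ W, B w v = 0 := fun w hw => by rw [← hB.neg, h1 w hw, neg_zero]
  intro x hx y hy
  obtain ⟨a, ha, b, hb, rfl⟩ := Submodule.mem_sup.1 hx
  obtain ⟨c, hc, d, hd, rfl⟩ := Submodule.mem_sup.1 hy
  obtain ⟨s, rfl⟩ := Submodule.mem_span_singleton.1 hb
  obtain ⟨t, rfl⟩ := Submodule.mem_span_singleton.1 hd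
  simp [hW a ha c hc, h1 c hc, h2 a ha, hB.self_eq_zero v]

variable [FiniteDimensional F V]

theorem finrank_eq_finrank_inf_ker_add_one (φ : V →ₗ[F] F) {W : Submodule F V}
    (hW : ¬ W ≤ LinearMap.ker φ) :
    finrank F W = finrank F ↥(W ⊓ LinearMap.ker φ) + 1 := by
  obtain ⟨w, hwW, hw⟩ := SetLike.not_le_iff_exists.1 hW
  have hw' : w ∉ W ⊓ LinearMap.ker φ := fun h => hw h.2
  rw [← Submodule.finrank_sup_span_singleton hw']
  suffices h : W = W ⊓ LinearMap.ker φ ⊔ Submodule.span F {w} by rw [← h]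
  refine le_antisymm (fun x hx => ?_) (sup_le inf_le_left (by simpa using hwW))
  rw [LinearMap.mem_ker] at hw
  have hx' : x = (x - (φ x / φ w) • w) + (φ x / φ w) • w := by abel
  rw [hx']
  refine Submodule.add_mem_sup ⟨W.sub_mem hx (W.smul_mem _ hwW), ?_⟩
    (Submodule.mem_span_singleton.2 ⟨_, rfl⟩)
  change φ (x - (φ x / φ w) • w) = 0
  rw [map_sub, map_smul, smul_eq_mul, div_mul_cancel₀ _ hw, sub_self]

/-- The open interval between a subspace of codimension `m` and the whole space has bounded fillings
below the top degree of a building of type `A_{m-1}`. Flags are pushed off the complements `W` of a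
hyperplane `H` over `U`, whose links are intervals of the same kind, and the other subspaces are
contracted by `W ≥ W ⊓ H ≤ H`. -/
theorem fills_flags_interval (m : ℕ) : ∀ k : ℕ, k + 2 ≤ m → ∃ K : ℝ, 0 ≤ K ∧
    ∀ U : Submodule F V, finrank F V = finrank F U + m →
      Fills (flags {W | U < W ∧ W < ⊤}) (flags {W | U < W ∧ W < ⊤}) k K := by
  induction m with
  | zero => intro k hk; omega
  | succ m ih =>
    intro k hk
    obtain ⟨K₀, hK₀⟩ : ∃ K : ℝ, 1 ≤ k → ∀ U : Submodule F V, finrank F V = finrank F U + m →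
        Fills (flags {W | U < W ∧ W < ⊤}) (flags {W | U < W ∧ W < ⊤}) (k - 1) K := by
      by_cases hk1 : 1 ≤ k
      · obtain ⟨K, -, hK⟩ := ih (k - 1) (by omega)
        exact ⟨K, fun _ => hK⟩
      · exact ⟨0, fun h => absurd h hk1⟩
    obtain ⟨K₁, -, h₁⟩ := fills_flags_of_greatest_below.{u} k 1
    obtain ⟨K₂, hK₂, h₂⟩ := fills_flags_of_push_up.{u} k (fun _ => K₀) K₁
    refine ⟨K₂, hK₂, fun U hU => ?_⟩
    have hUtop : U < ⊤ := by
      refine lt_top_iff_ne_top.2 fun h => ?_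
      rw [h, finrank_top] at hU
      omega
    obtain ⟨φ, hφ, hUφ⟩ := U.exists_le_ker_of_lt_top hUtop
    -- `H` is a hyperplane containing `U`.
    set H := LinearMap.ker φ with hH
    have hHtop : H < ⊤ := lt_top_iff_ne_top.2 fun h => hφ (LinearMap.ker_eq_top.1 h)
    have hUH : U < H := by
      refine lt_of_le_of_ne hUφ fun h => ?_
      have h1 := finrank_eq_finrank_inf_ker_add_one φ (W := ⊤) (not_le_of_gt hHtop)
      rw [top_inf_eq, ← hH, ← h, finrank_top] at h1
      omega
    have hbad : ∀ W, U < W → W ⊓ H = U → finrank F W = finrank F U + 1 := by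
      intro W hUW hW
      rw [← hW]
      refine finrank_eq_finrank_inf_ker_add_one φ fun h => hUW.ne ?_
      rw [← hW, inf_eq_left.2 h]
    refine h₂ _ {W | U < W ∧ W < ⊤} {W | (U < W ∧ W < ⊤) ∧ W ⊓ H ≠ U} (fun W hW => hW.1) ?_ ?_
    · -- For reasons of dimension, nothing lies below `y`, so only `j = 1` occurs.
      intro y hy hyX j hj1 hjk hj2
      have hyH : y ⊓ H = U := by
        by_contra h
        exact hyX ⟨hy, h⟩
      have hfy := hbad y hy.1 hyH
      have hj : j = 1 := by
        by_contra hne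
        obtain ⟨z, hz, hzy⟩ := hj2 (by omega)
        have hzH : z ⊓ H = U :=
          le_antisymm ((inf_le_inf_right H hzy.le).trans hyH.le) (le_inf hz.1.le hUφ)
        have h1 := Submodule.finrank_lt_finrank_of_lt hzy
        rw [hbad z hz.1 hzH] at h1
        omega
      subst hj
      have e : {x | x ∈ {W | (U < W ∧ W < ⊤) ∧ W ⊓ H ≠ U} ∧ y < x} = {W | y < W ∧ W < ⊤} := by
        ext x
        refine ⟨fun hx => ⟨hx.2, hx.1.1.2⟩, fun hx => ⟨⟨⟨hy.1.trans hx.1, hx.2⟩, fun h => ?_⟩, hx.1⟩⟩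
        have h1 := Submodule.finrank_lt_finrank_of_lt hx.1
        rw [hbad x (hy.1.trans hx.1) h] at h1
        omega
      rw [e]
      exact hK₀ (by omega) y (by omega)
    · refine h₁ _ _ {W | U < W ∧ W ≤ H} (fun W hW => ⟨⟨hW.1, hW.2.trans_lt hHtop⟩, ?_⟩) ?_ ?_
      · rw [inf_eq_left.2 hW.2]; exact hW.1.ne'
      · intro y hy hyX
        have hyH : ¬ y ≤ H := fun h => hyX ⟨hy.1.1, h⟩
        refine ⟨y ⊓ H, ⟨⟨lt_of_le_of_ne (le_inf hy.1.1.le hUφ) hy.2.symm, inf_le_right⟩, ?_⟩, ?_⟩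
        · exact lt_of_le_of_ne inf_le_left fun h => hyH (inf_eq_left.1 h)
        · exact fun x hx => le_inf hx.2.le hx.1.2
      · exact fills_flags_of_greatest (A := {W | U < W ∧ W ≤ H}) (t := H)
          ⟨⟨hUH, le_rfl⟩, fun x hx => hx.2⟩ k

/-- The subspaces orthogonal to a subspace of dimension `d` have codimension at most `d`. -/
theorem finrank_le_finrank_add_finrank_orthogonal (B : V →ₗ[F] V →ₗ[F] F) (U : Submodule F V) :
    finrank F V ≤ finrank F U + finrank F (LinearMap.ker (B.flip.domRestrict U).flip) := by
  have h1 := LinearMap.finrank_range_add_finrank_ker (B.flip.domRestrict U).flip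
  have h2 : finrank F (LinearMap.range (B.flip.domRestrict U).flip) ≤ finrank F U := by
    refine (Submodule.finrank_le _).trans ?_
    exact (Subspace.dual_finrank_eq (K := F) (V := U)).le
  omega

/-- The isotropic subspaces that properly contain a given isotropic subspace of dimension `n - m`, in
a space of dimension at least `2 n`, have bounded fillings below the top degree of a building of type
`C_m`. For a vector `v` outside of `U` but orthogonal to it, with orthogonal complement `H`, flags
are pushed off the `W` with `W ⊓ H = U`, whose links are of the same kind, and the other subspaces
are contracted by `W ≥ W ⊓ H ≤ (W ⊓ H) + v ≥ U + v`. The form may be degenerate. -/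
theorem fills_flags_isotropic {B : V →ₗ[F] V →ₗ[F] F} (hB : B.IsAlt) (m : ℕ) :
    ∀ k : ℕ, k + 1 ≤ m → ∃ K : ℝ, 0 ≤ K ∧ ∀ U : Submodule F V, IsIsotropic B U →
      2 * (finrank F U + m) ≤ finrank F V →
      Fills (flags {W | IsIsotropic B W ∧ U < W}) (flags {W | IsIsotropic B W ∧ U < W}) k K := by
  induction m with
  | zero => intro k hk; omega
  | succ m ih =>
    intro k hk
    obtain ⟨K₀, hK₀⟩ : ∃ K : ℝ, 1 ≤ k → ∀ U : Submodule F V, IsIsotropic B U →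
        2 * (finrank F U + m) ≤ finrank F V →
        Fills (flags {W | IsIsotropic B W ∧ U < W}) (flags {W | IsIsotropic B W ∧ U < W})
          (k - 1) K := by
      by_cases hk1 : 1 ≤ k
      · obtain ⟨K, -, hK⟩ := ih (k - 1) (by omega)
        exact ⟨K, fun _ => hK⟩
      · exact ⟨0, fun h => absurd h hk1⟩
    obtain ⟨K₁, -, h₁⟩ := fills_flags_of_least_above.{u} k 1
    obtain ⟨K₂, -, h₂⟩ := fills_flags_of_greatest_below.{u} k K₁
    obtain ⟨K₃, hK₃, h₃⟩ := fills_flags_of_push_up.{u} k (fun _ => K₀) K₂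
    refine ⟨K₃, hK₃, fun U hUiso hU => ?_⟩
    obtain ⟨v, hvU, hv⟩ : ∃ v, v ∉ U ∧ U ≤ LinearMap.ker (B v) := by
      have h1 := finrank_le_finrank_add_finrank_orthogonal B U
      have h2 : ¬ LinearMap.ker (B.flip.domRestrict U).flip ≤ U := fun h => by
        have := Submodule.finrank_mono h
        omega
      obtain ⟨v, hv, hvU⟩ := SetLike.not_le_iff_exists.1 h2
      refine ⟨v, hvU, fun u hu => ?_⟩
      exact LinearMap.congr_fun (LinearMap.mem_ker.1 hv) (⟨u, hu⟩ : U)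
    set H := LinearMap.ker (B v) with hH
    have hbad : ∀ W, U < W → W ⊓ H = U → finrank F W = finrank F U + 1 := by
      intro W hUW hW
      rw [← hW]
      refine finrank_eq_finrank_inf_ker_add_one (B v) fun h => hUW.ne ?_
      rw [← hW, inf_eq_left.2 h]
    have hvH : v ∈ H := hB.self_eq_zero v
    have hspan : ∀ W, W ≤ H → W ⊔ Submodule.span F {v} ≤ H := fun W hW =>
      sup_le hW (by simpa using hvH)
    have hmem : ∀ W : Submodule F V, v ∈ W ⊔ Submodule.span F {v} := fun W =>
      Submodule.mem_sup_right (Submodule.mem_span_singleton_self v)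
    have hlt : ∀ W : Submodule F V, v ∉ W → W < W ⊔ Submodule.span F {v} := fun W hW =>
      lt_of_le_of_ne le_sup_left fun h => hW (h ▸ hmem W)
    refine h₃ _ _ {W | (IsIsotropic B W ∧ U < W) ∧ W ⊓ H ≠ U} (fun W hW => hW.1) ?_ ?_
    · -- For reasons of dimension, nothing lies below `y`, so only `j = 1` occurs.
      intro y hy hyX j hj1 hjk hj2
      have hyH : y ⊓ H = U := by
        by_contra h
        exact hyX ⟨hy, h⟩
      have hfy := hbad y hy.2 hyH
      have hj : j = 1 := by
        by_contra hne
        obtain ⟨z, hz, hzy⟩ := hj2 (by omega)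
        have hzH : z ⊓ H = U :=
          le_antisymm ((inf_le_inf_right H hzy.le).trans hyH.le) (le_inf hz.2.le hv)
        have h1 := Submodule.finrank_lt_finrank_of_lt hzy
        rw [hbad z hz.2 hzH] at h1
        omega
      subst hj
      have e : {x | x ∈ {W | (IsIsotropic B W ∧ U < W) ∧ W ⊓ H ≠ U} ∧ y < x}
          = {W | IsIsotropic B W ∧ y < W} := by
        ext x
        refine ⟨fun hx => ⟨hx.1.1.1, hx.2⟩,
          fun hx => ⟨⟨⟨hx.1, hy.2.trans hx.2⟩, fun h => ?_⟩, hx.2⟩⟩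
        have h1 := Submodule.finrank_lt_finrank_of_lt hx.2
        rw [hbad x (hy.2.trans hx.2) h] at h1
        omega
      rw [e]
      exact hK₀ (by omega) y hy.1 (by omega)
    · refine h₂ _ _ {W | (IsIsotropic B W ∧ U < W) ∧ W ≤ H} (fun W hW => ⟨hW.1, ?_⟩) ?_ ?_
      · rw [inf_eq_left.2 hW.2]; exact hW.1.2.ne'
      · intro y hy hyX
        have hyH : ¬ y ≤ H := fun h => hyX ⟨hy.1, h⟩
        refine ⟨y ⊓ H, ⟨⟨⟨fun a ha b hb => hy.1.1 a ha.1 b hb.1,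
          lt_of_le_of_ne (le_inf hy.1.2.le hv) hy.2.symm⟩, inf_le_right⟩, ?_⟩, ?_⟩
        · exact lt_of_le_of_ne inf_le_left fun h => hyH (inf_eq_left.1 h)
        · exact fun x hx => le_inf hx.2.le hx.1.2
      · refine h₁ _ _ {W | ((IsIsotropic B W ∧ U < W) ∧ W ≤ H) ∧ v ∈ W} (fun W hW => hW.1) ?_ ?_
        · intro y hy hyX
          have hvy : v ∉ y := fun h => hyX ⟨hy, h⟩
          refine ⟨y ⊔ Submodule.span F {v}, ⟨⟨⟨⟨hy.1.1.sup_span hB hy.2,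
            hy.1.2.trans (hlt y hvy)⟩, hspan y hy.2⟩, hmem y⟩, hlt y hvy⟩, ?_⟩
          exact fun x hx => sup_le hx.2.le (by simpa using hx.1.2)
        · refine fills_flags_of_least
            (A := {W | ((IsIsotropic B W ∧ U < W) ∧ W ≤ H) ∧ v ∈ W}) (t := U ⊔ Submodule.span F {v})
            ⟨⟨⟨⟨hUiso.sup_span hB hv, hlt U hvU⟩, hspan U hv⟩, hmem U⟩, ?_⟩ k
          exact fun x hx => sup_le hx.1.1.2.le (by simpa using hx.2)

/-- An isotropic subspace for a nondegenerate form has at most half the dimension. -/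
theorem IsIsotropic.finrank_le {B : V →ₗ[F] V →ₗ[F] F} (hB : Function.Injective B)
    {W : Submodule F V} (hW : IsIsotropic B W) : 2 * finrank F W ≤ finrank F V := by
  let f : V →ₗ[F] Dual F W := (B.flip.domRestrict W).flip
  have hsurj : Function.Surjective f := by
    have hBs : Function.Surjective B :=
      (LinearMap.injective_iff_surjective_of_finrank_eq_finrank
        (Subspace.dual_finrank_eq (K := F) (V := V)).symm).1 hB
    intro φ
    obtain ⟨ψ, hψ⟩ := LinearMap.exists_extend φ
    obtain ⟨x, hx⟩ := hBs ψ
    refine ⟨x, LinearMap.ext fun w => ?_⟩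
    rw [← hψ, ← hx]
    rfl
  have h1 := LinearMap.finrank_range_add_finrank_ker f
  rw [LinearMap.range_eq_top.2 hsurj, finrank_top, Subspace.dual_finrank_eq] at h1
  have h2 : W ≤ LinearMap.ker f := fun w hw =>
    LinearMap.mem_ker.2 (LinearMap.ext fun w' => hW w hw w' w'.2)
  have h3 := Submodule.finrank_mono h2
  omega

theorem length_le_finrank_last {k : ℕ} (g : Fin (k + 1) → Submodule F V) (hg : StrictMono g)
    (h0 : g 0 ≠ ⊥) : k + 1 ≤ finrank F (g (Fin.last k)) := by
  induction k with
  | zero =>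
    exact Nat.one_le_iff_ne_zero.2 fun h => h0 (Submodule.finrank_eq_zero.1 h)
  | succ k ih =>
    have h1 := ih (fun i => g i.castSucc) (fun i j hij => hg (Fin.castSucc_lt_castSucc_iff.2 hij)) h0
    have h2 := Submodule.finrank_lt_finrank_of_lt (hg (Fin.castSucc_lt_last (Fin.last k)))
    omega

end Buildings

theorem titsBuildingA_vanishes (F : Type u) [Field F] (n : ℕ) (hn : 1 ≤ n) (q : ℤ)
    (hq : q ≠ (n : ℤ) - 2) :
    (orderComplex (TitsBuildingA F n)).RedBoundedCohomologyVanishes q := by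
  rcases lt_or_gt_of_ne hq with h | h
  · intro k hk
    refine (modelsOrderComplex _).vanishes (k := k) (fun j hj => ?_) k (by omega)
    obtain ⟨K, -, hK⟩ := fills_flags_interval (F := F) (V := Fin n → F) n j (by omega)
    refine ⟨K, ?_⟩
    have := hK ⊥ (by simp)
    simpa only [bot_lt_iff_ne_bot, lt_top_iff_ne_top] using this
  · intro k hk
    rcases k with _ | p
    · omega
    refine SemiSimplicialSet.vanishes_of_isEmpty _ p ⟨fun s => ?_⟩ (p + 1) rfl
    have h1 := length_le_finrank_last (fun i => (s.1 i).1) (fun i j hij => s.2 hij) (s.1 0).2.1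
    have h2 := Submodule.finrank_lt (s.1 (Fin.last p)).2.2
    simp at h2
    omega

theorem titsBuildingC_vanishes (F : Type u) [Field F] (n : ℕ) (q : ℤ) (hq : q ≠ (n : ℤ) - 1) :
    (orderComplex (TitsBuildingC F n)).RedBoundedCohomologyVanishes q := by
  let B : (Fin n ⊕ Fin n → F) →ₗ[F] (Fin n ⊕ Fin n → F) →ₗ[F] F :=
    Matrix.toLinearMap₂' F (Matrix.J (Fin n) F)
  have hBapp : ∀ x y, B x y = x ⬝ᵥ (Matrix.J (Fin n) F *ᵥ y) := fun x y =>
    Matrix.toLinearMap₂'_apply' _ _ _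
  have hB : B.IsAlt := by
    intro x
    obtain ⟨a, b, rfl⟩ : ∃ a b, Sum.elim a b = x := ⟨x ∘ Sum.inl, x ∘ Sum.inr, by simp⟩
    rw [hBapp, Matrix.J, Matrix.fromBlocks_mulVec]
    simp [sumElim_dotProduct_sumElim, Matrix.neg_mulVec, dotProduct_comm a b]
  have hBinj : Function.Injective B := by
    rw [injective_iff_map_eq_zero]
    intro x hx
    refine dotProduct_eq_zero x fun z => ?_
    have h1 : B x (Matrix.J (Fin n) F *ᵥ z) = 0 := by rw [hx]; rfl
    rw [hBapp, Matrix.mulVec_mulVec, Matrix.J_squared, Matrix.neg_mulVec, Matrix.one_mulVec,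
      dotProduct_neg, neg_eq_zero] at h1
    exact h1
  rcases lt_or_gt_of_ne hq with h | h
  · intro k hk
    refine (modelsOrderComplex _).vanishes (k := k) (fun j hj => ?_) k (by omega)
    obtain ⟨K, -, hK⟩ := fills_flags_isotropic hB n j (by omega)
    refine ⟨K, ?_⟩
    have := hK ⊥ (by rintro x hx y -; rw [(Submodule.mem_bot F).1 hx]; simp) (by simp; omega)
    have e : {W : Submodule F (Fin n ⊕ Fin n → F) | W ≠ ⊥ ∧
        ∀ x ∈ W, ∀ y ∈ W, x ⬝ᵥ (Matrix.J (Fin n) F *ᵥ y) = 0} = {W | IsIsotropic B W ∧ ⊥ < W} := by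
      ext W
      simp only [Set.mem_ofPred_eq, IsIsotropic, hBapp, bot_lt_iff_ne_bot, and_comm]
    rw [e]
    exact this
  · intro k hk
    rcases k with _ | p
    · omega
    refine SemiSimplicialSet.vanishes_of_isEmpty _ p ⟨fun s => ?_⟩ (p + 1) rfl
    have h1 := length_le_finrank_last (fun i => (s.1 i).1) (fun i j hij => s.2 hij) (s.1 0).2.1
    have h2 : IsIsotropic B (s.1 (Fin.last p)).1 := fun x hx y hy => by
      rw [hBapp]; exact (s.1 (Fin.last p)).2.2 x hx y hy
    have h3 := h2.finrank_le hBinj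
    simp at h3
    omega

end ListChain

namespace QuadraticStructure

/-! ### Hyperbolic pairs -/

open ListChain

variable {R : Type u} [CommRing R] {P : FormParameter R} {N : Type u} [AddCommGroup N] [Module R N]
  (Q : QuadraticStructure P N)

theorem _root_.FormParameter.sign_mul_sign (P : FormParameter R) : P.sign * P.sign = 1 := by
  rcases P.sign_eq with h | h <;> simp [h]

theorem lam_eq_zero_symm {x y : N} (h : Q.lam x y = 0) : Q.lam y x = 0 := by
  rw [Q.lam_symm, h, mul_zero]

theorem mu_smul_eq_zero {x : N} (h : Q.mu x = 0) (a : R) : Q.mu (a • x) = 0 := by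
  rw [Q.mu_smul a x 0 h, mul_zero]; rfl

theorem mu_add_of_lam_eq_zero {x y : N} (h : Q.lam x y = 0) : Q.mu (x + y) = Q.mu x + Q.mu y := by
  have h1 := Q.mu_add x y
  rw [h] at h1
  have h2 : ((0 : R) : R ⧸ P.subgroup) = 0 := rfl
  rw [h2, sub_sub, sub_eq_zero] at h1
  exact h1

theorem mu_add_smul {x y : N} (hx : Q.mu x = 0) (hy : Q.mu y = 0) (h : Q.lam x y = 0) (a : R) :
    Q.mu (x + a • y) = 0 := by
  rw [Q.mu_add_of_lam_eq_zero (by rw [map_smul, h, smul_zero]), hx, Q.mu_smul_eq_zero hy, add_zero]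

/-- A hyperbolic pair: the images of `e` and `f` under a morphism from the hyperbolic module. -/
structure IsHyperbolicPair (h : N × N) : Prop where
  lam_fst : Q.lam h.1 h.1 = 0
  lam_snd : Q.lam h.2 h.2 = 0
  lam_fst_snd : Q.lam h.1 h.2 = 1
  mu_fst : Q.mu h.1 = 0
  mu_snd : Q.mu h.2 = 0

/-- The vectors orthogonal to both members of a pair. -/
def perp (h : N × N) : Submodule R N := LinearMap.ker (Q.lam h.1) ⊓ LinearMap.ker (Q.lam h.2)

/-- The vectors orthogonal to all members of a list of pairs. -/
def perpList : List (N × N) → Submodule R N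
  | [] => ⊤
  | h :: s => Q.perp h ⊓ perpList s

/-- Two pairs of vectors are orthogonal if each vector of one is orthogonal to each vector of the
other. -/
def Orthogonal (h h' : N × N) : Prop := h'.1 ∈ Q.perp h ∧ h'.2 ∈ Q.perp h

/-- The lists of mutually orthogonal hyperbolic pairs in the submodule `M`. -/
def hyperbolicLists (M : Submodule R N) : Set (List (N × N)) :=
  {l | l.Pairwise Q.Orthogonal ∧ ∀ h ∈ l, Q.IsHyperbolicPair h ∧ h.1 ∈ M ∧ h.2 ∈ M}

/-- The submodule `M` contains `g` mutually orthogonal hyperbolic pairs: its Witt index is at least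
`g`. -/
def WittIndexGE (M : Submodule R N) (g : ℕ) : Prop := ∃ l ∈ Q.hyperbolicLists M, l.length = g

variable {Q}

theorem mem_perpList {s : List (N × N)} {x : N} : x ∈ Q.perpList s ↔ ∀ h ∈ s, x ∈ Q.perp h := by
  induction s with
  | nil => simp [perpList]
  | cons a s ih => simp [perpList, ih]

theorem Orthogonal.symm {h h' : N × N} (H : Q.Orthogonal h h') : Q.Orthogonal h' h :=
  ⟨⟨Q.lam_eq_zero_symm H.1.1, Q.lam_eq_zero_symm H.2.1⟩,
    ⟨Q.lam_eq_zero_symm H.1.2, Q.lam_eq_zero_symm H.2.2⟩⟩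

theorem hyperbolicLists_closed (M : Submodule R N) : Closed (Q.hyperbolicLists M) :=
  fun _ hl _ hl' => ⟨hl.1.sublist hl', fun x hx => hl.2 x (hl'.subset hx)⟩

theorem hyperbolicLists_mono {M M' : Submodule R N} (h : M ≤ M') :
    Q.hyperbolicLists M ⊆ Q.hyperbolicLists M' :=
  fun _ hl => ⟨hl.1, fun x hx => ⟨(hl.2 x hx).1, h (hl.2 x hx).2.1, h (hl.2 x hx).2.2⟩⟩

theorem cons_mem_hyperbolicLists {M : Submodule R N} {h : N × N} {l : List (N × N)}
    (hh : Q.IsHyperbolicPair h) (h1 : h.1 ∈ M) (h2 : h.2 ∈ M)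
    (hl : l ∈ Q.hyperbolicLists (M ⊓ Q.perp h)) : h :: l ∈ Q.hyperbolicLists M := by
  refine ⟨List.pairwise_cons.2 ⟨fun a ha => ⟨(hl.2 a ha).2.1.2, (hl.2 a ha).2.2.2⟩, hl.1⟩, ?_⟩
  intro a ha
  rcases List.mem_cons.1 ha with rfl | ha
  · exact ⟨hh, h1, h2⟩
  · exact ⟨(hl.2 a ha).1, (hl.2 a ha).2.1.1, (hl.2 a ha).2.2.1⟩

theorem mem_hyperbolicLists_of_cons {M : Submodule R N} {h : N × N} {l : List (N × N)}
    (hl : h :: l ∈ Q.hyperbolicLists M) :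
    (Q.IsHyperbolicPair h ∧ h.1 ∈ M ∧ h.2 ∈ M) ∧ l ∈ Q.hyperbolicLists (M ⊓ Q.perp h) := by
  have h1 := List.pairwise_cons.1 hl.1
  refine ⟨hl.2 h (by simp), h1.2, fun a ha => ?_⟩
  obtain ⟨h2, h3, h4⟩ := hl.2 a (by simp [ha])
  exact ⟨h2, ⟨h3, (h1.1 a ha).1⟩, ⟨h4, (h1.1 a ha).2⟩⟩

theorem WittIndexGE.mono {M M' : Submodule R N} {g g' : ℕ} (h : Q.WittIndexGE M g) (hM : M ≤ M')
    (hg : g' ≤ g) : Q.WittIndexGE M' g' := by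
  obtain ⟨l, hl, rfl⟩ := h
  exact ⟨l.take g', hyperbolicLists_mono hM (hyperbolicLists_closed M l hl _ (l.take_sublist g')),
    by simpa using hg⟩

theorem IsHyperbolicPair.swap {h : N × N} (H : Q.IsHyperbolicPair h) :
    Q.IsHyperbolicPair (h.2, P.sign • h.1) where
  lam_fst := H.lam_snd
  lam_snd := by simp [H.lam_fst]
  lam_fst_snd := by
    rw [map_smul, Q.lam_symm, H.lam_fst_snd, smul_eq_mul, mul_one, P.sign_mul_sign]
  mu_fst := H.mu_snd
  mu_snd := Q.mu_smul_eq_zero H.mu_fst _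

theorem Orthogonal.swap {h h' : N × N} (H : Q.Orthogonal h h') :
    Q.Orthogonal h (h'.2, P.sign • h'.1) :=
  ⟨H.2, Submodule.smul_mem _ _ H.1⟩

/-- An elementary transformation of two orthogonal hyperbolic pairs. It adds a multiple of `e` to
`e'`, and corrects `f` accordingly. -/
theorem IsHyperbolicPair.transvect {h h' : N × N} (H : Q.IsHyperbolicPair h)
    (H' : Q.IsHyperbolicPair h') (hh : Q.Orthogonal h h') (c : R) :
    Q.IsHyperbolicPair (h.1, h.2 + (-c) • h'.2) ∧ Q.IsHyperbolicPair (h'.1 + c • h.1, h'.2) ∧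
      Q.Orthogonal (h.1, h.2 + (-c) • h'.2) (h'.1 + c • h.1, h'.2) := by
  obtain ⟨⟨h1, h2⟩, h3, h4⟩ := hh
  obtain ⟨⟨h1', h3'⟩, h2', h4'⟩ := Orthogonal.symm ⟨⟨h1, h2⟩, h3, h4⟩
  change Q.lam _ _ = 0 at h1 h2 h3 h4 h1' h2' h3' h4'
  have e1 : Q.lam h.2 h.1 = P.sign := by rw [Q.lam_symm, H.lam_fst_snd, mul_one]
  have e2 : Q.lam h'.2 h'.1 = P.sign := by rw [Q.lam_symm, H'.lam_fst_snd, mul_one]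
  refine ⟨⟨H.lam_fst, ?_, ?_, H.mu_fst, Q.mu_add_smul H.mu_snd H'.mu_snd h4 _⟩,
    ⟨?_, H'.lam_snd, ?_, Q.mu_add_smul H'.mu_fst H.mu_fst h1' _, H'.mu_snd⟩,
    ⟨?_, ?_⟩, ⟨h3, ?_⟩⟩
  · simp [H.lam_snd, H'.lam_snd, h4, h4']
  · simp [H.lam_fst_snd, h3]
  · simp [H'.lam_fst, H.lam_fst, h1, h1']
  · simp [H'.lam_fst_snd, h3]
  · simp [h1, H.lam_fst]
  · simp [h2, h3', e1, e2]
  · simp [h4, H'.lam_snd]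

/-- The Euclidean algorithm on the values of a functional `f` on two orthogonal hyperbolic pairs:
the pairs can be changed so that `f` vanishes on one of them. A nonzero value on `e` is used to
reduce the values on `e'` and `f'` to remainders; the first nonzero remainder takes over. -/
theorem exists_pair_of_ne_zero {size : R → ℕ}
    (hsize : ∀ a b : R, a ≠ 0 → ∃ c, b + c * a = 0 ∨ size (b + c * a) < size a)
    (f : N →ₗ[R] R) (M : Submodule R N) (n : ℕ) : ∀ h h' : N × N, Q.IsHyperbolicPair h →
      Q.IsHyperbolicPair h' → Q.Orthogonal h h' → h.1 ∈ M → h.2 ∈ M → h'.1 ∈ M → h'.2 ∈ M →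
      f h.1 ≠ 0 → size (f h.1) = n →
      ∃ k k' : N × N, Q.IsHyperbolicPair k ∧ Q.IsHyperbolicPair k' ∧ Q.Orthogonal k k' ∧
        k.1 ∈ M ∧ k.2 ∈ M ∧ k'.1 ∈ M ∧ k'.2 ∈ M ∧ f k.1 = 0 ∧ f k.2 = 0 := by
  induction n using Nat.strong_induction_on with
  | _ n ih =>
  intro h h' H H' hh m1 m2 m1' m2' hne hn
  obtain ⟨c, hc⟩ := hsize (f h.1) (f h'.1) hne
  obtain ⟨T1, T2, T3⟩ := H.transvect H' hh c
  have ma : h'.1 + c • h.1 ∈ M := M.add_mem m1' (M.smul_mem _ m1)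
  have mb : h.2 + (-c) • h'.2 ∈ M := M.add_mem m2 (M.smul_mem _ m2')
  have hf : f (h'.1 + c • h.1) = f h'.1 + c * f h.1 := by simp
  by_cases h0 : f h'.1 + c * f h.1 = 0
  · obtain ⟨d, hd⟩ := hsize (f h.1) (f h'.2) hne
    obtain ⟨S1, S2, S3⟩ := T1.transvect T2.swap T3.swap d
    have mc : h'.2 + d • h.1 ∈ M := M.add_mem m2' (M.smul_mem _ m1)
    have md : P.sign • (h'.1 + c • h.1) ∈ M := M.smul_mem _ ma
    have me : h.2 + (-c) • h'.2 + (-d) • P.sign • (h'.1 + c • h.1) ∈ M :=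
      M.add_mem mb (M.smul_mem _ md)
    have hf' : f (h'.2 + d • h.1) = f h'.2 + d * f h.1 := by simp
    by_cases h1 : f h'.2 + d * f h.1 = 0
    · exact ⟨_, _, S2, S1, S3.symm, mc, md, m1, me, hf'.trans h1, by
        rw [map_smul, hf, h0, smul_zero]⟩
    · exact ih _ (hn ▸ hd.resolve_left h1) _ _ S2 S1 S3.symm mc md m1 me
        (by rw [hf']; exact h1) (by rw [hf'])
  · exact ih _ (hn ▸ hc.resolve_left h0) _ _ T2 T1 T3.symm ma m2' m1 mb
      (by rw [hf]; exact h0) (by rw [hf])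

/-- Passing to the kernel of a functional lowers the Witt index by at most one: among any two
orthogonal pairs, one can be made to lie in the kernel. -/
theorem WittIndexGE.inf_ker {size : R → ℕ}
    (hsize : ∀ a b : R, a ≠ 0 → ∃ c, b + c * a = 0 ∨ size (b + c * a) < size a)
    (f : N →ₗ[R] R) (g : ℕ) : ∀ M : Submodule R N, Q.WittIndexGE M (g + 1) →
      Q.WittIndexGE (M ⊓ LinearMap.ker f) g := by
  induction g with
  | zero => exact fun M _ => ⟨[], ⟨List.Pairwise.nil, by simp⟩, rfl⟩
  | succ g ih =>
    rintro M ⟨l, hl, hlen⟩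
    obtain ⟨h, l, rfl⟩ := List.exists_cons_of_length_eq_add_one hlen
    obtain ⟨h', t, rfl⟩ := List.exists_cons_of_length_eq_add_one (Nat.succ_injective hlen)
    obtain ⟨⟨H, m1, m2⟩, hl'⟩ := mem_hyperbolicLists_of_cons hl
    obtain ⟨⟨H', m1', m2'⟩, ht⟩ := mem_hyperbolicLists_of_cons hl'
    have hperp : ∀ a ∈ h :: h' :: [], a.1 ∈ M ⊓ Q.perpList t ∧ a.2 ∈ M ⊓ Q.perpList t := by
      intro a ha
      simp only [List.mem_cons, List.not_mem_nil, or_false] at ha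
      rcases ha with rfl | rfl
      · have : ∀ b ∈ t, Q.Orthogonal b a := fun b hb =>
          Orthogonal.symm ⟨(ht.2 b hb).2.1.1.2, (ht.2 b hb).2.2.1.2⟩
        exact ⟨⟨m1, mem_perpList.2 fun b hb => (this b hb).1⟩,
          ⟨m2, mem_perpList.2 fun b hb => (this b hb).2⟩⟩
      · have : ∀ b ∈ t, Q.Orthogonal b a := fun b hb =>
          Orthogonal.symm ⟨(ht.2 b hb).2.1.2, (ht.2 b hb).2.2.2⟩
        exact ⟨⟨m1'.1, mem_perpList.2 fun b hb => (this b hb).1⟩,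
          ⟨m2'.1, mem_perpList.2 fun b hb => (this b hb).2⟩⟩
    obtain ⟨p1, p2⟩ := hperp h (by simp)
    obtain ⟨p1', p2'⟩ := hperp h' (by simp)
    obtain ⟨k, k', K, K', hkk, q1, q2, q1', q2', f1, f2⟩ : ∃ k k' : N × N,
        Q.IsHyperbolicPair k ∧ Q.IsHyperbolicPair k' ∧ Q.Orthogonal k k' ∧
        k.1 ∈ M ⊓ Q.perpList t ∧ k.2 ∈ M ⊓ Q.perpList t ∧ k'.1 ∈ M ⊓ Q.perpList t ∧
        k'.2 ∈ M ⊓ Q.perpList t ∧ f k.1 = 0 ∧ f k.2 = 0 := by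
      have hh : Q.Orthogonal h h' := ⟨m1'.2, m2'.2⟩
      by_cases f1 : f h.1 = 0
      · by_cases f2 : f h.2 = 0
        · exact ⟨h, h', H, H', hh, p1, p2, p1', p2', f1, f2⟩
        · exact exists_pair_of_ne_zero hsize f _ _ (h.2, P.sign • h.1) h' H.swap H'
            hh.symm.swap.symm p2 (Submodule.smul_mem _ _ p1) p1' p2' f2 rfl
      · exact exists_pair_of_ne_zero hsize f _ _ h h' H H' hh p1 p2 p1' p2' f1 rfl
    have horth : ∀ (a : N × N), a.1 ∈ M ⊓ Q.perpList t → a.2 ∈ M ⊓ Q.perpList t →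
        ∀ b ∈ t, Q.Orthogonal a b := fun a ha1 ha2 b hb =>
      Orthogonal.symm ⟨mem_perpList.1 ha1.2 b hb, mem_perpList.1 ha2.2 b hb⟩
    obtain ⟨l', hl', hlen'⟩ := ih (M ⊓ Q.perp k) ⟨k' :: t, by
      refine cons_mem_hyperbolicLists K' ⟨q1'.1, hkk.1⟩ ⟨q2'.1, hkk.2⟩ ⟨ht.1, fun b hb => ?_⟩
      have h1 := horth k q1 q2 b hb
      have h2 := horth k' q1' q2' b hb
      have h3 := ht.2 b hb
      exact ⟨h3.1, ⟨⟨h3.2.1.1.1, h1.1⟩, h2.1⟩, ⟨⟨h3.2.2.1.1, h1.2⟩, h2.2⟩⟩, by simpa using hlen⟩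
    refine ⟨k :: l', cons_mem_hyperbolicLists K ⟨q1.1, f1⟩ ⟨q2.1, f2⟩ ?_, by simp [hlen']⟩
    refine hyperbolicLists_mono ?_ hl'
    exact le_of_eq (inf_right_comm _ _ _)

/-- For a hyperbolic pair `(e, f)`, the projection onto the vectors orthogonal to `f` along `e`. -/
def projAlong (h : N × N) : N →ₗ[R] N :=
  LinearMap.id - ((P.sign • Q.lam h.2).smulRight h.1)

theorem projAlong_apply (h : N × N) (x : N) :
    projAlong (Q := Q) h x = x + (-(P.sign * Q.lam h.2 x)) • h.1 := by
  simp [projAlong, sub_eq_add_neg]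

theorem lam_projAlong_left {h : N × N} {x : N} (hx : Q.lam h.1 x = 0) (y : N) :
    Q.lam (projAlong (Q := Q) h y) x = Q.lam y x := by
  simp [projAlong_apply, hx]

theorem lam_projAlong {h : N × N} {x y : N} (H : Q.IsHyperbolicPair h) (hx : Q.lam h.1 x = 0)
    (hy : Q.lam h.1 y = 0) :
    Q.lam (projAlong (Q := Q) h x) (projAlong (Q := Q) h y) = Q.lam x y := by
  rw [lam_projAlong_left]
  · simp [projAlong_apply, Q.lam_eq_zero_symm hx]
  · simp [projAlong_apply, hy, H.lam_fst]

theorem projAlong_mem_perp {h : N × N} {x : N} (H : Q.IsHyperbolicPair h) (hx : Q.lam h.1 x = 0) :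
    projAlong (Q := Q) h x ∈ Q.perp h := by
  constructor
  · simp [projAlong_apply, hx, H.lam_fst]
  · have e1 : Q.lam h.2 h.1 = P.sign := by rw [Q.lam_symm, H.lam_fst_snd, mul_one]
    simp [projAlong_apply, e1]
    linear_combination (-Q.lam h.2 x) * P.sign_mul_sign

theorem map_projAlong_mem {M : Submodule R N} {h : N × N} (H : Q.IsHyperbolicPair h)
    (h1 : h.1 ∈ M) {l : List (N × N)}
    (hl : l ∈ Q.hyperbolicLists (M ⊓ LinearMap.ker (Q.lam h.1))) :
    l.map (Prod.map (projAlong (Q := Q) h) (projAlong (Q := Q) h))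
      ∈ Q.hyperbolicLists (M ⊓ Q.perp h) := by
  have hM : ∀ x ∈ M, projAlong (Q := Q) h x ∈ M := fun x hx => by
    rw [projAlong_apply]; exact M.add_mem hx (M.smul_mem _ h1)
  have hmu : ∀ x, Q.mu x = 0 → Q.lam h.1 x = 0 → Q.mu (projAlong (Q := Q) h x) = 0 :=
    fun x hx hx' => by
      rw [projAlong_apply]; exact Q.mu_add_smul hx H.mu_fst (Q.lam_eq_zero_symm hx') _
  constructor
  · rw [List.pairwise_map]
    refine hl.1.imp_of_mem fun {a b} ha hb hab => ?_
    have ha' := hl.2 a ha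
    have hb' := hl.2 b hb
    refine ⟨⟨?_, ?_⟩, ?_, ?_⟩
    · exact (lam_projAlong H ha'.2.1.2 hb'.2.1.2).trans hab.1.1
    · exact (lam_projAlong H ha'.2.2.2 hb'.2.1.2).trans hab.1.2
    · exact (lam_projAlong H ha'.2.1.2 hb'.2.2.2).trans hab.2.1
    · exact (lam_projAlong H ha'.2.2.2 hb'.2.2.2).trans hab.2.2
  · intro b hb
    obtain ⟨a, ha, rfl⟩ := List.mem_map.1 hb
    obtain ⟨A, ⟨a1, a1'⟩, ⟨a2, a2'⟩⟩ := hl.2 a ha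
    refine ⟨⟨?_, ?_, ?_, hmu _ A.mu_fst a1', hmu _ A.mu_snd a2'⟩,
      ⟨hM _ a1, projAlong_mem_perp H a1'⟩, ⟨hM _ a2, projAlong_mem_perp H a2'⟩⟩
    · exact (lam_projAlong H a1' a1').trans A.lam_fst
    · exact (lam_projAlong H a2' a2').trans A.lam_snd
    · exact (lam_projAlong H a1' a2').trans A.lam_fst_snd

/-- The orthogonal complement of a hyperbolic pair `(e, f)` loses at most one from the Witt index: it
receives an isometric projection from the kernel of `λ(e, -)`. -/
theorem WittIndexGE.inf_perp {size : R → ℕ}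
    (hsize : ∀ a b : R, a ≠ 0 → ∃ c, b + c * a = 0 ∨ size (b + c * a) < size a)
    {M : Submodule R N} {g : ℕ} (hM : Q.WittIndexGE M (g + 1)) {h : N × N}
    (H : Q.IsHyperbolicPair h) (h1 : h.1 ∈ M) : Q.WittIndexGE (M ⊓ Q.perp h) g := by
  obtain ⟨l, hl, rfl⟩ := hM.inf_ker hsize (Q.lam h.1)
  exact ⟨_, map_projAlong_mem H h1 hl, by simp⟩

theorem WittIndexGE.inf_perpList {size : R → ℕ}
    (hsize : ∀ a b : R, a ≠ 0 → ∃ c, b + c * a = 0 ∨ size (b + c * a) < size a)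
    {g : ℕ} (s : List (N × N)) : ∀ {M : Submodule R N}, s ∈ Q.hyperbolicLists M →
      Q.WittIndexGE M (g + s.length) → Q.WittIndexGE (M ⊓ Q.perpList s) g := by
  induction s with
  | nil => intro M _ h; simpa [perpList] using h
  | cons a s ih =>
    intro M hs h
    obtain ⟨⟨A, a1, a2⟩, hs'⟩ := mem_hyperbolicLists_of_cons hs
    have := ih hs' (WittIndexGE.inf_perp hsize (g := g + s.length) h A a1)
    rwa [inf_assoc] at this

theorem within_hyperbolicLists (M M' : Submodule R N) :
    within (Q.hyperbolicLists M) {h | h.1 ∈ M' ∧ h.2 ∈ M'} = Q.hyperbolicLists (M ⊓ M') := by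
  ext l
  constructor
  · rintro ⟨⟨h1, h2⟩, h3⟩
    exact ⟨h1, fun a ha => ⟨(h2 a ha).1, ⟨(h2 a ha).2.1, (h3 a ha).1⟩,
      ⟨(h2 a ha).2.2, (h3 a ha).2⟩⟩⟩
  · rintro ⟨h1, h2⟩
    exact ⟨⟨h1, fun a ha => ⟨(h2 a ha).1, (h2 a ha).2.1.1, (h2 a ha).2.2.1⟩⟩,
      fun a ha => ⟨(h2 a ha).2.1.2, (h2 a ha).2.2.2⟩⟩

theorem link_hyperbolicLists {M : Submodule R N} (M' : Submodule R N) {s : List (N × N)}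
    (hs : s ∈ Q.hyperbolicLists M) :
    link (Q.hyperbolicLists M) {h | h.1 ∈ M' ∧ h.2 ∈ M'} s
      = Q.hyperbolicLists (M ⊓ M' ⊓ Q.perpList s) := by
  ext l
  constructor
  · rintro ⟨h1, h2, h3⟩
    have h4 := List.pairwise_append.1 h2
    refine ⟨h4.1, fun a ha => ?_⟩
    obtain ⟨A, a1, a2⟩ := h3 a (by simp [ha])
    have h5 : ∀ b ∈ s, Q.Orthogonal b a := fun b hb => (h4.2.2 a ha b hb).symm
    exact ⟨A, ⟨⟨a1, (h1 a ha).1⟩, mem_perpList.2 fun b hb => (h5 b hb).1⟩,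
      ⟨⟨a2, (h1 a ha).2⟩, mem_perpList.2 fun b hb => (h5 b hb).2⟩⟩
  · rintro ⟨h1, h2⟩
    refine ⟨fun a ha => ⟨(h2 a ha).2.1.1.2, (h2 a ha).2.2.1.2⟩,
      List.pairwise_append.2 ⟨h1, hs.1, fun a ha b hb => ?_⟩, fun a ha => ?_⟩
    · exact Orthogonal.symm ⟨mem_perpList.1 (h2 a ha).2.1.2 b hb,
        mem_perpList.1 (h2 a ha).2.2.2 b hb⟩
    · rcases List.mem_append.1 ha with ha | ha
      · exact ⟨(h2 a ha).1, (h2 a ha).2.1.1.1, (h2 a ha).2.2.1.1⟩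
      · exact hs.2 a ha

/-- Uniform acyclicity of the complex of hyperbolic pairs in a submodule of large Witt index. For a
hyperbolic pair `(e, f)`, cycles are pushed into the kernel of `λ(e, -)`, then into the orthogonal
complement of `(e, f)`, where they bound the cone with apex `(e, f)`. -/
theorem fills_hyperbolicLists {size : R → ℕ}
    (hsize : ∀ a b : R, a ≠ 0 → ∃ c, b + c * a = 0 ∨ size (b + c * a) < size a) (k : ℕ) :
    ∃ K : ℝ, ∀ M : Submodule R N, Q.WittIndexGE M (2 * k + 2) →
      Fills (Q.hyperbolicLists M) (Q.hyperbolicLists M) k K := by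
  induction k using Nat.strong_induction_on with
  | _ k ih =>
  choose! K hK using ih
  obtain ⟨K₁, -, hK₁⟩ := fills_of_push.{u} k (fun m => K (k - m)) 1
  obtain ⟨K₂, -, hK₂⟩ := fills_of_push.{u} k (fun m => K (k - m)) K₁
  refine ⟨K₂, fun M hM => ?_⟩
  obtain ⟨l, hl, hlen⟩ := hM
  have hM : Q.WittIndexGE M (2 * k + 2) := ⟨l, hl, hlen⟩
  obtain ⟨h, l, rfl⟩ := List.exists_cons_of_length_eq_add_one hlen
  obtain ⟨⟨H, h1, h2⟩, -⟩ := mem_hyperbolicLists_of_cons hl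
  have hpos : ∀ s : List (N × N), s ≠ [] → 1 ≤ s.length := fun s hs =>
    List.length_pos_iff.2 hs
  refine hK₂ _ _ _ {a | a.1 ∈ LinearMap.ker (Q.lam h.1) ∧ a.2 ∈ LinearMap.ker (Q.lam h.1)}
    (hyperbolicLists_closed M) subset_rfl (fun s hs hne hsk _ => ?_) ?_
  · have hs1 := hpos s hne
    rw [link_hyperbolicLists _ hs]
    refine hK _ (by omega) _ ?_
    have w1 : Q.WittIndexGE M (2 * k + 2 - s.length + s.length) := hM.mono le_rfl (by omega)
    have w2 := (w1.inf_perpList hsize s hs).mono le_rfl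
      (show 2 * (k - s.length) + 2 + 1 ≤ _ by omega)
    refine (w2.inf_ker hsize (Q.lam h.1)).mono ?_ le_rfl
    exact le_of_eq (inf_right_comm _ _ _)
  · rw [within_hyperbolicLists]
    refine hK₁ _ _ _ {a | a.1 ∈ LinearMap.ker (Q.lam h.2) ∧ a.2 ∈ LinearMap.ker (Q.lam h.2)}
      (hyperbolicLists_closed _) (hyperbolicLists_mono inf_le_left) (fun s hs hne hsk _ => ?_) ?_
    · have hs1 := hpos s hne
      rw [link_hyperbolicLists _ hs]
      refine hK _ (by omega) _ ?_
      have w1 : Q.WittIndexGE (M ⊓ Q.perp h) (2 * k + 1) := WittIndexGE.inf_perp hsize hM H h1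
      -- Here `s` is only orthogonal to `e`. Its projection along `e` is orthogonal to `(e, f)`, and
      -- has the same complement as `s` within the complement of `(e, f)`.
      have hs' := map_projAlong_mem H h1 hs
      have w2 := WittIndexGE.inf_perpList (g := 2 * k + 1 - s.length) hsize _ hs'
        (w1.mono le_rfl (by rw [List.length_map]; omega))
      refine w2.mono ?_ (by omega)
      rintro x ⟨⟨hxM, hx1, hx2⟩, hx⟩
      refine ⟨⟨⟨hxM, hx1⟩, hx2⟩, mem_perpList.2 fun b hb => ?_⟩
      have h3 := mem_perpList.1 hx _ (List.mem_map_of_mem hb)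
      exact ⟨(lam_projAlong_left hx1 _).symm.trans h3.1, (lam_projAlong_left hx1 _).symm.trans h3.2⟩
    · rw [within_hyperbolicLists]
      refine Fills.of_cone h (fun l hl => cons_mem_hyperbolicLists H h1 h2 ?_) k
      exact hyperbolicLists_mono (by rw [inf_assoc]; exact le_rfl) hl

end QuadraticStructure

/-! ### The complex of hyperbolic split injections -/

theorem coordIncl_single (S : Type v) {M : Type u} [Semiring S] [AddCommMonoid M] [Module S M]
    {p : ℕ} (i : Fin (p + 1)) (j : Fin p) (x : M) :
    coordIncl S i (Pi.single j x) = Pi.single (i.succAbove j) x := by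
  funext k
  rcases Fin.eq_self_or_eq_succAbove i k with rfl | ⟨k, rfl⟩
  · rw [coordIncl_same, Pi.single_eq_of_ne (Fin.succAbove_ne k j).symm]
  · rw [coordIncl_succAbove]
    simp [Pi.single_apply]

namespace QuadraticStructure

open ListChain

variable {R : Type u} [CommRing R] {P : FormParameter R} {N : Type u} [AddCommGroup N] [Module R N]
  {Q : QuadraticStructure P N}

section PowerSingle

variable {M : Type u} [AddCommGroup M] [Module R M] (Q' : QuadraticStructure P M)

theorem power_lam_apply (n : ℕ) (x y : Fin n → M) :
    (Q'.power n).lam x y = ∑ i, Q'.lam (x i) (y i) := rfl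

theorem power_mu_apply (n : ℕ) (x : Fin n → M) : (Q'.power n).mu x = ∑ i, Q'.mu (x i) := rfl

theorem power_lam_single_same (n : ℕ) (i : Fin n) (x y : M) :
    (Q'.power n).lam (Pi.single i x) (Pi.single i y) = Q'.lam x y := by
  rw [power_lam_apply, Finset.sum_eq_single i] <;> simp +contextual

theorem power_lam_single_of_ne (n : ℕ) {i j : Fin n} (h : i ≠ j) (x y : M) :
    (Q'.power n).lam (Pi.single i x) (Pi.single j y) = 0 := by
  rw [power_lam_apply]
  refine Finset.sum_eq_zero fun k _ => ?_
  rcases eq_or_ne k i with rfl | hk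
  · rw [Pi.single_eq_of_ne h, map_zero]
  · rw [Pi.single_eq_of_ne hk, map_zero, LinearMap.zero_apply]

theorem power_mu_single (n : ℕ) (i : Fin n) (x : M) :
    (Q'.power n).mu (Pi.single i x) = Q'.mu x := by
  rw [power_mu_apply, Finset.sum_eq_single i]
  · simp
  · intro j _ hj
    rw [Pi.single_eq_of_ne hj, mu_zero]
  · simp

end PowerSingle

theorem hyperbolic_lam_apply (x y : R × R) :
    (hyperbolic P).lam x y = x.1 * y.2 + P.sign * (x.2 * y.1) := rfl

theorem hyperbolic_mu_apply (x : R × R) :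
    (hyperbolic P).mu x = ((x.1 * x.2 : R) : R ⧸ P.subgroup) := rfl

/-- The pairs that are the images of the standard basis under a linear map from `H^p`. -/
def basisPairs {p : ℕ} (f : (Fin p → R × R) →ₗ[R] N) (i : Fin p) : N × N :=
  (f (Pi.single i (1, 0)), f (Pi.single i (0, 1)))

theorem ofFn_basisPairs_mem {p : ℕ} {f : (Fin p → R × R) →ₗ[R] N}
    (hf : IsMorphism ((hyperbolic P).power p) Q f) :
    List.ofFn (basisPairs f) ∈ Q.hyperbolicLists ⊤ := by
  have hmu0 : ((0 : R) : R ⧸ P.subgroup) = 0 := rfl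
  refine ⟨List.pairwise_ofFn.2 fun i j hij => ⟨⟨?_, ?_⟩, ?_, ?_⟩, fun h hh => ?_⟩
  · exact (hf.1 _ _).trans (power_lam_single_of_ne _ _ hij.ne _ _)
  · exact (hf.1 _ _).trans (power_lam_single_of_ne _ _ hij.ne _ _)
  · exact (hf.1 _ _).trans (power_lam_single_of_ne _ _ hij.ne _ _)
  · exact (hf.1 _ _).trans (power_lam_single_of_ne _ _ hij.ne _ _)
  · obtain ⟨i, rfl⟩ := List.mem_ofFn.1 hh
    refine ⟨⟨?_, ?_, ?_, ?_, ?_⟩, trivial, trivial⟩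
    · refine (hf.1 _ _).trans ((power_lam_single_same _ _ _ _ _).trans ?_)
      simp [hyperbolic_lam_apply]
    · refine (hf.1 _ _).trans ((power_lam_single_same _ _ _ _ _).trans ?_)
      simp [hyperbolic_lam_apply]
    · refine (hf.1 _ _).trans ((power_lam_single_same _ _ _ _ _).trans ?_)
      simp [hyperbolic_lam_apply]
    · refine (hf.2 _).trans ((power_mu_single _ _ _ _).trans ?_)
      simp [hyperbolic_mu_apply, hmu0]
    · refine (hf.2 _).trans ((power_mu_single _ _ _ _).trans ?_)
      simp [hyperbolic_mu_apply, hmu0]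

/-- The linear map from `H^p` with prescribed images of the standard basis. -/
def ofPairs {p : ℕ} (g : Fin p → N × N) : (Fin p → R × R) →ₗ[R] N where
  toFun x := ∑ i, ((x i).1 • (g i).1 + (x i).2 • (g i).2)
  map_add' x y := by
    rw [← Finset.sum_add_distrib]
    refine Finset.sum_congr rfl fun i _ => ?_
    simp only [Pi.add_apply, Prod.fst_add, Prod.snd_add, add_smul]
    abel
  map_smul' a x := by
    simp [Finset.smul_sum, mul_smul]

theorem ofPairs_apply {p : ℕ} (g : Fin p → N × N) (x : Fin p → R × R) :
    ofPairs (R := R) g x = ∑ i, ((x i).1 • (g i).1 + (x i).2 • (g i).2) := rfl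

theorem mu_sum {p : ℕ} (v : Fin p → N) (hv : ∀ i j, i ≠ j → Q.lam (v i) (v j) = 0) :
    Q.mu (∑ i, v i) = ∑ i, Q.mu (v i) := by
  suffices h : ∀ s : Finset (Fin p), Q.mu (∑ i ∈ s, v i) = ∑ i ∈ s, Q.mu (v i) from h _
  intro s
  induction s using Finset.induction_on with
  | empty => simp [mu_zero]
  | insert a s ha ih =>
    rw [Finset.sum_insert ha, Finset.sum_insert ha, mu_add_of_lam_eq_zero, ih]
    rw [map_sum]
    exact Finset.sum_eq_zero fun i hi => hv a i fun h => ha (h ▸ hi)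

theorem isMorphism_ofPairs {p : ℕ} {g : Fin p → N × N}
    (hg : List.ofFn g ∈ Q.hyperbolicLists ⊤) :
    IsMorphism ((hyperbolic P).power p) Q (ofPairs g) := by
  have H : ∀ i, Q.IsHyperbolicPair (g i) := fun i => (hg.2 _ (List.mem_ofFn.2 ⟨i, rfl⟩)).1
  have horth : ∀ i j, i ≠ j → Q.Orthogonal (g i) (g j) := by
    intro i j hij
    rcases lt_or_gt_of_ne hij with h | h
    · exact List.pairwise_ofFn.1 hg.1 h
    · exact (List.pairwise_ofFn.1 hg.1 h).symm
  have hlam : ∀ (a b c d : R) (i j : Fin p), i ≠ j →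
      Q.lam (a • (g i).1 + b • (g i).2) (c • (g j).1 + d • (g j).2) = 0 := by
    intro a b c d i j hij
    obtain ⟨⟨h1, h2⟩, h3, h4⟩ := horth i j hij
    change Q.lam _ _ = 0 at h1 h2 h3 h4
    simp [h1, h2, h3, h4]
  constructor
  · intro x y
    rw [ofPairs_apply g x, map_sum, LinearMap.sum_apply, ofPairs_apply, power_lam_apply]
    refine Finset.sum_congr rfl fun i _ => ?_
    rw [map_sum, Finset.sum_eq_single i (fun j _ hj => hlam _ _ _ _ i j hj.symm) (by simp)]
    have e1 : Q.lam (g i).2 (g i).1 = P.sign := by rw [Q.lam_symm, (H i).lam_fst_snd, mul_one]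
    simp only [map_add, map_smul, LinearMap.add_apply, LinearMap.smul_apply, (H i).lam_fst,
      (H i).lam_snd, (H i).lam_fst_snd, e1, smul_eq_mul, hyperbolic_lam_apply]
    ring
  · intro x
    rw [ofPairs_apply, power_mu_apply, mu_sum _ fun i j hij => hlam _ _ _ _ i j hij]
    refine Finset.sum_congr rfl fun i _ => ?_
    have h1 := Q.mu_add ((x i).1 • (g i).1) ((x i).2 • (g i).2)
    rw [Q.mu_smul_eq_zero (H i).mu_fst, Q.mu_smul_eq_zero (H i).mu_snd, sub_zero, sub_zero] at h1
    rw [h1, hyperbolic_mu_apply]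
    simp [(H i).lam_fst_snd, mul_comm]

/-- The complex of hyperbolic split injections is modelled by the lists of mutually orthogonal
hyperbolic pairs. -/
noncomputable def modelsHyperbolic (Q : QuadraticStructure P N) :
    Models (Q.hyperbolicLists ⊤) Q.hyperbolicSplitInjectionComplex where
  nil_mem := ⟨List.Pairwise.nil, by simp⟩
  vert f := basisPairs f.1
  injective p f g h := by
    refine Subtype.ext (LinearMap.pi_ext' fun i => LinearMap.prod_ext ?_ ?_)
    · exact LinearMap.ext_ring (congrArg Prod.fst (congrFun h i))
    · exact LinearMap.ext_ring (congrArg Prod.snd (congrFun h i))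
  vert_mem f := ofFn_basisPairs_mem f.2
  exists_vert g hg := ⟨⟨ofPairs g, isMorphism_ofPairs hg⟩, by
    funext i
    refine Prod.ext ?_ ?_
    · change ofPairs g (Pi.single i (1, 0)) = _
      rw [ofPairs_apply, Finset.sum_eq_single i] <;> simp +contextual
    · change ofPairs g (Pi.single i (0, 1)) = _
      rw [ofPairs_apply, Finset.sum_eq_single i] <;> simp +contextual⟩
  vert_face i f j := by
    refine Prod.ext ?_ ?_
    · exact congrArg f.1 (coordIncl_single R i j _)
    · exact congrArg f.1 (coordIncl_single R i j _)

/-- The hypothesis on `size` is a form of Euclidean division. -/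
theorem hyperbolicSplitInjectionComplex_vanishes {size : R → ℕ}
    (hsize : ∀ a b : R, a ≠ 0 → ∃ c, b + c * a = 0 ∨ size (b + c * a) < size a)
    (P : FormParameter R) (n : ℕ) (q : ℤ) (hq : q ≤ ((n : ℤ) - 4) / 2) :
    (((hyperbolic P).power n).hyperbolicSplitInjectionComplex).RedBoundedCohomologyVanishes q := by
  intro k hk
  refine (modelsHyperbolic _).vanishes (k := k) (fun j hj => ?_) k (by omega)
  obtain ⟨K, hK⟩ := fills_hyperbolicLists (Q := (hyperbolic P).power n) hsize j
  refine ⟨K, hK ⊤ ?_⟩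
  have hid : IsMorphism ((hyperbolic P).power n) ((hyperbolic P).power n) LinearMap.id :=
    ⟨fun _ _ => rfl, fun _ => rfl⟩
  have h : ((hyperbolic P).power n).WittIndexGE ⊤ n :=
    ⟨_, ofFn_basisPairs_mem hid, by simp⟩
  exact h.mono le_rfl (by omega)

end QuadraticStructure

/-! ### Unimodular lists -/

open ListChain MulOpposite

section Unimodular

variable (R : Type u) [Ring R]
variable {M : Type u} [AddCommGroup M] [Module Rᵐᵒᵖ M]
variable {M' : Type u} [AddCommGroup M'] [Module Rᵐᵒᵖ M']

/-- A list of vectors in a right module is unimodular if each vector is taken to `1` by a functional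
that vanishes on the vectors behind it. By elimination, one can then find a system of functionals
that is dual to the list. -/
def ListUnimodular : List M → Prop
  | [] => True
  | v :: l => (∃ f : M →ₗ[Rᵐᵒᵖ] R, f v = 1 ∧ ∀ w ∈ l, f w = 0) ∧ ListUnimodular l

variable {R}

theorem ListUnimodular.sublist {l l' : List M} (h : ListUnimodular R l) (hl : l'.Sublist l) :
    ListUnimodular R l' := by
  induction hl with
  | slnil => trivial
  | cons a _ ih => exact ih h.2
  | cons_cons a hs ih =>
    obtain ⟨⟨f, hf, hf'⟩, h⟩ := h
    exact ⟨⟨f, hf, fun w hw => hf' w (hs.subset hw)⟩, ih h⟩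

theorem ListUnimodular.perm {l l' : List M} (h : ListUnimodular R l) (hl : l.Perm l') :
    ListUnimodular R l' := by
  induction hl with
  | nil => trivial
  | cons a hp ih =>
    obtain ⟨⟨f, hf, hf'⟩, h⟩ := h
    exact ⟨⟨f, hf, fun w hw => hf' w (hp.mem_iff.2 hw)⟩, ih h⟩
  | swap a b l =>
    obtain ⟨⟨f, hf, hf'⟩, ⟨g, hg, hg'⟩, h⟩ := h
    refine ⟨⟨g - g b • f, ?_, fun w hw => ?_⟩, ⟨f, hf, fun w hw => hf' w (by simp [hw])⟩, h⟩
    · simp [hg, hf' a (by simp)]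
    · rcases List.mem_cons.1 hw with rfl | hw
      · simp [hf]
      · simp [hg' w hw, hf' w (by simp [hw])]
  | trans _ _ ih₁ ih₂ => exact ih₂ (ih₁ h)

theorem ListUnimodular.of_map (φ : M →ₗ[Rᵐᵒᵖ] M') {l : List M}
    (h : ListUnimodular R (l.map φ)) : ListUnimodular R l := by
  induction l with
  | nil => trivial
  | cons a l ih =>
    obtain ⟨⟨f, hf, hf'⟩, h⟩ := h
    exact ⟨⟨f ∘ₗ φ, hf, fun w hw => hf' _ (List.mem_map_of_mem hw)⟩, ih h⟩

theorem ListUnimodular.map {φ : M →ₗ[Rᵐᵒᵖ] M'} {ψ : M' →ₗ[Rᵐᵒᵖ] M} (hψ : ∀ x, ψ (φ x) = x)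
    {l : List M} (h : ListUnimodular R l) : ListUnimodular R (l.map φ) := by
  refine ListUnimodular.of_map ψ ?_
  have : ψ ∘ φ = id := funext hψ
  rwa [List.map_map, this, List.map_id]

/-- The map `φ` exhibits `M'` as the quotient of `M` by the free summand spanned by `v`, with
section `ι`. -/
structure SplitQuotient (v : M) (φ : M →ₗ[Rᵐᵒᵖ] M') (ι : M' →ₗ[Rᵐᵒᵖ] M) : Prop where
  map_vec : φ v = 0
  section_map : ∀ x, φ (ι x) = x
  exists_functional : ∃ π : M →ₗ[Rᵐᵒᵖ] R, π v = 1
  exists_sub : ∀ x, ∃ r : Rᵐᵒᵖ, x = ι (φ x) + r • v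

theorem SplitQuotient.unimodular_iff {v : M} {φ : M →ₗ[Rᵐᵒᵖ] M'} {ι : M' →ₗ[Rᵐᵒᵖ] M}
    (H : SplitQuotient v φ ι) {l : List M} :
    ListUnimodular R (l ++ [v]) ↔ ListUnimodular R (l.map φ) := by
  induction l with
  | nil =>
    obtain ⟨π, hπ⟩ := H.exists_functional
    exact ⟨fun _ => trivial, fun _ => ⟨⟨π, hπ, by simp⟩, trivial⟩⟩
  | cons a l ih =>
    refine and_congr ⟨?_, ?_⟩ ih
    · rintro ⟨f, hf, hf'⟩
      have key : ∀ x, f (ι (φ x)) = f x := fun x => by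
        obtain ⟨r, hr⟩ := H.exists_sub x
        conv_rhs => rw [hr, map_add, map_smul, hf' v (by simp), smul_zero, add_zero]
      refine ⟨f ∘ₗ ι, (key a).trans hf, fun w hw => ?_⟩
      obtain ⟨x, hx, rfl⟩ := List.mem_map.1 hw
      exact (key x).trans (hf' x (by simp [hx]))
    · rintro ⟨f, hf, hf'⟩
      refine ⟨f ∘ₗ φ, hf, fun w hw => ?_⟩
      rcases List.mem_append.1 hw with hw | hw
      · exact hf' _ (List.mem_map_of_mem hw)
      · rw [List.mem_singleton.1 hw, LinearMap.comp_apply, H.map_vec, map_zero]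

variable (R) in
/-- The lists of vectors in `A` that form a unimodular list together with the list `v`. -/
def unimodularLists (A : Set M) (v : List M) : Set (List M) :=
  {x | (∀ a ∈ x, a ∈ A) ∧ ListUnimodular R (x ++ v)}

theorem unimodularLists_closed (A : Set M) (v : List M) : Closed (unimodularLists R A v) :=
  fun _ hl _ hl' => ⟨fun a ha => hl.1 a (hl'.subset ha), hl.2.sublist (hl'.append_right v)⟩

theorem within_unimodularLists {A X : Set M} (h : X ⊆ A) (v : List M) :
    within (unimodularLists R A v) X = unimodularLists R X v := by
  ext l
  exact ⟨fun hl => ⟨hl.2, hl.1.2⟩, fun hl => ⟨⟨fun a ha => h (hl.1 a ha), hl.2⟩, hl.1⟩⟩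

theorem link_unimodularLists {A X : Set M} (h : X ⊆ A) {v s : List M}
    (hs : s ∈ unimodularLists R A v) :
    link (unimodularLists R A v) X s = unimodularLists R X (s ++ v) := by
  ext l
  constructor
  · rintro ⟨h1, -, h2⟩
    exact ⟨h1, by rwa [List.append_assoc] at h2⟩
  · rintro ⟨h1, h2⟩
    refine ⟨h1, fun a ha => ?_, by rwa [List.append_assoc]⟩
    rcases List.mem_append.1 ha with ha | ha
    · exact h (h1 a ha)
    · exact hs.1 a ha

theorem fills_unimodularLists_equiv (e : M ≃ₗ[Rᵐᵒᵖ] M') {A : Set M} {A' : Set M'}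
    (hA : ∀ a ∈ A, e a ∈ A') (hA' : ∀ a ∈ A', e.symm a ∈ A) {v : List M} {k : ℕ} {K : ℝ}
    (hK : 0 ≤ K)
    (h : Fills (unimodularLists R A' (v.map e)) (unimodularLists R A' (v.map e)) k K) :
    Fills (unimodularLists R A v) (unimodularLists R A v) k K := by
  refine h.of_retract e e.symm (fun l hl => ⟨?_, ?_⟩) (fun l hl => ⟨?_, ?_⟩) (by simp) hK
  · simpa using fun a ha => hA a (hl.1 a ha)
  · rw [← List.map_append]
    exact hl.2.map (φ := e.toLinearMap) (ψ := e.symm.toLinearMap) (by simp)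
  · intro a ha
    obtain ⟨b, hb, rfl⟩ := List.mem_map.1 ha
    exact hA' b (hl.1 b hb)
  · refine ListUnimodular.of_map e.toLinearMap ?_
    have : (⇑e ∘ ⇑e.symm) = id := by ext; simp
    simpa [List.map_append, List.map_map, this] using hl.2

/-- A vector `v` in the reference list can be removed by passing to the quotient by `v`. -/
theorem SplitQuotient.fills {v : M} {φ : M →ₗ[Rᵐᵒᵖ] M'} {ι : M' →ₗ[Rᵐᵒᵖ] M}
    (H : SplitQuotient v φ ι) {A : Set M} {A' : Set M'} (hA : ∀ a ∈ A, φ a ∈ A')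
    (hA' : ∀ a ∈ A', ι a ∈ A) (hιφ : ∀ a ∈ A, ι (φ a) = a) {w w' : List M}
    (hw : w.Perm (w' ++ [v])) {k : ℕ} {K : ℝ} (hK : 0 ≤ K)
    (h : Fills (unimodularLists R A' (w'.map φ)) (unimodularLists R A' (w'.map φ)) k K) :
    Fills (unimodularLists R A w) (unimodularLists R A w) k K := by
  refine h.of_retract φ ι (fun l hl => ⟨?_, ?_⟩) (fun l hl => ⟨?_, ?_⟩)
    (fun l hl a ha => hιφ a (hl.1 a ha)) hK
  · intro a ha
    obtain ⟨b, hb, rfl⟩ := List.mem_map.1 ha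
    exact hA b (hl.1 b hb)
  · rw [← List.map_append, ← H.unimodular_iff, List.append_assoc]
    exact hl.2.perm (hw.append_left l)
  · intro a ha
    obtain ⟨b, hb, rfl⟩ := List.mem_map.1 ha
    exact hA' b (hl.1 b hb)
  · refine ListUnimodular.perm ?_ (hw.symm.append_left _)
    rw [← List.append_assoc, H.unimodular_iff, List.map_append, List.map_map]
    have : φ ∘ ι = id := funext H.section_map
    rw [this, List.map_id]
    exact hl.2

end Unimodular

/-! ### Stable range -/

section StableRange

variable {R : Type u} [Ring R]

variable (R) in
/-- The right module `N` is free of rank `n`. -/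
def IsFreeOfRank (n : ℕ) (N : Type u) [AddCommGroup N] [Module Rᵐᵒᵖ N] : Prop :=
  Nonempty (N ≃ₗ[Rᵐᵒᵖ] (Fin n → R))

variable {M N Q : Type u} [AddCommGroup M] [Module Rᵐᵒᵖ M] [AddCommGroup N] [Module Rᵐᵒᵖ N]
  [AddCommGroup Q] [Module Rᵐᵒᵖ Q]

/-- The linear map `R → M` with `1 ↦ v`. -/
def ofVector (v : M) : R →ₗ[Rᵐᵒᵖ] M where
  toFun r := op r • v
  map_add' r r' := by rw [op_add, add_smul]
  map_smul' a r := by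
    rw [RingHom.id_apply, smul_smul]
    rfl

theorem ofVector_apply (v : M) (r : R) : ofVector v r = op r • v := rfl

/-- The shear `(x, y) ↦ (x + t y, y)`. -/
def shear (t : Q →ₗ[Rᵐᵒᵖ] N) : (N × Q) ≃ₗ[Rᵐᵒᵖ] (N × Q) where
  toFun x := (x.1 + t x.2, x.2)
  invFun x := (x.1 - t x.2, x.2)
  map_add' x y := by
    refine Prod.ext ?_ rfl
    simp only [Prod.fst_add, Prod.snd_add, map_add]
    abel
  map_smul' a x := by
    refine Prod.ext ?_ rfl
    simp
  left_inv x := by simp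
  right_inv x := by simp

theorem shear_apply (t : Q →ₗ[Rᵐᵒᵖ] N) (x : N × Q) : shear t x = (x.1 + t x.2, x.2) := rfl

theorem shear_symm_apply (t : Q →ₗ[Rᵐᵒᵖ] N) (x : N × Q) :
    (shear t).symm x = (x.1 - t x.2, x.2) := rfl

/-- The splitting of the last coordinate. -/
def snocEquiv (n : ℕ) : (Fin (n + 1) → R) ≃ₗ[Rᵐᵒᵖ] (Fin n → R) × R where
  toFun x := (fun i => x i.castSucc, x (Fin.last n))
  invFun x := Fin.snoc (α := fun _ => R) x.1 x.2
  map_add' _ _ := rfl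
  map_smul' _ _ := rfl
  left_inv x := Fin.snoc_init_self x
  right_inv x := by ext <;> simp

theorem snocEquiv_symm_apply {n : ℕ} (x : (Fin n → R) × R) :
    (snocEquiv n).symm x = Fin.snoc (α := fun _ => R) x.1 x.2 := rfl

theorem IsFreeOfRank.succ {n : ℕ} (h : IsFreeOfRank R (n + 1) N) :
    Nonempty (N ≃ₗ[Rᵐᵒᵖ] (Fin n → R) × R) := by
  obtain ⟨e⟩ := h
  exact ⟨e.trans (snocEquiv n)⟩

theorem IsFreeOfRank.prod {m n : ℕ} (h : IsFreeOfRank R m N) (h' : IsFreeOfRank R n Q) :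
    IsFreeOfRank R (m + n) (N × Q) := by
  obtain ⟨e⟩ := h
  obtain ⟨e'⟩ := h'
  exact ⟨(e.prodCongr e').trans ((LinearEquiv.sumArrowLequivProdArrow (Fin m) (Fin n) Rᵐᵒᵖ R).symm.trans
    (LinearEquiv.funCongrLeft Rᵐᵒᵖ R finSumFinEquiv.symm))⟩

theorem isFreeOfRank_pi (n : ℕ) : IsFreeOfRank R n (Fin n → R) := ⟨LinearEquiv.refl _ _⟩

theorem isFreeOfRank_one : IsFreeOfRank R 1 R := ⟨(LinearEquiv.funUnique (Fin 1) Rᵐᵒᵖ R).symm⟩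

variable (R) in
/-- A coordinate-free form of the stable range condition: for a unimodular vector `(x, r)` in
`R^m × R`, where `m ≥ s`, there is a linear map `t` such that `x + t r` is unimodular. -/
def HasStableRange (s : ℕ) : Prop :=
  ∀ m, s ≤ m → ∀ u : (Fin m → R) × R, ListUnimodular R [u] →
    ∃ t : R →ₗ[Rᵐᵒᵖ] (Fin m → R), ListUnimodular R [u.1 + t u.2]

theorem listUnimodular_singleton {v : M} :
    ListUnimodular R [v] ↔ ∃ f : M →ₗ[Rᵐᵒᵖ] R, f v = 1 := by
  simp [ListUnimodular]

/-- A single vector spans a free direct summand if and only if some functional takes it to `1`. -/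
theorem isUnimodular_iff {m : ℕ} (r : Fin m → R) :
    IsUnimodular Rᵐᵒᵖ ![r] ↔ ListUnimodular R [r] := by
  rw [listUnimodular_singleton]
  have hrange : Set.range ![r] = {r} := by simp
  have hli : LinearIndependent Rᵐᵒᵖ ![r] ↔ ∀ a : Rᵐᵒᵖ, a • r = 0 → a = 0 := by
    rw [Fintype.linearIndependent_iff]
    constructor
    · intro h a ha
      exact h (fun _ => a) (by simpa using ha) 0
    · intro h g hg i
      rw [Subsingleton.elim i 0]
      exact h _ (by simpa using hg)
  rw [IsUnimodular, hli, hrange]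
  constructor
  · rintro ⟨h1, C, hC⟩
    have hinj : Function.Injective (ofVector (R := R) r) := by
      rw [injective_iff_map_eq_zero]
      intro a ha
      exact op_injective (h1 (op a) ha)
    have hr : LinearMap.range (ofVector (R := R) r) = Submodule.span Rᵐᵒᵖ {r} := by
      ext x
      rw [Submodule.mem_span_singleton]
      constructor
      · rintro ⟨a, rfl⟩
        exact ⟨op a, rfl⟩
      · rintro ⟨a, rfl⟩
        exact ⟨unop a, rfl⟩
    rw [← hr] at hC
    let e := LinearEquiv.ofInjective (ofVector (R := R) r) hinj
    refine ⟨e.symm.toLinearMap ∘ₗ Submodule.projectionOnto _ C hC, ?_⟩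
    have hmem : ofVector (R := R) r 1 = r := by simp [ofVector_apply]
    have h2 : Submodule.projectionOnto _ C hC r = e 1 := by
      have h3 := Submodule.projectionOnto_apply_left hC (e 1)
      have h4 : ((e 1 : LinearMap.range (ofVector (R := R) r)) : Fin m → R) = r := hmem
      rwa [h4] at h3
    rw [LinearMap.comp_apply, h2]
    exact e.symm_apply_apply 1
  · rintro ⟨f, hf⟩
    have key : ∀ a : Rᵐᵒᵖ, f (a • r) = unop a := fun a => by
      rw [map_smul, hf, MulOpposite.smul_eq_mul_unop, one_mul]
    refine ⟨fun a ha => ?_, LinearMap.ker f, ?_⟩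
    · have := key a
      rw [ha, map_zero] at this
      exact unop_injective this.symm
    · rw [isCompl_iff, Submodule.disjoint_def, codisjoint_iff, eq_top_iff]
      constructor
      · intro x hx hx'
        obtain ⟨a, rfl⟩ := Submodule.mem_span_singleton.1 hx
        have h1 : unop a = 0 := (key a).symm.trans hx'
        rw [unop_injective (a₂ := 0) h1, zero_smul]
      · intro x _
        have : x = op (f x) • r + (x - op (f x) • r) := by abel
        rw [this]
        refine Submodule.add_mem_sup (Submodule.mem_span_singleton.2 ⟨_, rfl⟩) ?_
        rw [LinearMap.mem_ker, map_sub, key, unop_op, sub_self]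

theorem StableRangeCondition.hasStableRange {s : ℕ} (h : StableRangeCondition R (s + 1)) :
    HasStableRange R s := by
  intro m hm u hu
  have hr : ListUnimodular R [(snocEquiv m).symm u] := by
    refine ListUnimodular.of_map (snocEquiv m).toLinearMap ?_
    simpa using hu
  obtain ⟨t, ht⟩ := h m (by omega) _ ((isUnimodular_iff _).2 hr)
  refine ⟨LinearMap.pi fun i => (t i) • LinearMap.id, ?_⟩
  rw [isUnimodular_iff] at ht
  convert ht using 2
  funext i
  simp [snocEquiv_symm_apply]

theorem hasStableRange_of_stableRank_eq {s : ℕ} (h : stableRank R = (s : ℕ∞)) :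
    1 ≤ s ∧ HasStableRange R s := by
  have h1 : ∃ l : ℕ, 1 ≤ l ∧ StableRangeCondition R (l + 1) ∧ l = s := by
    by_contra hne
    push Not at hne
    have h2 : ((s + 1 : ℕ) : ℕ∞) ≤ stableRank R := by
      refine le_iInf₂ fun l hl => ?_
      have h3 : stableRank R ≤ l := iInf₂_le l hl
      rw [h, Nat.cast_le] at h3
      have h4 := hne l hl.1 hl.2
      exact_mod_cast (by omega : s + 1 ≤ l)
    rw [h, Nat.cast_le] at h2
    omega
  obtain ⟨l, h2, h3, rfl⟩ := h1
  exact ⟨h2, h3.hasStableRange⟩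

/-- Several coordinates of a unimodular vector can be dropped, after adding their images under a
linear map to the other coordinates. -/
theorem HasStableRange.exists_unimodular {s : ℕ} (hs : HasStableRange R s) {m : ℕ} (hm : s ≤ m)
    (hN : IsFreeOfRank R m N) (j : ℕ) : ∀ (Q : Type u) [AddCommGroup Q] [Module Rᵐᵒᵖ Q],
      IsFreeOfRank R j Q → ∀ u : N × Q, ListUnimodular R [u] →
      ∃ t : Q →ₗ[Rᵐᵒᵖ] N, ListUnimodular R [u.1 + t u.2] := by
  induction j with
  | zero =>
    rintro Q _ _ ⟨e⟩ u hu
    have hQ : u.2 = 0 := e.injective (Subsingleton.elim _ _)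
    obtain ⟨f, hf⟩ := listUnimodular_singleton.1 hu
    refine ⟨0, listUnimodular_singleton.2 ⟨f ∘ₗ LinearMap.inl _ N Q, ?_⟩⟩
    have : u = (u.1, 0) := Prod.ext rfl hQ
    rw [this] at hf
    simpa using hf
  | succ j ih =>
    intro Q _ _ hQ u hu
    obtain ⟨e⟩ := hQ.succ
    obtain ⟨a⟩ := hN.prod (isFreeOfRank_pi (R := R) j)
    obtain ⟨f, hf⟩ := listUnimodular_singleton.1 hu
    -- The vector `u` in the coordinates `(N × R^j) × R`.
    obtain ⟨t₁, ht₁⟩ := hs (m + j) (by omega) (a (u.1, (e u.2).1), (e u.2).2)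
      (listUnimodular_singleton.2 ⟨f ∘ₗ LinearMap.prod
        (LinearMap.fst _ N (Fin j → R) ∘ₗ a.symm.toLinearMap ∘ₗ LinearMap.fst _ _ _)
        (e.symm.toLinearMap ∘ₗ LinearMap.prod
          (LinearMap.snd _ N (Fin j → R) ∘ₗ a.symm.toLinearMap ∘ₗ LinearMap.fst _ _ _)
          (LinearMap.snd _ _ _)), by simpa using hf⟩)
    obtain ⟨g, hg⟩ := listUnimodular_singleton.1 ht₁
    let t₁' : R →ₗ[Rᵐᵒᵖ] N × (Fin j → R) := a.symm.toLinearMap ∘ₗ t₁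
    obtain ⟨t₂, ht₂⟩ := ih (Fin j → R) (isFreeOfRank_pi j)
      ((u.1, (e u.2).1) + t₁' (e u.2).2)
      (listUnimodular_singleton.2 ⟨g ∘ₗ a.toLinearMap, by simpa [t₁'] using hg⟩)
    refine ⟨(LinearMap.fst _ _ _ ∘ₗ t₁' ∘ₗ LinearMap.snd _ _ _
      + t₂ ∘ₗ (LinearMap.fst _ _ _ + LinearMap.snd _ _ _ ∘ₗ t₁' ∘ₗ LinearMap.snd _ _ _))
        ∘ₗ e.toLinearMap, ?_⟩
    convert ht₂ using 2
    simp [add_assoc]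

/-- In a free module of rank larger than the stable rank, a unimodular vector has a coordinate `1`
for a suitable basis. -/
theorem HasStableRange.exists_equiv {s : ℕ} (hs : HasStableRange R s) {m : ℕ} (hm : s ≤ m)
    (hN : IsFreeOfRank R (m + 1) N) {x : N} (hx : ListUnimodular R [x]) :
    ∃ e : N ≃ₗ[Rᵐᵒᵖ] R × (Fin m → R), (e x).1 = 1 := by
  obtain ⟨e⟩ := hN.succ
  obtain ⟨t, ht⟩ := hs m hm (e x) (by
    obtain ⟨f, hf⟩ := listUnimodular_singleton.1 hx
    exact listUnimodular_singleton.2 ⟨f ∘ₗ e.symm.toLinearMap, by simpa using hf⟩)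
  obtain ⟨f, hf⟩ := listUnimodular_singleton.1 ht
  refine ⟨((e.trans (shear t)).trans (LinearEquiv.prodComm Rᵐᵒᵖ _ _)).trans
    (shear ((1 - (e x).2) • f)), ?_⟩
  simp [shear_apply, hf]

end StableRange

/-! ### Uniform acyclicity of unimodular lists -/

section VanDerKallen

variable (R : Type u) [Ring R]

/-- Bounded fillings for the lists in the free module `N` of rank `n` that are unimodular together
with a given list of length `k` in a larger free module `N × Q`. -/
def LinearFills (n k l : ℕ) (K : ℝ) : Prop :=
  ∀ (N Q : Type u) [AddCommGroup N] [Module Rᵐᵒᵖ N] [AddCommGroup Q] [Module Rᵐᵒᵖ Q] (j : ℕ),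
    IsFreeOfRank R n N → IsFreeOfRank R j Q → ∀ v : List (N × Q), v.length = k →
    Fills (unimodularLists R {a | a.2 = 0} v) (unimodularLists R {a | a.2 = 0} v) l K

/-- The analogue of `LinearFills` for lists in `N ∪ (N + e)`, where `e` is an additional basis
vector. -/
def AffineFills (n k l : ℕ) (K : ℝ) : Prop :=
  ∀ (N Q : Type u) [AddCommGroup N] [Module Rᵐᵒᵖ N] [AddCommGroup Q] [Module Rᵐᵒᵖ Q] (j : ℕ),
    IsFreeOfRank R n N → IsFreeOfRank R j Q → ∀ v : List (N × (R × Q)), v.length = k →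
    Fills (unimodularLists R {a | a.2 = 0 ∨ a.2 = (1, 0)} v)
      (unimodularLists R {a | a.2 = 0 ∨ a.2 = (1, 0)} v) l K

variable {R}

/-- The quotient by a vector `y` with `π y = 1` is the summand complementary to the coordinate
`π`. -/
theorem SplitQuotient.of_coordinate {M M' : Type u} [AddCommGroup M] [Module Rᵐᵒᵖ M]
    [AddCommGroup M'] [Module Rᵐᵒᵖ M'] {π : M →ₗ[Rᵐᵒᵖ] R} {ρ : M →ₗ[Rᵐᵒᵖ] M'}
    {ι : M' →ₗ[Rᵐᵒᵖ] M} (hρι : ∀ x, ρ (ι x) = x) (hπι : ∀ x, π (ι x) = 0)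
    (hker : ∀ x, π x = 0 → ι (ρ x) = x) {y : M} (hy : π y = 1) :
    SplitQuotient y (ρ ∘ₗ (LinearMap.id - ofVector (R := R) y ∘ₗ π)) ι where
  map_vec := by simp [ofVector_apply, hy]
  section_map x := by simp [hρι, hπι, ofVector_apply]
  exists_functional := ⟨π, hy⟩
  exists_sub x := ⟨op (π x), by
    have h1 : π (x - op (π x) • y) = 0 := by
      rw [map_sub, map_smul, hy, MulOpposite.smul_eq_mul_unop, unop_op, one_mul, sub_self]
    have h2 := hker _ h1
    simp only [LinearMap.comp_apply, LinearMap.sub_apply, LinearMap.id_apply, ofVector_apply]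
    rw [h2, sub_add_cancel]⟩

/-- In `R^{n+1} = N ⊕ R e`, lists are pushed into `N ∪ (N + e)`. The links are affine
families for longer reference lists. -/
theorem exists_linearFills_succ {n k l : ℕ}
    (h : ∀ m ≤ l, ∃ K, 0 ≤ K ∧ AffineFills R n (k + m) (l - m) K) :
    ∃ K, 0 ≤ K ∧ LinearFills R (n + 1) k l K := by
  choose! K hK0 hK using h
  obtain ⟨K', hK', hpush⟩ := fills_of_push.{u} l K (K 0)
  refine ⟨K', hK', fun N Q _ _ _ _ j hN hQ v hv => ?_⟩
  obtain ⟨e⟩ := hN.succ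
  refine fills_unimodularLists_equiv
    ((e.prodCongr (LinearEquiv.refl Rᵐᵒᵖ Q)).trans (LinearEquiv.prodAssoc Rᵐᵒᵖ (Fin n → R) R Q))
    (A' := {a | a.2.2 = 0}) (fun a ha => ha) (fun a ha => ha) hK' ?_
  set v' := v.map ((e.prodCongr (LinearEquiv.refl Rᵐᵒᵖ Q)).trans
    (LinearEquiv.prodAssoc Rᵐᵒᵖ (Fin n → R) R Q)) with hv'
  have hvlen : v'.length = k := by simp [hv', hv]
  have hXA : {a : (Fin n → R) × (R × Q) | a.2 = 0 ∨ a.2 = (1, 0)} ⊆ {a | a.2.2 = 0} := by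
    rintro a (ha | ha)
    · exact congrArg Prod.snd ha
    · exact congrArg Prod.snd ha
  refine hpush _ _ _ {a | a.2 = 0 ∨ a.2 = (1, 0)} (unimodularLists_closed _ _) subset_rfl
    (fun s hs _ hsl _ => ?_) ?_
  · rw [link_unimodularLists hXA hs]
    exact hK _ hsl _ Q j (isFreeOfRank_pi n) hQ _ (by rw [List.length_append, hvlen, add_comm])
  · rw [within_unimodularLists hXA]
    have := hK 0 (Nat.zero_le _) (Fin n → R) Q j (isFreeOfRank_pi n) hQ v' hvlen
    refine this.mono subset_rfl (fun x hx => ⟨fun a ha => hXA (hx.1 a ha), hx.2⟩) le_rfl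

/-- Lists in `N ∪ (N + e)` can be pushed into `N`: the link of a list that starts with a vector `h`
in `N + e` is understood by projecting along `h`. -/
theorem exists_affineFills_zero {n l : ℕ}
    (h : ∀ m, 1 ≤ m → m ≤ l → ∃ K, 0 ≤ K ∧ LinearFills R n (m - 1) (l - m) K) :
    ∃ K, 0 ≤ K ∧ AffineFills R n 0 l K := by
  choose! K hK0 hK using h
  obtain ⟨K', hK', hpush⟩ := fills_of_push.{u} l K 1
  refine ⟨K', hK', fun N Q _ _ _ _ j hN hQ v hv => ?_⟩
  obtain rfl := List.length_eq_zero_iff.1 hv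
  have hXA : {a : N × (R × Q) | a.2 = 0} ⊆ {a | a.2 = 0 ∨ a.2 = (1, 0)} := fun a ha => Or.inl ha
  refine hpush _ _ _ {a | a.2 = 0} (unimodularLists_closed _ _) subset_rfl
    (fun s hs hne hsl hsX => ?_) ?_
  · rw [link_unimodularLists hXA hs, List.append_nil]
    obtain ⟨y, t, rfl⟩ := List.exists_cons_of_ne_nil hne
    have hy : y.2 = (1, 0) := (hs.1 y (by simp)).resolve_left (hsX y t rfl)
    let π : N × (R × Q) →ₗ[Rᵐᵒᵖ] R := LinearMap.fst _ _ _ ∘ₗ LinearMap.snd _ _ _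
    let ρ : N × (R × Q) →ₗ[Rᵐᵒᵖ] N × Q :=
      LinearMap.prod (LinearMap.fst _ _ _) (LinearMap.snd _ _ _ ∘ₗ LinearMap.snd _ _ _)
    let ι : N × Q →ₗ[Rᵐᵒᵖ] N × (R × Q) :=
      LinearMap.prod (LinearMap.fst _ _ _) (LinearMap.inr _ _ _ ∘ₗ LinearMap.snd _ _ _)
    have H := SplitQuotient.of_coordinate (π := π) (ρ := ρ) (ι := ι) (fun _ => rfl) (fun _ => rfl)
      (fun x hx => Prod.ext rfl (Prod.ext (Eq.symm hx) rfl)) (y := y) (congrArg Prod.fst hy)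
    have hX : ∀ a : N × (R × Q), a.2 = 0 →
        (ρ ∘ₗ (LinearMap.id - ofVector (R := R) y ∘ₗ π)) a = (a.1, 0) := by
      intro a ha
      have : π a = 0 := congrArg Prod.fst ha
      simp only [LinearMap.comp_apply, LinearMap.sub_apply, LinearMap.id_apply, this, map_zero,
        sub_zero]
      have h2 : a.2.2 = 0 := congrArg Prod.snd ha
      exact Prod.ext rfl h2
    refine H.fills (A := {a | a.2 = 0}) (A' := {a | a.2 = 0}) (w' := t) (fun a ha => ?_)
      (fun a ha => ?_) (fun a ha => ?_) (List.perm_append_singleton y t).symm (hK0 _ (by simp) hsl) ?_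
    · rw [hX a ha]; rfl
    · exact Prod.ext rfl ha
    · rw [hX a ha]
      exact Prod.ext rfl ha.symm
    · exact hK _ (by simp) hsl N Q j hN hQ _ (by simp)
  · rw [within_unimodularLists hXA]
    refine Fills.of_cone ((0, (1, 0)) : N × (R × Q)) (fun x hx => ?_) l
    refine ⟨?_, ?_⟩
    · intro a ha
      rcases List.mem_cons.1 ha with rfl | ha
      · exact Or.inr rfl
      · exact Or.inl (hx.1 a ha)
    · refine ⟨⟨LinearMap.fst _ _ _ ∘ₗ LinearMap.snd _ _ _, rfl, fun w hw => ?_⟩, hx.2⟩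
      have hw : w ∈ x ++ [] := hw
      rw [List.append_nil] at hw
      exact congrArg Prod.fst (hx.1 w hw)

/-- By the stable range condition one can choose coordinates of `N` and `e` such that the first
vector `y` of the reference list has a coordinate `1`. Lists in `N ∪ (N + e)` can be pushed into the
vectors for which this coordinate vanishes, and there projection along `y` removes `y` from the
reference list. -/
theorem exists_affineFills_succ {s : ℕ} (hs : HasStableRange R s) {n k l : ℕ} (hn : s ≤ n)
    (h : ∀ m ≤ l, ∃ K, 0 ≤ K ∧ AffineFills R n (k + m) (l - m) K) :
    ∃ K, 0 ≤ K ∧ AffineFills R (n + 1) (k + 1) l K := by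
  choose! K hK0 hK using h
  obtain ⟨K', hK', hpush⟩ := fills_of_push.{u} l K (K 0)
  refine ⟨K', hK', fun N Q _ _ _ _ j hN hQ v hv => ?_⟩
  by_cases hv' : ListUnimodular R v
  swap
  · exact Fills.of_isEmpty (fun x hx => hv' (hx.2.sublist (List.sublist_append_right _ _))) _ _
  obtain ⟨y₀, w₀, rfl⟩ := List.exists_cons_of_length_eq_add_one hv
  obtain ⟨t, ht⟩ := hs.exists_unimodular (hn.trans (Nat.le_succ n)) hN _ _
    (isFreeOfRank_one.prod hQ) y₀ (hv'.sublist (List.singleton_sublist.2 (by simp)))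
  obtain ⟨e, he⟩ := hs.exists_equiv hn hN ht
  let E : (N × (R × Q)) ≃ₗ[Rᵐᵒᵖ] (R × (Fin n → R)) × (R × Q) :=
    (shear t).trans (e.prodCongr (LinearEquiv.refl Rᵐᵒᵖ (R × Q)))
  refine fills_unimodularLists_equiv E (A' := {a | a.2 = 0 ∨ a.2 = (1, 0)})
    (fun a ha => ha) (fun a ha => ha) hK' ?_
  rw [List.map_cons]
  set y := E y₀ with hy
  have hy1 : y.1.1 = 1 := he
  set w := w₀.map E with hw
  have hwlen : w.length = k := by simpa [hw] using hv
  let X : Set ((R × (Fin n → R)) × (R × Q)) := {a | a.1.1 = 0 ∧ (a.2 = 0 ∨ a.2 = (1, 0))}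
  have hXA : X ⊆ {a | a.2 = 0 ∨ a.2 = (1, 0)} := fun a ha => ha.2
  let π : (R × (Fin n → R)) × (R × Q) →ₗ[Rᵐᵒᵖ] R := LinearMap.fst _ _ _ ∘ₗ LinearMap.fst _ _ _
  let ρ : (R × (Fin n → R)) × (R × Q) →ₗ[Rᵐᵒᵖ] (Fin n → R) × (R × Q) :=
    LinearMap.prod (LinearMap.snd _ _ _ ∘ₗ LinearMap.fst _ _ _) (LinearMap.snd _ _ _)
  let ι : (Fin n → R) × (R × Q) →ₗ[Rᵐᵒᵖ] (R × (Fin n → R)) × (R × Q) :=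
    LinearMap.prod (LinearMap.inr _ _ _ ∘ₗ LinearMap.fst _ _ _) (LinearMap.snd _ _ _)
  have H := SplitQuotient.of_coordinate (π := π) (ρ := ρ) (ι := ι) (fun _ => rfl) (fun _ => rfl)
    (fun x hx => Prod.ext (Prod.ext (Eq.symm hx) rfl) rfl) (y := y) hy1
  have hX : ∀ a ∈ X, (ρ ∘ₗ (LinearMap.id - ofVector (R := R) y ∘ₗ π)) a = (a.1.2, a.2) := by
    intro a ha
    have : π a = 0 := ha.1
    simp only [LinearMap.comp_apply, LinearMap.sub_apply, LinearMap.id_apply, this, map_zero,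
      sub_zero]
    rfl
  have key : ∀ s : List ((R × (Fin n → R)) × (R × Q)), s.length ≤ l →
      Fills (unimodularLists R X (s ++ y :: w)) (unimodularLists R X (s ++ y :: w))
        (l - s.length) (K s.length) := by
    intro s hsl
    refine H.fills (A := X) (A' := {a | a.2 = 0 ∨ a.2 = (1, 0)}) (w' := s ++ w) (fun a ha => ?_)
      (fun a ha => ⟨rfl, ha⟩) (fun a ha => ?_) ?_ (hK0 _ hsl) ?_
    · rw [hX a ha]; exact ha.2
    · rw [hX a ha]
      exact Prod.ext (Prod.ext ha.1.symm rfl) rfl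
    · rw [List.append_assoc]
      exact (List.perm_append_singleton y w).symm.append_left s
    · exact hK _ hsl _ Q j (isFreeOfRank_pi n) hQ _ (by simp [hwlen, add_comm])
  refine hpush _ _ _ X (unimodularLists_closed _ _) subset_rfl (fun s hs _ hsl _ => ?_) ?_
  · rw [link_unimodularLists hXA hs]
    exact key s hsl
  · rw [within_unimodularLists hXA]
    exact (key [] (Nat.zero_le _)).mono subset_rfl
      (fun x hx => ⟨fun a ha => hXA (hx.1 a ha), hx.2⟩) le_rfl

/-- The base case on the boundary of the stable range: there is a vector of `N + e` that is
unimodular together with the single reference vector. -/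
theorem affineFills_one_zero {n : ℕ} (hs : HasStableRange R n) : AffineFills R n 1 0 1 := by
  intro N Q _ _ _ _ j hN hQ v hv
  by_cases hv' : ListUnimodular R v
  swap
  · exact Fills.of_isEmpty (fun x hx => hv' (hx.2.sublist (List.sublist_append_right _ _))) _ _
  obtain ⟨y, rfl⟩ := List.length_eq_one_iff.1 hv
  obtain ⟨t, ht⟩ := hs.exists_unimodular le_rfl hN _ _ (isFreeOfRank_one.prod hQ) y hv'
  obtain ⟨f, hf⟩ := listUnimodular_singleton.1 ht
  refine fills_unimodularLists_equiv (shear t) (A' := {a | a.2 = 0 ∨ a.2 = (1, 0)})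
    (fun a ha => ha) (fun a ha => ha) zero_le_one ?_
  refine Fills.zero_of_mem (a := (0, (1, 0))) ⟨?_, ?_⟩
  · intro a ha
    rw [List.mem_singleton.1 ha]
    exact Or.inr rfl
  · refine ListUnimodular.perm (l := [shear t y, (0, (1, 0))]) ?_ (List.Perm.swap _ _ _)
    refine ⟨⟨f ∘ₗ LinearMap.fst _ _ _, hf, fun w hw => ?_⟩,
      ⟨LinearMap.fst _ _ _ ∘ₗ LinearMap.snd _ _ _, rfl, by simp⟩, trivial⟩
    rw [List.mem_singleton.1 hw]
    simp

/-- The simultaneous induction on the rank that proves uniform acyclicity for the linear and the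
affine families. The bound for the affine family is better by one. -/
theorem exists_fills {s : ℕ} (hs1 : 1 ≤ s) (hs : HasStableRange R s) (n : ℕ) :
    (∀ k l, l + k + s ≤ n → ∃ K, 0 ≤ K ∧ LinearFills R n k l K) ∧
      ∀ k l, l + k + s ≤ n + 1 → ∃ K, 0 ≤ K ∧ AffineFills R n k l K := by
  induction n with
  | zero =>
    refine ⟨fun k l h => by omega, fun k l h => ?_⟩
    obtain rfl : k = 0 := by omega
    exact exists_affineFills_zero fun m h1 h2 => by omega
  | succ n ih =>
    have hlin : ∀ k l, l + k + s ≤ n + 1 → ∃ K, 0 ≤ K ∧ LinearFills R (n + 1) k l K := fun k l h =>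
      exists_linearFills_succ fun m hm => ih.2 _ _ (by omega)
    refine ⟨hlin, fun k l h => ?_⟩
    rcases k with _ | k
    · exact exists_affineFills_zero fun m h1 h2 => hlin _ _ (by omega)
    · rcases Nat.lt_or_ge n s with hns | hns
      · obtain rfl : s = n + 1 := by omega
        obtain rfl : k = 0 := by omega
        obtain rfl : l = 0 := by omega
        exact ⟨1, zero_le_one, affineFills_one_zero hs⟩
      · exact exists_affineFills_succ hs hns fun m hm => ih.2 _ _ (by omega)

/-! ### The complex of split injections -/

/-- A list is unimodular if and only if it has a dual system of functionals. -/
theorem listUnimodular_ofFn_iff {M : Type u} [AddCommGroup M] [Module Rᵐᵒᵖ M] {k : ℕ}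
    (w : Fin k → M) : ListUnimodular R (List.ofFn w) ↔
      ∃ g : Fin k → M →ₗ[Rᵐᵒᵖ] R, ∀ i j, g i (w j) = if i = j then 1 else 0 := by
  induction k with
  | zero => exact ⟨fun _ => ⟨fun _ => 0, fun i => i.elim0⟩, fun _ => by simp [ListUnimodular]⟩
  | succ k ih =>
    rw [List.ofFn_succ]
    constructor
    · rintro ⟨⟨f, hf, hf'⟩, h⟩
      obtain ⟨g, hg⟩ := (ih _).1 h
      have hf0 : ∀ j : Fin k, f (w j.succ) = 0 := fun j => hf' _ (List.mem_ofFn.2 ⟨j, rfl⟩)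
      refine ⟨Fin.cons f fun i => g i - g i (w 0) • f, fun i j => ?_⟩
      refine Fin.cases ?_ (fun i => ?_) i <;> refine Fin.cases ?_ (fun j => ?_) j
      · simp [hf]
      · simp [hf0, (Fin.succ_ne_zero j).symm]
      · simp [hf]
      · simp [hf0, hg]
    · rintro ⟨g, hg⟩
      refine ⟨⟨g 0, by simp [hg], fun x hx => ?_⟩, (ih _).2 ⟨fun i => g i.succ, fun i j => ?_⟩⟩
      · obtain ⟨j, rfl⟩ := List.mem_ofFn.1 hx
        simp [hg, (Fin.succ_ne_zero j).symm]
      · simp [hg]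

theorem linearMap_apply_eq_sum {M : Type u} [AddCommGroup M] [Module Rᵐᵒᵖ M] {k : ℕ}
    (f : (Fin k → R) →ₗ[Rᵐᵒᵖ] M) (x : Fin k → R) : f x = ∑ i, op (x i) • f (Pi.single i 1) := by
  conv_lhs => rw [← Finset.univ_sum_single x]
  rw [map_sum]
  refine Finset.sum_congr rfl fun i _ => ?_
  rw [← map_smul, ← Pi.single_smul]
  simp

theorem isSplitInjective_iff {M : Type u} [AddCommGroup M] [Module Rᵐᵒᵖ M] {k : ℕ}
    (f : (Fin k → R) →ₗ[Rᵐᵒᵖ] M) :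
    IsSplitInjective f ↔ ListUnimodular R (List.ofFn fun i => f (Pi.single i 1)) := by
  rw [listUnimodular_ofFn_iff]
  constructor
  · rintro ⟨g, hg⟩
    refine ⟨fun i => LinearMap.proj i ∘ₗ g, fun i j => ?_⟩
    have : g (f (Pi.single j 1)) = Pi.single j 1 := LinearMap.congr_fun hg _
    simp [this, Pi.single_apply]
  · rintro ⟨g, hg⟩
    refine ⟨LinearMap.pi g, LinearMap.ext fun x => funext fun i => ?_⟩
    rw [LinearMap.comp_apply, linearMap_apply_eq_sum f x, LinearMap.pi_apply, map_sum]
    simp [hg]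

/-- The complex of split injections is modelled by the unimodular lists. -/
noncomputable def modelsSplitInjection (n : ℕ) :
    Models {l : List (Fin n → R) | ListUnimodular R l} (splitInjectionComplex R n) where
  nil_mem := trivial
  vert f i := f.1 (Pi.single i 1)
  injective p f g h := by
    refine Subtype.ext (LinearMap.ext fun x => ?_)
    rw [linearMap_apply_eq_sum f.1, linearMap_apply_eq_sum g.1]
    exact Finset.sum_congr rfl fun i _ => congrArg _ (congrFun h i)
  vert_mem f := (isSplitInjective_iff f.1).1 f.2
  exists_vert {p} g hg := by
    let f : (Fin (p + 1) → R) →ₗ[Rᵐᵒᵖ] (Fin n → R) :=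
      ∑ i, ofVector (R := R) (g i) ∘ₗ LinearMap.proj i
    have hf : (fun i => f (Pi.single i 1)) = g := by
      funext i
      simp only [f, LinearMap.sum_apply, LinearMap.comp_apply, LinearMap.proj_apply]
      rw [Finset.sum_eq_single i]
      · simp [ofVector_apply]
      · intro j _ hj
        rw [Pi.single_eq_of_ne hj, map_zero]
      · simp
    exact ⟨⟨f, (isSplitInjective_iff f).2 (by rw [hf]; exact hg)⟩, hf⟩
  vert_face i f j := congrArg f.1 (coordIncl_single Rᵐᵒᵖ i j _)

theorem splitInjectionComplex_vanishes (n : ℕ) {s : ℕ} (hs : stableRank R = (s : ℕ∞)) (q : ℤ)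
    (hq : q ≤ (n : ℤ) - (s : ℤ) - 1) :
    (splitInjectionComplex R n).RedBoundedCohomologyVanishes q := by
  obtain ⟨hs1, hs'⟩ := hasStableRange_of_stableRank_eq hs
  intro k hk
  refine (modelsSplitInjection n).vanishes (k := k) (fun l hl => ?_) k (by omega)
  obtain ⟨K, hK0, hK⟩ := (exists_fills hs1 hs' n).1 0 l (by omega)
  refine ⟨K, (hK (Fin n → R) (Fin 0 → R) 0 (isFreeOfRank_pi n) (isFreeOfRank_pi 0) [] rfl
    ).of_retract (LinearMap.inl Rᵐᵒᵖ _ _) (LinearMap.fst Rᵐᵒᵖ _ _) (fun x hx => ⟨?_, ?_⟩)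
    (fun x hx => ?_) (by simp) hK0⟩
  · intro a ha
    obtain ⟨b, -, rfl⟩ := List.mem_map.1 ha
    rfl
  · rw [List.append_nil]
    exact ListUnimodular.map (ψ := LinearMap.fst _ _ _) (fun _ => rfl) hx
  · refine ListUnimodular.of_map (LinearMap.inl Rᵐᵒᵖ (Fin n → R) (Fin 0 → R)) ?_
    have h1 := hx.2
    rw [List.append_nil] at h1
    rw [List.map_map]
    refine (congrArg (ListUnimodular R) ?_).mpr h1
    conv_rhs => rw [← List.map_id x]
    exact List.map_congr_left fun a ha => Prod.ext rfl (hx.1 a ha).symm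

end VanDerKallen

theorem theoremA :
    (∀ (F : Type u) [Field F] (n : ℕ), 1 ≤ n → ∀ q : ℤ, q ≠ (n : ℤ) - 2 →
      (orderComplex (TitsBuildingA F n)).RedBoundedCohomologyVanishes q) ∧
    (∀ (R : Type u) [Ring R] (n s : ℕ), stableRank R = (s : ℕ∞) →
      ∀ q : ℤ, q ≤ (n : ℤ) - (s : ℤ) - 1 →
      (splitInjectionComplex R n).RedBoundedCohomologyVanishes q) ∧
    (∀ (F : Type u) [Field F] (n : ℕ) (q : ℤ), q ≠ (n : ℤ) - 1 →
      (orderComplex (TitsBuildingC F n)).RedBoundedCohomologyVanishes q) ∧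
    (∀ (P : FormParameter ℤ) (n : ℕ) (q : ℤ), q ≤ ((n : ℤ) - 4) / 2 →
      (((QuadraticStructure.hyperbolic P).power n).hyperbolicSplitInjectionComplex
        ).RedBoundedCohomologyVanishes q) ∧
    (∀ (K : Type u) [Field K] [CharZero K] (P : FormParameter K) (n : ℕ) (q : ℤ),
      q ≤ ((n : ℤ) - 4) / 2 →
      (((QuadraticStructure.hyperbolic P).power n).hyperbolicSplitInjectionComplex
        ).RedBoundedCohomologyVanishes q) := by
  refine ⟨fun F _ n hn q hq => ListChain.titsBuildingA_vanishes F n hn q hq,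
    fun R _ n s hs q hq => splitInjectionComplex_vanishes n hs q hq,
    fun F _ n q hq => ListChain.titsBuildingC_vanishes F n q hq, fun P n q hq => ?_,
    fun K _ _ P n q hq => ?_⟩
  · -- Division with remainder in `ℤ`.
    refine QuadraticStructure.hyperbolicSplitInjectionComplex_vanishes (size := Int.natAbs)
      (fun a b ha => ⟨-(b / a), Or.inr ?_⟩) P n q hq
    have h1 := Int.emod_nonneg b ha
    have h2 := Int.emod_lt_abs b ha
    rw [Int.abs_eq_natAbs] at h2
    have h3 : b + -(b / a) * a = b % a := by
      have := Int.mul_ediv_add_emod b a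
      linear_combination -this
    rw [h3]
    omega
  · refine QuadraticStructure.hyperbolicSplitInjectionComplex_vanishes (size := fun _ => 0)
      (fun a b ha => ⟨-(b / a), Or.inl ?_⟩) P n q hq
    field_simp
    ring
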